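/- Let $n\ge 3$, let $M$ be a smooth $n$-dimensional manifold, let $\alpha=\sqrt{a_{ij}(x)y^iy^j}$ be a smooth Riemannian metric and $\beta=b_i(x)y^i$ a smooth nowhere vanishing $1$-form on $M$, and let $m\in\mathbb R$ with $m\ne 0,1,-1$. Let $F=\alpha^{1-m}\beta^m$ be the corresponding $m$-Kropina metric, defined on the tangent vectors $y$ with $\beta(y)>0$. Put $g_{ij}=\frac12[F^2]_{y^iy^j}$, $y_k=g_{ik}y^i$ and, where $(g_{ij})$ is nondegenerate, with $(g^{ij})=(g_{ij})^{-1}$, $$G^i=\tfrac14 g^{il}\big\{[F^2]_{x^ky^l}y^k-[F^2]_{x^l}\big\},\qquad R^i_{\ k}=2\frac{\partial G^i}{\partial x^k}-y^j\frac{\partial^2G^i}{\partial x^j\partial y^k}+2G^j\frac{\partial^2G^i}{\partial y^j\partial y^k}-\frac{\partial G^i}{\partial y^j}\frac{\partial G^j}{\partial y^k}.$$ $F$ is said to be of scalar flag curvature if there is a function $K=K(x,y)$ of tangent vectors such that $R^i_{\ k}=K\,(F^2\delta^i_k-y^iy_k)$ at all $y$ with $\beta(y)>0$ at which $(g_{ij})$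 is nondegenerate. Then $F$ is of scalar flag curvature if and only if $F$ can be written in the form $$F=\widetilde\alpha^{\,1-m}\widetilde\beta^{\,m}$$ (with the same domain), where $\widetilde\alpha$ is a smooth flat Riemannian metric on $M$ and $\widetilde\beta$ is a smooth $1$-form on $M$ that is parallel with respect to $\widetilde\alpha$ and has constant length $\|\widetilde\beta\|_{\widetilde\alpha}=1$. Moreover, for every such pair $(\widetilde\alpha,\widetilde\beta)$: $F$ is locally Minkowskian, that is, around every point there are local coordinates in which $F(x,y)$ does not depend on $x$; around every point there are local coordinates in which $\widetilde\alpha=|y|$ and $\widetilde\beta=y^1$; and there is a smooth function $c=c(x)>0$ on $M$ such that $$\alpha=c^{-m}\widetilde\alpha,\qquad \beta=c^{1-m}\widetilde\beta .$$ -/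

import Mathlib

open scoped Manifold ContDiff Bundle

noncomputable section

namespace MKropina

/-! ### Riemannian metrics and one-forms on a smooth manifold -/

section Basic

variable {n : ℕ} {M : Type*} [TopologicalSpace M] [ChartedSpace (EuclideanSpace ℝ (Fin n)) M]
  [IsManifold (𝓡 n) ∞ M]

variable (n M) in
/-- A smooth Riemannian metric on the `n`-dimensional manifold `M`. -/
abbrev RiemMetric :=
  Bundle.ContMDiffRiemannianMetric (𝓡 n) ∞ (EuclideanSpace ℝ (Fin n))
    (fun p : M => TangentSpace (𝓡 n) p)

variable (n M) in
/-- A smooth differential one-form on the `n`-dimensional manifold `M`. -/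
structure OneForm where
  /-- The value of the form at a point. -/
  form (p : M) : TangentSpace (𝓡 n) p →L[ℝ] ℝ
  smooth : ContMDiff (𝓡 n) ((𝓡 n).prod 𝓘(ℝ, EuclideanSpace ℝ (Fin n) →L[ℝ] ℝ)) ∞
    (fun p => Bundle.TotalSpace.mk' (EuclideanSpace ℝ (Fin n) →L[ℝ] ℝ)
      (E := fun p : M => TangentSpace (𝓡 n) p →L[ℝ] ℝ) p (form p))

/-- The length `α(v) = √(a_{ij} v^i v^j)` of a tangent vector. -/
def length (α : RiemMetric n M) (p : M) (v : TangentSpace (𝓡 n) p) : ℝ :=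
  √(α.inner p v v)

/-! ### Local coordinates -/

variable (n M) in
/-- `e` is a smooth local coordinate system of `M`: its points have coordinates `x ∈ e.target`. -/
def IsCoord (e : OpenPartialHomeomorph M (EuclideanSpace ℝ (Fin n))) : Prop :=
  e ∈ IsManifold.maximalAtlas (𝓡 n) ∞ M

/-- The tangent vector `y^i ∂/∂x^i` at the point with coordinates `x`. -/
def coordVec (e : OpenPartialHomeomorph M (EuclideanSpace ℝ (Fin n)))
    (x y : EuclideanSpace ℝ (Fin n)) : TangentSpace (𝓡 n) (e.symm x) :=
  mfderiv (𝓡 n) (𝓡 n) e.symm x y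

/-- The `i`-th vector of the standard basis of `ℝⁿ`. -/
def stdVec (i : Fin n) : EuclideanSpace ℝ (Fin n) := EuclideanSpace.single i 1

/-- The partial derivative `∂f/∂x^k` of a function on `ℝⁿ`. -/
def pd (k : Fin n) (f : EuclideanSpace ℝ (Fin n) → ℝ) (x : EuclideanSpace ℝ (Fin n)) : ℝ :=
  fderiv ℝ f x (stdVec k)

/-- The matrix `a_{ij}(x)` of a Riemannian metric in local coordinates. -/
def coeffA (α : RiemMetric n M) (e : OpenPartialHomeomorph M (EuclideanSpace ℝ (Fin n)))
    (x : EuclideanSpace ℝ (Fin n)) : Matrix (Fin n) (Fin n) ℝ :=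
  Matrix.of fun i j => α.inner (e.symm x) (coordVec e x (stdVec i)) (coordVec e x (stdVec j))

/-- The components `b_i(x)` of a one-form in local coordinates. -/
def coeffB (β : OneForm n M) (e : OpenPartialHomeomorph M (EuclideanSpace ℝ (Fin n)))
    (i : Fin n) (x : EuclideanSpace ℝ (Fin n)) : ℝ :=
  β.form (e.symm x) (coordVec e x (stdVec i))

/-- The Christoffel symbols
`Γ^k_{ij} = ½ a^{kl} (∂_i a_{lj} + ∂_j a_{li} - ∂_l a_{ij})` of a Riemannian metric. -/
def christoffel (α : RiemMetric n M) (e : OpenPartialHomeomorph M (EuclideanSpace ℝ (Fin n)))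
    (k i j : Fin n) (x : EuclideanSpace ℝ (Fin n)) : ℝ :=
  1 / 2 * ∑ l, (coeffA α e x)⁻¹ k l *
    (pd i (fun z => coeffA α e z l j) x + pd j (fun z => coeffA α e z l i) x
      - pd l (fun z => coeffA α e z i j) x)

/-- The Riemann curvature tensor
`∂_i Γ^l_{jk} - ∂_j Γ^l_{ik} + Γ^l_{ip} Γ^p_{jk} - Γ^l_{jp} Γ^p_{ik}` of a Riemannian metric. -/
def riemTensor (α : RiemMetric n M) (e : OpenPartialHomeomorph M (EuclideanSpace ℝ (Fin n)))
    (l k i j : Fin n) (x : EuclideanSpace ℝ (Fin n)) : ℝ :=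
  pd i (christoffel α e l j k) x - pd j (christoffel α e l i k) x
    + ∑ p, (christoffel α e l i p x * christoffel α e p j k x
      - christoffel α e l j p x * christoffel α e p i k x)

/-- A Riemannian metric is flat if its curvature tensor vanishes. -/
def IsFlat (α : RiemMetric n M) : Prop :=
  ∀ e, IsCoord n M e → ∀ x ∈ e.target, ∀ l k i j, riemTensor α e l k i j x = 0

/-- `β` is parallel with respect to `α`: `b_{i|j} = ∂_j b_i - Γ^k_{ij} b_k = 0`. -/
def IsParallel (α : RiemMetric n M) (β : OneForm n M) : Prop :=
  ∀ e, IsCoord n M e → ∀ x ∈ e.target, ∀ i j,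
    pd j (coeffB β e i) x - ∑ k, christoffel α e k i j x * coeffB β e k x = 0

/-- `β` has constant length one with respect to `α`: `a^{ij} b_i b_j = 1`. -/
def HasUnitLength (α : RiemMetric n M) (β : OneForm n M) : Prop :=
  ∀ e, IsCoord n M e → ∀ x ∈ e.target,
    ∑ i, ∑ j, (coeffA α e x)⁻¹ i j * coeffB β e i x * coeffB β e j x = 1

end Basic

/-! ### The spray and the Riemann curvature of a Finsler function `F(x, y)` on `ℝⁿ` -/

section Local

variable {n : ℕ}

/-- The partial derivative `∂f/∂x^k` of a function `f(x, y)`. -/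
def pdx (k : Fin n) (f : EuclideanSpace ℝ (Fin n) → EuclideanSpace ℝ (Fin n) → ℝ)
    (x y : EuclideanSpace ℝ (Fin n)) : ℝ :=
  pd k (fun z => f z y) x

/-- The partial derivative `∂f/∂y^k` of a function `f(x, y)`. -/
def pdy (k : Fin n) (f : EuclideanSpace ℝ (Fin n) → EuclideanSpace ℝ (Fin n) → ℝ)
    (x y : EuclideanSpace ℝ (Fin n)) : ℝ :=
  pd k (fun z => f x z) y

variable (F : EuclideanSpace ℝ (Fin n) → EuclideanSpace ℝ (Fin n) → ℝ)

/-- The function `F²`. -/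
def energy (x y : EuclideanSpace ℝ (Fin n)) : ℝ := F x y ^ 2

/-- The fundamental tensor `g_{ij} = (½ F²)_{y^i y^j}`. -/
def fundTensor (x y : EuclideanSpace ℝ (Fin n)) : Matrix (Fin n) (Fin n) ℝ :=
  Matrix.of fun i j => 1 / 2 * pdy j (pdy i (energy F)) x y

/-- The spray coefficients `G^i = ¼ g^{il} ([F²]_{x^k y^l} y^k - [F²]_{x^l})`. -/
def spray (i : Fin n) (x y : EuclideanSpace ℝ (Fin n)) : ℝ :=
  1 / 4 * ∑ l, (fundTensor F x y)⁻¹ i l *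
    (∑ k, pdy l (pdx k (energy F)) x y * y k - pdx l (energy F) x y)

/-- The Riemann curvature
`R^i_k = 2 ∂G^i/∂x^k - y^j ∂²G^i/∂x^j∂y^k + 2 G^j ∂²G^i/∂y^j∂y^k - ∂G^i/∂y^j ∂G^j/∂y^k`. -/
def riemCurv (i k : Fin n) (x y : EuclideanSpace ℝ (Fin n)) : ℝ :=
  2 * pdx k (spray F i) x y - ∑ j, y j * pdy k (pdx j (spray F i)) x y
    + 2 * ∑ j, spray F j x y * pdy k (pdy j (spray F i)) x y
    - ∑ j, pdy j (spray F i) x y * pdy k (spray F j) x y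

/-- The covector `y_k = (½ F²)_{y^i y^k} y^i`. -/
def lowered (k : Fin n) (x y : EuclideanSpace ℝ (Fin n)) : ℝ :=
  ∑ i, fundTensor F x y i k * y i

end Local

/-! ### Singular Finsler metrics -/

section Finsler

variable {n : ℕ} {M : Type*} [TopologicalSpace M] [ChartedSpace (EuclideanSpace ℝ (Fin n)) M]

variable (n M) in
/-- A function of tangent vectors, considered only on a domain in each tangent space
(the values outside the domain are irrelevant). -/
structure SingularMetric where
  /-- The tangent vectors at which the metric is defined. -/
  dom (p : M) : Set (TangentSpace (𝓡 n) p)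
  /-- The values of the metric. -/
  val (p : M) : TangentSpace (𝓡 n) p → ℝ

/-- Two singular metrics agree: they have the same domain and the same values on it. -/
def SingularMetric.Agrees (F F' : SingularMetric n M) : Prop :=
  ∀ p, F.dom p = F'.dom p ∧ ∀ v ∈ F.dom p, F.val p v = F'.val p v

/-- The function `F(x, y)` that represents a singular metric in local coordinates. -/
def SingularMetric.coordFun (F : SingularMetric n M)
    (e : OpenPartialHomeomorph M (EuclideanSpace ℝ (Fin n)))
    (x y : EuclideanSpace ℝ (Fin n)) : ℝ :=
  F.val (e.symm x) (coordVec e x y)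

/-- `F` is of scalar flag curvature: there is a function `K` of tangent vectors with
`R^i_k = K (F² δ^i_k - y^i y_k)` at all vectors of the domain at which the fundamental tensor
is nondegenerate, that is, at which the spray of `F` is defined. -/
def SingularMetric.IsOfScalarFlagCurvature (F : SingularMetric n M) : Prop :=
  ∃ K : (p : M) → TangentSpace (𝓡 n) p → ℝ,
    ∀ e, IsCoord n M e → ∀ x ∈ e.target, ∀ y, coordVec e x y ∈ F.dom (e.symm x) →
      (fundTensor (F.coordFun e) x y).det ≠ 0 →
      ∀ i k, riemCurv (F.coordFun e) i k x y =
        K (e.symm x) (coordVec e x y) *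
          (F.coordFun e x y ^ 2 * (if i = k then 1 else 0)
            - y i * lowered (F.coordFun e) k x y)

/-- `F` is locally Minkowskian: around every point there are local coordinates in which `F`
(with its domain) does not depend on `x`. -/
def SingularMetric.IsLocallyMinkowskian (F : SingularMetric n M) : Prop :=
  ∀ p : M, ∃ e, IsCoord n M e ∧ p ∈ e.source ∧
    ∃ (U : Set (EuclideanSpace ℝ (Fin n))) (f : EuclideanSpace ℝ (Fin n) → ℝ),
      ∀ x ∈ e.target, ∀ y, (coordVec e x y ∈ F.dom (e.symm x) ↔ y ∈ U) ∧
        (y ∈ U → F.coordFun e x y = f y)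

variable [IsManifold (𝓡 n) ∞ M]

/-- The `m`-Kropina metric `F = α^{1-m} β^m`, defined on the tangent vectors with `β > 0`. -/
def kropina (m : ℝ) (α : RiemMetric n M) (β : OneForm n M) : SingularMetric n M where
  dom p := {v | 0 < β.form p v}
  val p v := length α p v ^ (1 - m) * β.form p v ^ m

/-- `F = α^{1-m} β^m` where `α` is flat and `β` is parallel with respect to `α` and has
constant length one. -/
def IsFlatParallelForm (m : ℝ) (F : SingularMetric n M) (α : RiemMetric n M)
    (β : OneForm n M) : Prop :=
  F.Agrees (kropina m α β) ∧ IsFlat α ∧ IsParallel α β ∧ HasUnitLength α β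

end Finsler

end MKropina

end

/-! Multiplying `α` and `β` by suitable powers of the length of `β` leaves `F` unchanged and makes
that length one (`exists_hasUnitLength`), so the pair is normalised from the start. Write X for the
vector dual to `β`, `r₀₀ = b_{i|j} yⁱ yʲ`, and s for the curl of `β`. For unit length the spray is
the explicit field `sprayK`, rational in y, with two possible polar loci: the quadric D = mα² -
(1+m)β² = 0, where the fundamental tensor degenerates, and the hyperplane β = 0. Scalar curvature
says that the curvature is one unknown factor λ = KF² times a known tensor. Contracting it with w_i
u^k, where w(u) = w(y) = 0, eliminates λ, so poles on the other side have to cancel.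

Near D = 0 the leading pole of the contracted curvature is a multiple of the square of the cubic N =
β r₀₀ - (2m/(1-m)) α² s₀. On lines X + tw with β(w) = 0 this forces N to vanish at the complex roots
of D, and the coefficients of N along these lines then give r₀₀ = 0 and s₀ = 0
(`numer_line_divisible`, `cubic_eq_zero_of_dvd`, `killing`). Here m ≠ -1 keeps α² away from zero at
these roots, and n ≥ 3 provides a direction orthogonal to both X and w, which the contraction needs.

The singular part of the spray that is left is (m/(1-m)) α² sⁱ₀ / β. Let y approach a nonzero w with
β(w) = 0 and put p = s(w). Contracting with X and with p yields two limits for λβ². If p ≠ 0, they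
agree only for m = -1 (`curlUp_mulVec_eq_zero`). Hence `β` is closed and Killing, that is, parallel
(`covD_eq_zero`).

For parallel `β` the spray is that of `α`, and the Ricci identity gives b_i Rⁱ_k = 0. Comparison
with the scalar form gives λ = 0 on an open set, so the curvature form of `α`, being polynomial in
y, vanishes identically (`riem_eq_zero`). Conversely a flat `α` with parallel `β` has zero
curvature, and K = 0 serves.

The adapted coordinates come from Frobenius' theorem: an orthonormal coframe of parallel covectors
containing `β` consists of closed forms, whose potentials are the coordinates
(`exists_flat_coords`). The representation is rigid because equal half-spaces β > 0 make the two
forms proportional. The conformal factor is the length of `β` with respect to `α`, hence smooth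
(`exists_smooth_conformal_factor`). -/

noncomputable section

namespace MKropina

open Filter Topology

/-- The model space `ℝⁿ`. -/
abbrev Euc (n : ℕ) := EuclideanSpace ℝ (Fin n)

/-! ### Rules for partial derivatives in coordinates. -/

section PartialDerivatives

variable {n : ℕ} {f g : Euc n → ℝ} {x : Euc n} {k : Fin n}

theorem pd_congr (h : f =ᶠ[𝓝 x] g) : pd k f x = pd k g x := by
  unfold pd; rw [h.fderiv_eq]

@[simp] theorem pd_const (c : ℝ) : pd k (fun _ => c) x = 0 := by
  simp [pd]

theorem pd_add (hf : DifferentiableAt ℝ f x) (hg : DifferentiableAt ℝ g x) :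
    pd k (fun z => f z + g z) x = pd k f x + pd k g x := by
  unfold pd; rw [fderiv_fun_add hf hg]; rfl

theorem pd_sub (hf : DifferentiableAt ℝ f x) (hg : DifferentiableAt ℝ g x) :
    pd k (fun z => f z - g z) x = pd k f x - pd k g x := by
  unfold pd; rw [fderiv_fun_sub hf hg]; rfl

theorem pd_mul (hf : DifferentiableAt ℝ f x) (hg : DifferentiableAt ℝ g x) :
    pd k (fun z => f z * g z) x = pd k f x * g x + f x * pd k g x := by
  unfold pd; rw [fderiv_fun_mul hf hg]
  simp only [_root_.add_apply, _root_.smul_apply, smul_eq_mul]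
  ring

theorem pd_const_mul (c : ℝ) (hf : DifferentiableAt ℝ f x) :
    pd k (fun z => c * f z) x = c * pd k f x := by
  rw [pd_mul (differentiableAt_const _) hf]; simp

theorem pd_mul_const (c : ℝ) (hf : DifferentiableAt ℝ f x) :
    pd k (fun z => f z * c) x = pd k f x * c := by
  rw [pd_mul hf (differentiableAt_const _)]; simp

theorem pd_inv (hf : DifferentiableAt ℝ f x) (h0 : f x ≠ 0) :
    pd k (fun z => (f z)⁻¹) x = - pd k f x / f x ^ 2 := by
  unfold pd
  have h := (hasDerivAt_inv h0).comp_hasFDerivAt x hf.hasFDerivAt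
  have h' : HasFDerivAt (fun z => (f z)⁻¹) (-(f x ^ 2)⁻¹ • fderiv ℝ f x) x := h
  rw [h'.fderiv]
  simp only [_root_.smul_apply, smul_eq_mul]
  field_simp

theorem pd_div (hf : DifferentiableAt ℝ f x) (hg : DifferentiableAt ℝ g x) (h0 : g x ≠ 0) :
    pd k (fun z => f z / g z) x = pd k f x / g x - f x * pd k g x / g x ^ 2 := by
  simp only [div_eq_mul_inv]
  rw [pd_mul hf (hg.fun_inv h0), pd_inv hg h0]
  field_simp
  ring

theorem pd_sum {ι : Type*} {s : Finset ι} {f : ι → Euc n → ℝ}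
    (hf : ∀ i ∈ s, DifferentiableAt ℝ (f i) x) :
    pd k (fun z => ∑ i ∈ s, f i z) x = ∑ i ∈ s, pd k (f i) x := by
  unfold pd
  rw [fderiv_fun_sum hf]
  simp

@[fun_prop]
theorem differentiable_coord (i : Fin n) : Differentiable ℝ (fun y : Euc n => y i) :=
  (EuclideanSpace.proj i : Euc n →L[ℝ] ℝ).differentiable

theorem pd_coord (i : Fin n) : pd k (fun y : Euc n => y i) x = if i = k then 1 else 0 := by
  unfold pd
  have h : (fun y : Euc n => y i) = (EuclideanSpace.proj i : Euc n →L[ℝ] ℝ) := rfl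
  rw [h, ContinuousLinearMap.fderiv]
  simp [stdVec]

theorem fderiv_eq_sum_pd (f : Euc n → ℝ) (x v : Euc n) :
    fderiv ℝ f x v = ∑ k, v k * pd k f x := by
  have hv : v = ∑ k, v k • (stdVec k : Euc n) := by
    ext i
    simp [stdVec, Pi.single_apply]
  conv_lhs => rw [hv]
  simp [map_sum, pd]

theorem contDiffAt_pd (hf : ContDiffAt ℝ ∞ f x) (k : Fin n) : ContDiffAt ℝ ∞ (pd k f) x :=
  (hf.fderiv_right (m := ∞) (by simp)).clm_apply contDiffAt_const

theorem pd_comm (hf : ContDiffAt ℝ ∞ f x) (i j : Fin n) :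
    pd i (pd j f) x = pd j (pd i f) x := by
  have hd : DifferentiableAt ℝ (fderiv ℝ f) x :=
    (hf.fderiv_right (m := 1) (WithTop.coe_le_coe.2 le_top)).differentiableAt one_ne_zero
  have key : ∀ i j : Fin n, pd i (pd j f) x = fderiv ℝ (fderiv ℝ f) x (stdVec i) (stdVec j) := by
    intro i j
    change fderiv ℝ (fun z => fderiv ℝ f z (stdVec j)) x (stdVec i) = _
    rw [fderiv_clm_apply hd (differentiableAt_const _)]
    simp
  rw [key, key]
  exact (hf.isSymmSndFDerivAt (by simp; exact WithTop.coe_le_coe.2 le_top)) (stdVec i) (stdVec j)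

end PartialDerivatives

/-! ### Polynomial functions of y and their first jets in x. -/

section PolyMap

variable {n : ℕ}

/-- A function on `ℝⁿ` that is a polynomial in the coordinates. -/
def PolyMap (f : Euc n → ℝ) : Prop :=
  ∃ p : MvPolynomial (Fin n) ℝ, ∀ y, f y = MvPolynomial.eval (fun i => y i) p

namespace PolyMap

variable {f g : Euc n → ℝ}

theorem const (c : ℝ) : PolyMap (fun _ : Euc n => c) := ⟨MvPolynomial.C c, by simp⟩

theorem coord (i : Fin n) : PolyMap (fun y : Euc n => y i) := ⟨MvPolynomial.X i, by simp⟩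

theorem add (hf : PolyMap f) (hg : PolyMap g) : PolyMap (fun y => f y + g y) := by
  obtain ⟨p, hp⟩ := hf; obtain ⟨r, hr⟩ := hg
  exact ⟨p + r, by simp [hp, hr]⟩

theorem sub (hf : PolyMap f) (hg : PolyMap g) : PolyMap (fun y => f y - g y) := by
  obtain ⟨p, hp⟩ := hf; obtain ⟨r, hr⟩ := hg
  exact ⟨p - r, by simp [hp, hr]⟩

theorem mul (hf : PolyMap f) (hg : PolyMap g) : PolyMap (fun y => f y * g y) := by
  obtain ⟨p, hp⟩ := hf; obtain ⟨r, hr⟩ := hg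
  exact ⟨p * r, by simp [hp, hr]⟩

theorem pow (hf : PolyMap f) (k : ℕ) : PolyMap (fun y => f y ^ k) := by
  obtain ⟨p, hp⟩ := hf
  exact ⟨p ^ k, by simp [hp]⟩

theorem sum {ι : Type*} {s : Finset ι} {f : ι → Euc n → ℝ} (hf : ∀ i, PolyMap (f i)) :
    PolyMap (fun y => ∑ i ∈ s, f i y) := by
  choose p hp using hf
  exact ⟨∑ i ∈ s, p i, by simp [hp, map_sum]⟩

theorem differentiable (hf : PolyMap f) : Differentiable ℝ f := by
  obtain ⟨p, hp⟩ := hf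
  have : f = fun y : Euc n => MvPolynomial.eval (fun i => y i) p := funext hp
  rw [this]
  clear hp this
  induction p using MvPolynomial.induction_on with
  | C a => simp
  | add p q hp hq => simpa using hp.fun_add hq
  | mul_X p i hp => simpa using hp.fun_mul (differentiable_coord i)

theorem pd (hf : PolyMap f) (k : Fin n) : PolyMap (pd k f) := by
  obtain ⟨p, hp⟩ := hf
  have : f = fun y : Euc n => MvPolynomial.eval (fun i => y i) p := funext hp
  subst this
  clear hp
  refine ⟨MvPolynomial.pderiv k p, fun y => ?_⟩
  induction p using MvPolynomial.induction_on with
  | C a => simp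
  | add p q hp hq =>
    have h1 : Differentiable ℝ (fun y : Euc n => MvPolynomial.eval (fun i => y i) p) :=
      PolyMap.differentiable ⟨p, fun _ => rfl⟩
    have h2 : Differentiable ℝ (fun y : Euc n => MvPolynomial.eval (fun i => y i) q) :=
      PolyMap.differentiable ⟨q, fun _ => rfl⟩
    simp only [map_add]
    rw [pd_add (h1 y) (h2 y), hp, hq]
  | mul_X p i hp =>
    have h1 : Differentiable ℝ (fun y : Euc n => MvPolynomial.eval (fun i => y i) p) :=
      PolyMap.differentiable ⟨p, fun _ => rfl⟩
    simp only [map_mul, MvPolynomial.eval_X]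
    rw [pd_mul (h1 y) (differentiable_coord i y), hp, pd_coord]
    simp only [Derivation.leibniz, MvPolynomial.pderiv_X, smul_eq_mul, map_add, map_mul,
      MvPolynomial.eval_X, Pi.single_apply]
    split_ifs <;> simp <;> ring

/-- Divisibility and vanishing are decided on lines, where polynomials of one variable are
available. -/
theorem exists_line (hf : PolyMap f) (v w : Euc n) :
    ∃ p : Polynomial ℝ, ∀ t : ℝ, f (v + t • w) = p.eval t := by
  obtain ⟨p, hp⟩ := hf
  refine ⟨MvPolynomial.aeval (fun i => Polynomial.C (v i) + Polynomial.X * Polynomial.C (w i)) p,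
    fun t => ?_⟩
  rw [hp]
  clear hp
  induction p using MvPolynomial.induction_on with
  | C a => simp
  | add p q hp hq => rw [map_add, map_add, Polynomial.eval_add, hp, hq]
  | mul_X p i hp => rw [map_mul, map_mul, Polynomial.eval_mul, hp]; simp; exact Or.inl (mul_comm _ _)

end PolyMap

/-- A function `f(x, y)` that is differentiable in `x` at `x₀` and whose value and first
`x`-derivatives at `x₀` are polynomials in `y`. -/
structure PolyJet (x₀ : Euc n) (f : Euc n → Euc n → ℝ) : Prop where
  diff : ∀ y, DifferentiableAt ℝ (fun x => f x y) x₀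
  poly : PolyMap (f x₀)
  pdx_poly : ∀ j, PolyMap (pdx j f x₀)

namespace PolyJet

variable {x₀ : Euc n} {f g : Euc n → Euc n → ℝ}

theorem of_base {c : Euc n → ℝ} (hc : DifferentiableAt ℝ c x₀) :
    PolyJet x₀ (fun x _ => c x) :=
  ⟨fun _ => hc, PolyMap.const _, fun _ => PolyMap.const _⟩

theorem const (c : ℝ) : PolyJet x₀ (fun _ _ => c) := of_base (differentiableAt_const c)

theorem coord (i : Fin n) : PolyJet x₀ (fun _ y => y i) :=
  ⟨fun _ => differentiableAt_const _, PolyMap.coord i, fun j => by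
    have : pdx j (fun _ y : Euc n => y i) x₀ = fun _ => 0 := by
      funext y; simp [pdx]
    rw [this]; exact PolyMap.const 0⟩

theorem add (hf : PolyJet x₀ f) (hg : PolyJet x₀ g) : PolyJet x₀ (fun x y => f x y + g x y) :=
  ⟨fun y => (hf.diff y).add (hg.diff y), hf.poly.add hg.poly, fun j => by
    have : pdx j (fun x y => f x y + g x y) x₀ = fun y => pdx j f x₀ y + pdx j g x₀ y := by
      funext y; exact pd_add (hf.diff y) (hg.diff y)
    rw [this]; exact (hf.pdx_poly j).add (hg.pdx_poly j)⟩

theorem sub (hf : PolyJet x₀ f) (hg : PolyJet x₀ g) : PolyJet x₀ (fun x y => f x y - g x y) :=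
  ⟨fun y => (hf.diff y).sub (hg.diff y), hf.poly.sub hg.poly, fun j => by
    have : pdx j (fun x y => f x y - g x y) x₀ = fun y => pdx j f x₀ y - pdx j g x₀ y := by
      funext y; exact pd_sub (hf.diff y) (hg.diff y)
    rw [this]; exact (hf.pdx_poly j).sub (hg.pdx_poly j)⟩

theorem mul (hf : PolyJet x₀ f) (hg : PolyJet x₀ g) : PolyJet x₀ (fun x y => f x y * g x y) :=
  ⟨fun y => (hf.diff y).mul (hg.diff y), hf.poly.mul hg.poly, fun j => by
    have : pdx j (fun x y => f x y * g x y) x₀ =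
        fun y => pdx j f x₀ y * g x₀ y + f x₀ y * pdx j g x₀ y := by
      funext y; exact pd_mul (hf.diff y) (hg.diff y)
    rw [this]
    exact ((hf.pdx_poly j).mul hg.poly).add (hf.poly.mul (hg.pdx_poly j))⟩

theorem sum {ι : Type*} {s : Finset ι} {f : ι → Euc n → Euc n → ℝ}
    (hf : ∀ i, PolyJet x₀ (f i)) : PolyJet x₀ (fun x y => ∑ i ∈ s, f i x y) :=
  ⟨fun y => DifferentiableAt.fun_sum fun i _ => (hf i).diff y,
    PolyMap.sum fun i => (hf i).poly, fun j => by
    have : pdx j (fun x y => ∑ i ∈ s, f i x y) x₀ = fun y => ∑ i ∈ s, pdx j (f i) x₀ y := by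
      funext y; exact pd_sum fun i _ => (hf i).diff y
    rw [this]; exact PolyMap.sum fun i => (hf i).pdx_poly j⟩

theorem pow (hf : PolyJet x₀ f) (k : ℕ) : PolyJet x₀ (fun x y => f x y ^ k) := by
  induction k with
  | zero => simpa using const 1
  | succ k ih => simpa [pow_succ] using ih.mul hf

end PolyJet

end PolyMap

end MKropina

end

/-! ### Tensors of a metric and a one-form of length one in coordinates. -/

noncomputable section

namespace MKropina

open Filter Topology Matrix

section LocalTensors

variable {n : ℕ}

/-- The quadratic form of a matrix. -/
def quad (A : Matrix (Fin n) (Fin n) ℝ) (y : Fin n → ℝ) : ℝ := y ⬝ᵥ A *ᵥ y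

theorem quad_eq_sum (A : Matrix (Fin n) (Fin n) ℝ) (y : Fin n → ℝ) :
    quad A y = ∑ i, ∑ j, A i j * y i * y j := by
  simp only [quad, dotProduct, mulVec, Finset.mul_sum]
  refine Finset.sum_congr rfl fun i _ => Finset.sum_congr rfl fun j _ => by ring

theorem pd_linear (v : Fin n → ℝ) (k : Fin n) (y : Euc n) :
    pd k (fun y : Euc n => v ⬝ᵥ y.ofLp) y = v k := by
  simp only [dotProduct]
  rw [pd_sum fun i _ => by fun_prop]
  simp_rw [pd_const_mul _ (differentiable_coord _ _), pd_coord]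
  simp

theorem pd_mulVec (A : Matrix (Fin n) (Fin n) ℝ) (i k : Fin n) (y : Euc n) :
    pd k (fun y : Euc n => (A *ᵥ y.ofLp) i) y = A i k :=
  pd_linear (A i) k y

theorem polyMap_linear (v : Fin n → ℝ) : PolyMap (fun y : Euc n => v ⬝ᵥ y.ofLp) :=
  PolyMap.sum fun i => (PolyMap.const (v i)).mul (PolyMap.coord i)

theorem polyMap_mulVec (A : Matrix (Fin n) (Fin n) ℝ) (i : Fin n) :
    PolyMap (fun y : Euc n => (A *ᵥ y.ofLp) i) := polyMap_linear (A i)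

theorem polyMap_quad (A : Matrix (Fin n) (Fin n) ℝ) : PolyMap (fun y : Euc n => quad A y.ofLp) :=
  PolyMap.sum (s := Finset.univ) fun i => (PolyMap.coord i).mul (polyMap_mulVec A i)

theorem pd_quad (A : Matrix (Fin n) (Fin n) ℝ) (k : Fin n) (y : Euc n) :
    pd k (fun y : Euc n => quad A y.ofLp) y = (A *ᵥ y.ofLp) k + (Aᵀ *ᵥ y.ofLp) k := by
  simp only [quad]
  unfold dotProduct
  rw [pd_sum fun i _ => (differentiable_coord i y).fun_mul ((polyMap_mulVec A i).differentiable y)]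
  simp_rw [pd_mul (differentiable_coord _ y) ((polyMap_mulVec A _).differentiable y), pd_coord,
    pd_mulVec, Finset.sum_add_distrib]
  simp [mulVec, dotProduct, mul_comm]

/-- The matrix of the partial derivatives `∂_k A_{ij}`. -/
def pdMat (k : Fin n) (A : Euc n → Matrix (Fin n) (Fin n) ℝ) (x : Euc n) :
    Matrix (Fin n) (Fin n) ℝ := Matrix.of fun i j => pd k (fun z => A z i j) x

/-- The vector of the partial derivatives `∂_k v_i`. -/
def pdVec (k : Fin n) (v : Fin n → Euc n → ℝ) (x : Euc n) : Fin n → ℝ := fun i => pd k (v i) x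

variable {A : Euc n → Matrix (Fin n) (Fin n) ℝ} {v : Fin n → Euc n → ℝ} {x : Euc n}

theorem pdx_quad (hA : ∀ i j, DifferentiableAt ℝ (fun z => A z i j) x) (k : Fin n)
    (y : Fin n → ℝ) : pd k (fun x => quad (A x) y) x = quad (pdMat k A x) y := by
  simp only [quad_eq_sum]
  rw [pd_sum fun i _ => DifferentiableAt.fun_sum fun j _ => ((hA i j).mul_const _).mul_const _]
  refine Finset.sum_congr rfl fun i _ => ?_
  rw [pd_sum fun j _ => ((hA i j).mul_const _).mul_const _]
  refine Finset.sum_congr rfl fun j _ => ?_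
  rw [pd_mul_const _ ((hA i j).mul_const _), pd_mul_const _ (hA i j)]
  rfl

theorem pdx_linear (hv : ∀ i, DifferentiableAt ℝ (v i) x) (k : Fin n) (y : Fin n → ℝ) :
    pd k (fun x => (fun i => v i x) ⬝ᵥ y) x = pdVec k v x ⬝ᵥ y := by
  simp only [dotProduct]
  rw [pd_sum fun i _ => (hv i).mul_const _]
  exact Finset.sum_congr rfl fun i _ => pd_mul_const _ (hv i)

theorem polyJet_linear (hv : ∀ i, DifferentiableAt ℝ (v i) x) :
    PolyJet x (fun x y => (fun i => v i x) ⬝ᵥ y.ofLp) :=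
  PolyJet.sum fun i => (PolyJet.of_base (hv i)).mul (PolyJet.coord i)

theorem polyJet_mulVec (hA : ∀ i j, DifferentiableAt ℝ (fun z => A z i j) x) (i : Fin n) :
    PolyJet x (fun x y => (A x *ᵥ y.ofLp) i) := polyJet_linear (v := fun j x => A x i j) (hA i)

theorem polyJet_quad (hA : ∀ i j, DifferentiableAt ℝ (fun z => A z i j) x) :
    PolyJet x (fun x y => quad (A x) y.ofLp) :=
  PolyJet.sum (s := Finset.univ) fun i => (PolyJet.coord i).mul (polyJet_mulVec hA i)

variable (a : Euc n → Matrix (Fin n) (Fin n) ℝ) (b : Fin n → Euc n → ℝ)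

/-- The Christoffel symbols `Γ^k_{ij}` of a field of matrices. -/
def chr (k i j : Fin n) (x : Euc n) : ℝ :=
  1 / 2 * ∑ l, (a x)⁻¹ k l *
    (pd i (fun z => a z l j) x + pd j (fun z => a z l i) x - pd l (fun z => a z i j) x)

/-- The matrix `(Γ^k_{ij})_{ij}`. -/
def chrMat (k : Fin n) (x : Euc n) : Matrix (Fin n) (Fin n) ℝ :=
  Matrix.of fun i j => chr a k i j x

/-- The curvature tensor formed with `chr`. -/
def riem (l k i j : Fin n) (x : Euc n) : ℝ :=
  pd i (chr a l j k) x - pd j (chr a l i k) x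
    + ∑ p, (chr a l i p x * chr a p j k x - chr a l j p x * chr a p i k x)

/-- The covector `(b_i(x))_i`. -/
def cov (x : Euc n) : Fin n → ℝ := fun i => b i x

/-- The vector `b^i = a^{ij} b_j`. -/
def bup (x : Euc n) : Fin n → ℝ := (a x)⁻¹ *ᵥ cov b x

/-- The covariant derivative `b_{i|j}`. -/
def covD (x : Euc n) : Matrix (Fin n) (Fin n) ℝ :=
  Matrix.of fun i j => pd j (b i) x - ∑ k, chr a k i j x * b k x

/-- The tensor `s_{ij} = ½ (∂_j b_i - ∂_i b_j)`. -/
def curl (x : Euc n) : Matrix (Fin n) (Fin n) ℝ :=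
  Matrix.of fun i j => 1 / 2 * (pd j (b i) x - pd i (b j) x)

/-- The tensor `s^i_j`. -/
def curlUp (x : Euc n) : Matrix (Fin n) (Fin n) ℝ := (a x)⁻¹ * curl b x

/-- The spray coefficients `½ Γ^i_{jk} y^j y^k` of the Riemannian metric. -/
def sprayR (x y : Euc n) : Fin n → ℝ := fun i => 1 / 2 * quad (chrMat a i x) y.ofLp

/-- The quadratic form `α²`. -/
def alphaSq (x y : Euc n) : ℝ := quad (a x) y.ofLp

/-- The linear form `β`. -/
def beta (x y : Euc n) : ℝ := cov b x ⬝ᵥ y.ofLp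

/-- The quadratic form `mα² - (1+m)β²`, whose zeros are the degenerate vectors. -/
def discr (m : ℝ) (x y : Euc n) : ℝ := m * alphaSq a x y - (1 + m) * beta b x y ^ 2

/-- The cubic form `β r₀₀ - 2m/(1-m) α² s₀`. -/
def numer (m : ℝ) (x y : Euc n) : ℝ :=
  beta b x y * quad (covD a b x) y.ofLp
    - 2 * (m / (1 - m)) * alphaSq a x y * (bup a b x ⬝ᵥ curl b x *ᵥ y.ofLp)

/-- The spray coefficients of the `m`-Kropina metric with `b = 1`. -/
def sprayK (m : ℝ) (x y : Euc n) : Fin n → ℝ :=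
  sprayR a x y + (m / (1 - m) * alphaSq a x y / beta b x y) • (curlUp a b x *ᵥ y.ofLp)
    + (m * numer a b m x y / (beta b x y * discr a b m x y)) •
      ((alphaSq a x y / 2) • bup a b x - beta b x y • y.ofLp)

/-- A smooth Riemannian metric and a smooth one-form of length one on an open set of `ℝⁿ`. -/
structure UnitPair (U : Set (Euc n)) : Prop where
  isOpen : IsOpen U
  smooth_a : ∀ i j, ContDiffOn ℝ ∞ (fun x => a x i j) U
  smooth_b : ∀ i, ContDiffOn ℝ ∞ (b i) U
  posDef : ∀ x ∈ U, (a x).PosDef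
  unit : ∀ x ∈ U, cov b x ⬝ᵥ bup a b x = 1

end LocalTensors

/-- The inverse is the adjugate divided by the determinant, both polynomial in the entries. -/
theorem contDiffAt_matrix_inv {n : ℕ} {a : Euc n → Matrix (Fin n) (Fin n) ℝ} {x : Euc n}
    (ha : ∀ i j, ContDiffAt ℝ ∞ (fun x => a x i j) x) (h0 : (a x).det ≠ 0) (i j : Fin n) :
    ContDiffAt ℝ ∞ (fun x => (a x)⁻¹ i j) x := by
  have hdet : ContDiffAt ℝ ∞ (fun x => (a x).det) x := by
    simp only [det_apply]
    exact ContDiffAt.sum fun σ _ => (contDiffAt_prod fun i _ => ha _ _).const_smul _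
  have hadj : ContDiffAt ℝ ∞ (fun x => (a x).adjugate i j) x := by
    simp only [adjugate_apply, det_apply]
    refine ContDiffAt.sum fun σ _ => (contDiffAt_prod fun k _ => ?_).const_smul _
    simp only [updateRow_apply]
    split_ifs
    · exact contDiffAt_const
    · exact ha _ _
  have : (fun x => (a x)⁻¹ i j) = fun x => (a x).det⁻¹ * (a x).adjugate i j := by
    funext z
    simp [inv_def, Ring.inverse_eq_inv']
  rw [this]
  exact (hdet.inv h0).mul hadj

namespace UnitPair

variable {n : ℕ} {a : Euc n → Matrix (Fin n) (Fin n) ℝ} {b : Fin n → Euc n → ℝ}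
  {U : Set (Euc n)} {x : Euc n}

theorem contDiffAt_a (h : UnitPair a b U) (hx : x ∈ U) (i j : Fin n) :
    ContDiffAt ℝ ∞ (fun x => a x i j) x := (h.smooth_a i j).contDiffAt (h.isOpen.mem_nhds hx)

theorem contDiffAt_b (h : UnitPair a b U) (hx : x ∈ U) (i : Fin n) :
    ContDiffAt ℝ ∞ (b i) x := (h.smooth_b i).contDiffAt (h.isOpen.mem_nhds hx)

theorem symm (h : UnitPair a b U) (hx : x ∈ U) : (a x)ᵀ = a x := by
  have := (h.posDef x hx).isHermitian
  rwa [Matrix.IsHermitian, conjTranspose_eq_transpose_of_trivial] at this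

theorem symm_apply (h : UnitPair a b U) (hx : x ∈ U) (i j : Fin n) : a x i j = a x j i := by
  conv_lhs => rw [← h.symm hx]
  rfl

theorem isUnit_det (h : UnitPair a b U) (hx : x ∈ U) : IsUnit (a x).det :=
  (h.posDef x hx).det_pos.ne'.isUnit

theorem inv_symm (h : UnitPair a b U) (hx : x ∈ U) : ((a x)⁻¹)ᵀ = (a x)⁻¹ := by
  rw [transpose_nonsing_inv, h.symm hx]

theorem contDiffAt_inv (h : UnitPair a b U) (hx : x ∈ U) (i j : Fin n) :
    ContDiffAt ℝ ∞ (fun x => (a x)⁻¹ i j) x :=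
  contDiffAt_matrix_inv (h.contDiffAt_a hx) (h.posDef x hx).det_pos.ne' i j

theorem contDiffAt_chr (h : UnitPair a b U) (hx : x ∈ U) (k i j : Fin n) :
    ContDiffAt ℝ ∞ (chr a k i j) x := by
  refine contDiffAt_const.mul (ContDiffAt.sum fun l _ => (h.contDiffAt_inv hx _ _).mul ?_)
  exact ((contDiffAt_pd (h.contDiffAt_a hx _ _) _).add
    (contDiffAt_pd (h.contDiffAt_a hx _ _) _)).sub (contDiffAt_pd (h.contDiffAt_a hx _ _) _)

theorem contDiffAt_bup (h : UnitPair a b U) (hx : x ∈ U) (i : Fin n) :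
    ContDiffAt ℝ ∞ (fun x => bup a b x i) x :=
  ContDiffAt.sum (s := Finset.univ) fun j _ => (h.contDiffAt_inv hx i j).mul (h.contDiffAt_b hx j)

theorem contDiffAt_covD (h : UnitPair a b U) (hx : x ∈ U) (i j : Fin n) :
    ContDiffAt ℝ ∞ (fun x => covD a b x i j) x :=
  (contDiffAt_pd (h.contDiffAt_b hx i) j).sub
    (ContDiffAt.sum fun k _ => (h.contDiffAt_chr hx _ _ _).mul (h.contDiffAt_b hx k))

theorem contDiffAt_curl (h : UnitPair a b U) (hx : x ∈ U) (i j : Fin n) :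
    ContDiffAt ℝ ∞ (fun x => curl b x i j) x :=
  contDiffAt_const.mul ((contDiffAt_pd (h.contDiffAt_b hx i) j).sub
    (contDiffAt_pd (h.contDiffAt_b hx j) i))

theorem contDiffAt_curlUp (h : UnitPair a b U) (hx : x ∈ U) (i j : Fin n) :
    ContDiffAt ℝ ∞ (fun x => curlUp a b x i j) x :=
  ContDiffAt.sum (s := Finset.univ) fun k _ => (h.contDiffAt_inv hx i k).mul (h.contDiffAt_curl hx k j)

/-! ### Algebraic identities -/

theorem chr_symm (h : UnitPair a b U) (hx : x ∈ U) (k i j : Fin n) :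
    chr a k i j x = chr a k j i x := by
  have e : ∀ l, pd l (fun z => a z i j) x = pd l (fun z => a z j i) x := fun l =>
    pd_congr (by filter_upwards [h.isOpen.mem_nhds hx] with z hz using h.symm_apply hz i j)
  simp only [chr, e]
  congr 1
  exact Finset.sum_congr rfl fun l _ => by ring

theorem sum_a_chr (h : UnitPair a b U) (hx : x ∈ U) (l i j : Fin n) :
    ∑ k, a x l k * chr a k i j x = 1 / 2 *
      (pd i (fun z => a z l j) x + pd j (fun z => a z l i) x - pd l (fun z => a z i j) x) := by
  set c : Fin n → ℝ := fun l =>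
    pd i (fun z => a z l j) x + pd j (fun z => a z l i) x - pd l (fun z => a z i j) x with hc
  have h1 : (fun k => chr a k i j x) = (1 / 2 : ℝ) • ((a x)⁻¹ *ᵥ c) := rfl
  have h2 : a x *ᵥ (fun k => chr a k i j x) = (1 / 2 : ℝ) • c := by
    rw [h1, mulVec_smul, mulVec_mulVec, mul_nonsing_inv _ (h.isUnit_det hx), one_mulVec]
  exact congrFun h2 l

theorem mulVec_bup (h : UnitPair a b U) (hx : x ∈ U) : a x *ᵥ bup a b x = cov b x := by
  rw [bup, mulVec_mulVec, mul_nonsing_inv _ (h.isUnit_det hx), one_mulVec]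

theorem mulVec_curlUp (h : UnitPair a b U) (hx : x ∈ U) (y : Fin n → ℝ) :
    a x *ᵥ (curlUp a b x *ᵥ y) = curl b x *ᵥ y := by
  rw [curlUp, mulVec_mulVec, ← Matrix.mul_assoc, mul_nonsing_inv _ (h.isUnit_det hx),
    Matrix.one_mul]

theorem dot_symm (h : UnitPair a b U) (hx : x ∈ U) (v w : Fin n → ℝ) :
    v ⬝ᵥ a x *ᵥ w = (a x *ᵥ v) ⬝ᵥ w := by
  rw [dotProduct_mulVec, ← mulVec_transpose, h.symm hx]

theorem bup_dot (h : UnitPair a b U) (hx : x ∈ U) (w : Fin n → ℝ) :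
    bup a b x ⬝ᵥ a x *ᵥ w = cov b x ⬝ᵥ w := by
  rw [h.dot_symm hx, h.mulVec_bup hx]

theorem curl_transpose : (curl b x)ᵀ = - curl b x := by
  ext i j; simp [curl]; ring

theorem dot_curl (v w : Fin n → ℝ) : v ⬝ᵥ curl b x *ᵥ w = - (w ⬝ᵥ curl b x *ᵥ v) := by
  rw [dotProduct_mulVec, ← mulVec_transpose, curl_transpose, neg_mulVec, neg_dotProduct,
    dotProduct_comm]

theorem quad_curl (v : Fin n → ℝ) : v ⬝ᵥ curl b x *ᵥ v = 0 := by
  have := dot_curl (b := b) (x := x) v v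
  linarith

theorem curl_eq_covD (h : UnitPair a b U) (hx : x ∈ U) (i j : Fin n) :
    curl b x i j = 1 / 2 * (covD a b x i j - covD a b x j i) := by
  simp only [curl, covD, of_apply]
  simp_rw [h.chr_symm hx _ j i]
  ring

theorem alphaSq_pos (h : UnitPair a b U) (hx : x ∈ U) {y : Euc n} (hy : 0 < beta b x y) :
    0 < alphaSq a x y := by
  have h0 : y.ofLp ≠ 0 := by
    intro h0
    simp [beta, h0] at hy
  simpa [alphaSq, quad] using (h.posDef x hx).dotProduct_mulVec_pos h0

/-- Lowering the index removes the inverse matrix. In this form the identity trades the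
x-derivatives of `a` in the Euler-Lagrange expression of `F²` for `sprayR`; `cov_dot_sprayR` and
`dot_mulVec_sprayR` do the same for the contractions with `b` and with y. -/
theorem mulVec_sprayR (h : UnitPair a b U) (hx : x ∈ U) (y : Euc n) (i : Fin n) :
    (a x *ᵥ sprayR a x y) i = 1 / 2 * ∑ k, (pdMat k a x *ᵥ y.ofLp) i * y k
      - 1 / 4 * quad (pdMat i a x) y.ofLp := by
  have h1 : (a x *ᵥ sprayR a x y) i
      = 1 / 2 * ∑ j, ∑ k, (∑ l, a x i l * chr a l j k x) * y j * y k := by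
    simp only [mulVec, dotProduct, sprayR, quad_eq_sum, chrMat, of_apply, Finset.mul_sum,
      Finset.sum_mul]
    rw [Finset.sum_comm]
    refine Finset.sum_congr rfl fun j _ => ?_
    rw [Finset.sum_comm]
    refine Finset.sum_congr rfl fun k _ => Finset.sum_congr rfl fun l _ => by ring
  simp_rw [h1, h.sum_a_chr hx, quad_eq_sum, pdMat, mulVec, dotProduct, of_apply]
  have h2 : ∑ k, (∑ j, pd k (fun z => a z i j) x * y j) * y k
      = ∑ j, ∑ k, pd j (fun z => a z i k) x * y j * y k := by
    refine Finset.sum_congr rfl fun j _ => ?_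
    rw [Finset.sum_mul]
    exact Finset.sum_congr rfl fun k _ => by ring
  have h3 : ∑ k, (∑ j, pd k (fun z => a z i j) x * y j) * y k
      = ∑ j, ∑ k, pd k (fun z => a z i j) x * y j * y k := by
    rw [Finset.sum_comm]
    exact Finset.sum_congr rfl fun j _ => Finset.sum_mul _ _ _
  have h4 : ∑ j, ∑ k, 1 / 2 * (pd j (fun z => a z i k) x + pd k (fun z => a z i j) x
      - pd i (fun z => a z j k) x) * y j * y k =
      1 / 2 * (∑ j, ∑ k, pd j (fun z => a z i k) x * y j * y k
       + ∑ j, ∑ k, pd k (fun z => a z i j) x * y j * y k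
       - ∑ j, ∑ k, pd i (fun z => a z j k) x * y j * y k) := by
    simp only [← Finset.sum_add_distrib, ← Finset.sum_sub_distrib, Finset.mul_sum]
    exact Finset.sum_congr rfl fun j _ => Finset.sum_congr rfl fun k _ => by ring
  rw [h4, ← h2, ← h3]
  ring

theorem cov_dot_sprayR (y : Euc n) :
    cov b x ⬝ᵥ sprayR a x y
      = 1 / 2 * (∑ k, (pdVec k b x ⬝ᵥ y.ofLp) * y k - quad (covD a b x) y.ofLp) := by
  simp only [quad_eq_sum, covD, of_apply, sprayR, dotProduct, pdVec, cov, chrMat]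
  have h1 : ∑ k, (∑ i, pd k (b i) x * y i) * y k = ∑ i, ∑ j, pd j (b i) x * y i * y j := by
    rw [Finset.sum_comm]
    exact Finset.sum_congr rfl fun i _ => Finset.sum_mul _ _ _
  rw [h1]
  simp only [← Finset.sum_sub_distrib, Finset.mul_sum]
  rw [Finset.sum_comm]
  refine Finset.sum_congr rfl fun i _ => ?_
  rw [Finset.sum_comm]
  refine Finset.sum_congr rfl fun j _ => ?_
  have : 1 / 2 * (pd j (b i) x * y i * y j - (pd j (b i) x - ∑ k, chr a k i j x * b k x) * y i * y j)
    = (1 / 2 * y i * y j) * ∑ k, chr a k i j x * b k x := by ring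
  rw [this, Finset.mul_sum]
  exact Finset.sum_congr rfl fun k _ => by ring

theorem dot_mulVec_sprayR (h : UnitPair a b U) (hx : x ∈ U) (y : Euc n) :
    y.ofLp ⬝ᵥ a x *ᵥ sprayR a x y = 1 / 4 * ∑ k, quad (pdMat k a x) y.ofLp * y k := by
  have h1 : ∀ i, y i * (a x *ᵥ sprayR a x y) i = 1 / 2 * ∑ k, y i * (pdMat k a x *ᵥ y.ofLp) i * y k
      - 1 / 4 * (quad (pdMat i a x) y.ofLp * y i) := by
    intro i
    rw [h.mulVec_sprayR hx, mul_sub]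
    congr 1
    · simp only [Finset.mul_sum]
      exact Finset.sum_congr rfl fun k _ => by ring
    · ring
  simp only [dotProduct]
  simp_rw [h1, Finset.sum_sub_distrib, ← Finset.mul_sum]
  rw [Finset.sum_comm]
  simp_rw [quad, dotProduct, ← Finset.sum_mul]
  ring

end UnitPair

end MKropina

end

/-! ### The fundamental tensor and the spray of the Kropina metric. -/

noncomputable section

namespace MKropina

open Filter Topology Matrix

theorem differentiableAt_rpow_mul_rpow {n : ℕ} {f g : Euc n → ℝ} {z : Euc n} {p r : ℝ}
    (hf : DifferentiableAt ℝ f z) (hg : DifferentiableAt ℝ g z) (hf0 : 0 < f z) (hg0 : 0 < g z) :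
    DifferentiableAt ℝ (fun z => f z ^ p * g z ^ r) z :=
  (hf.rpow_const (Or.inl hf0.ne')).fun_mul (hg.rpow_const (Or.inl hg0.ne'))

theorem pd_rpow {n : ℕ} {f : Euc n → ℝ} {z : Euc n} {p : ℝ} {k : Fin n}
    (hf : DifferentiableAt ℝ f z) (hf0 : 0 < f z) :
    pd k (fun z => f z ^ p) z = f z ^ p * (p * pd k f z / f z) := by
  have := (hf.hasFDerivAt.rpow_const (p := p) (Or.inl hf0.ne')).fderiv
  simp only [pd, this, _root_.smul_apply, smul_eq_mul]
  rw [Real.rpow_sub_one hf0.ne']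
  field_simp

theorem pd_rpow_mul_rpow {n : ℕ} {f g : Euc n → ℝ} {z : Euc n} {p r : ℝ} {k : Fin n}
    (hf : DifferentiableAt ℝ f z) (hg : DifferentiableAt ℝ g z) (hf0 : 0 < f z) (hg0 : 0 < g z) :
    pd k (fun z => f z ^ p * g z ^ r) z
      = f z ^ p * g z ^ r * (p * pd k f z / f z + r * pd k g z / g z) := by
  rw [pd_mul (hf.rpow_const (Or.inl hf0.ne')) (hg.rpow_const (Or.inl hg0.ne')),
    pd_rpow hf hf0, pd_rpow hg hg0]
  ring

variable {n : ℕ}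

/-- `F² = α^{2(1-m)} β^{2m}` on the vectors with `β > 0`. -/
def IsKropinaEnergy (m : ℝ) (a : Euc n → Matrix (Fin n) (Fin n) ℝ) (b : Fin n → Euc n → ℝ)
    (U : Set (Euc n)) (F : Euc n → Euc n → ℝ) : Prop :=
  ∀ x ∈ U, ∀ y, 0 < beta b x y → energy F x y = alphaSq a x y ^ (1 - m) * beta b x y ^ (2 * m)

/-- The logarithmic derivative `∂ log F² / ∂ y^i`. -/
def ell (m : ℝ) (a : Euc n → Matrix (Fin n) (Fin n) ℝ) (b : Fin n → Euc n → ℝ) (x y : Euc n)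
    (i : Fin n) : ℝ :=
  2 * (1 - m) * (a x *ᵥ y.ofLp) i / alphaSq a x y + 2 * m * b i x / beta b x y

/-- The logarithmic derivative `∂ log F² / ∂ x^k`. -/
def lam (m : ℝ) (a : Euc n → Matrix (Fin n) (Fin n) ℝ) (b : Fin n → Euc n → ℝ) (x y : Euc n)
    (k : Fin n) : ℝ :=
  (1 - m) * quad (pdMat k a x) y.ofLp / alphaSq a x y
    + 2 * m * (pdVec k b x ⬝ᵥ y.ofLp) / beta b x y

namespace UnitPair

variable {m : ℝ} {a : Euc n → Matrix (Fin n) (Fin n) ℝ} {b : Fin n → Euc n → ℝ}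
  {U : Set (Euc n)} {F : Euc n → Euc n → ℝ} {x y : Euc n}

theorem differentiable_alphaSq : Differentiable ℝ (alphaSq a x) := (polyMap_quad (a x)).differentiable

theorem differentiable_beta : Differentiable ℝ (beta b x) := (polyMap_linear (cov b x)).differentiable

theorem differentiableAt_a (h : UnitPair a b U) (hx : x ∈ U) (i j : Fin n) :
    DifferentiableAt ℝ (fun x => a x i j) x := (h.contDiffAt_a hx i j).differentiableAt (by simp)

theorem differentiableAt_b (h : UnitPair a b U) (hx : x ∈ U) (i : Fin n) :
    DifferentiableAt ℝ (b i) x := (h.contDiffAt_b hx i).differentiableAt (by simp)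

theorem polyJet_alphaSq (h : UnitPair a b U) (hx : x ∈ U) : PolyJet x (alphaSq a) :=
  polyJet_quad (h.differentiableAt_a hx)

theorem polyJet_beta (h : UnitPair a b U) (hx : x ∈ U) : PolyJet x (beta b) :=
  polyJet_linear (h.differentiableAt_b hx)

theorem pd_beta (k : Fin n) : pd k (beta b x) y = b k x := pd_linear (cov b x) k y

theorem pd_alphaSq (h : UnitPair a b U) (hx : x ∈ U) (k : Fin n) :
    pd k (alphaSq a x) y = 2 * (a x *ᵥ y.ofLp) k := by
  have := pd_quad (a x) k y
  rw [h.symm hx] at this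
  rw [show alphaSq a x = fun y => quad (a x) y.ofLp from rfl, this]
  ring

theorem eventually_beta_pos (hy : 0 < beta b x y) : ∀ᶠ z in 𝓝 y, 0 < beta b x z :=
  differentiable_beta.continuous.continuousAt.eventually (lt_mem_nhds hy)

theorem eventually_beta_pos_base (h : UnitPair a b U) (hx : x ∈ U) (hy : 0 < beta b x y) :
    ∀ᶠ z in 𝓝 x, 0 < beta b z y :=
  ((h.polyJet_beta hx).diff y).continuousAt.eventually (lt_mem_nhds hy)

theorem pdy_energy (h : UnitPair a b U) (hF : IsKropinaEnergy m a b U F) (hx : x ∈ U)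
    (hy : 0 < beta b x y) (i : Fin n) :
    pdy i (energy F) x y = energy F x y * ell m a b x y i := by
  -- `F²` is given by powers only where β > 0, so the formula is used as an identity of germs.
  have e : (fun z => energy F x z) =ᶠ[𝓝 y]
      fun z => alphaSq a x z ^ (1 - m) * beta b x z ^ (2 * m) := by
    filter_upwards [eventually_beta_pos hy] with z hz using hF x hx z hz
  rw [pdy, pd_congr e, pd_rpow_mul_rpow (differentiable_alphaSq y) (differentiable_beta y)
    (h.alphaSq_pos hx hy) hy, hF x hx y hy, h.pd_alphaSq hx, pd_beta, ell]
  ring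

theorem pdx_energy (h : UnitPair a b U) (hF : IsKropinaEnergy m a b U F) (hx : x ∈ U)
    (hy : 0 < beta b x y) (k : Fin n) :
    pdx k (energy F) x y = energy F x y * lam m a b x y k := by
  have e : (fun z => energy F z y) =ᶠ[𝓝 x]
      fun z => alphaSq a z y ^ (1 - m) * beta b z y ^ (2 * m) := by
    filter_upwards [h.eventually_beta_pos_base hx hy, h.isOpen.mem_nhds hx] with z hz hz'
      using hF z hz' y hz
  rw [pdx, pd_congr e, pd_rpow_mul_rpow ((h.polyJet_alphaSq hx).diff y)
    ((h.polyJet_beta hx).diff y) (h.alphaSq_pos hx hy) hy, hF x hx y hy]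
  have e1 : pd k (fun z => alphaSq a z y) x = quad (pdMat k a x) y.ofLp :=
    pdx_quad (h.differentiableAt_a hx) k y.ofLp
  have e2 : pd k (fun z => beta b z y) x = pdVec k b x ⬝ᵥ y.ofLp :=
    pdx_linear (h.differentiableAt_b hx) k y.ofLp
  rw [e1, e2, lam]

theorem differentiableAt_energy (h : UnitPair a b U) (hF : IsKropinaEnergy m a b U F) (hx : x ∈ U)
    (hy : 0 < beta b x y) : DifferentiableAt ℝ (energy F x) y := by
  have e : energy F x =ᶠ[𝓝 y]
      fun z => alphaSq a x z ^ (1 - m) * beta b x z ^ (2 * m) := by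
    filter_upwards [eventually_beta_pos hy] with z hz using hF x hx z hz
  exact (differentiableAt_rpow_mul_rpow (differentiable_alphaSq y) (differentiable_beta y)
    (h.alphaSq_pos hx hy) hy).congr_of_eventuallyEq e

theorem differentiableAt_div {f g : Euc n → ℝ} (hf : DifferentiableAt ℝ f y)
    (hg : DifferentiableAt ℝ g y) (h0 : g y ≠ 0) : DifferentiableAt ℝ (fun z => f z / g z) y := by
  simp only [div_eq_mul_inv]
  exact hf.fun_mul (hg.fun_inv h0)

theorem pdy_pdy_energy (h : UnitPair a b U) (hF : IsKropinaEnergy m a b U F) (hx : x ∈ U)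
    (hy : 0 < beta b x y) (i j : Fin n) :
    pdy j (pdy i (energy F)) x y = energy F x y * (ell m a b x y i * ell m a b x y j
      + 2 * (1 - m) * (a x i j / alphaSq a x y
        - 2 * (a x *ᵥ y.ofLp) i * (a x *ᵥ y.ofLp) j / alphaSq a x y ^ 2)
      - 2 * m * b i x * b j x / beta b x y ^ 2) := by
  have e : (fun z => pdy i (energy F) x z) =ᶠ[𝓝 y]
      fun z => energy F x z * ell m a b x z i := by
    filter_upwards [eventually_beta_pos hy] with z hz using h.pdy_energy hF hx hz i
  have hA0 := (h.alphaSq_pos hx hy).ne'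
  have d1 : DifferentiableAt ℝ (fun z : Euc n => 2 * (1 - m) * (a x *ᵥ z.ofLp) i) y :=
    ((polyMap_mulVec (a x) i).differentiable y).const_mul _
  have d2 : DifferentiableAt ℝ (fun z => 2 * (1 - m) * (a x *ᵥ z.ofLp) i / alphaSq a x z) y :=
    differentiableAt_div d1 (differentiable_alphaSq y) hA0
  have d3 : DifferentiableAt ℝ (fun z => 2 * m * b i x / beta b x z) y :=
    differentiableAt_div (differentiableAt_const _) (differentiable_beta y) hy.ne'
  have hE := h.pdy_energy hF hx hy j
  rw [pdy] at hE
  have d4 : DifferentiableAt ℝ (fun z => ell m a b x z i) y := d2.fun_add d3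
  rw [pdy, pd_congr e, pd_mul (h.differentiableAt_energy hF hx hy) d4]
  have e4 : pd j (fun z => ell m a b x z i) y = 2 * (1 - m) * (a x i j / alphaSq a x y
        - 2 * (a x *ᵥ y.ofLp) i * (a x *ᵥ y.ofLp) j / alphaSq a x y ^ 2)
      - 2 * m * b i x * b j x / beta b x y ^ 2 := by
    simp only [ell]
    rw [pd_add d2 d3, pd_div d1 (differentiable_alphaSq y) hA0,
      pd_div (differentiableAt_const _) (differentiable_beta y) hy.ne', h.pd_alphaSq hx, pd_beta,
      pd_const_mul _ ((polyMap_mulVec (a x) i).differentiable y), pd_mulVec, pd_const]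
    ring
  rw [e4, hE]
  ring

theorem pdy_pdx_energy (h : UnitPair a b U) (hF : IsKropinaEnergy m a b U F) (hx : x ∈ U)
    (hy : 0 < beta b x y) (k l : Fin n) :
    pdy l (pdx k (energy F)) x y = energy F x y * (lam m a b x y k * ell m a b x y l
      + 2 * (1 - m) * ((pdMat k a x *ᵥ y.ofLp) l / alphaSq a x y
        - quad (pdMat k a x) y.ofLp * (a x *ᵥ y.ofLp) l / alphaSq a x y ^ 2)
      + 2 * m * (pd k (b l) x / beta b x y
        - (pdVec k b x ⬝ᵥ y.ofLp) * b l x / beta b x y ^ 2)) := by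
  have e : (fun z => pdx k (energy F) x z) =ᶠ[𝓝 y]
      fun z => energy F x z * lam m a b x z k := by
    filter_upwards [eventually_beta_pos hy] with z hz using h.pdx_energy hF hx hz k
  have hA0 := (h.alphaSq_pos hx hy).ne'
  have d1 : DifferentiableAt ℝ (fun z : Euc n => (1 - m) * quad (pdMat k a x) z.ofLp) y :=
    ((polyMap_quad (pdMat k a x)).differentiable y).const_mul _
  have d2 : DifferentiableAt ℝ
      (fun z => (1 - m) * quad (pdMat k a x) z.ofLp / alphaSq a x z) y :=
    differentiableAt_div d1 (differentiable_alphaSq y) hA0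
  have d1' : DifferentiableAt ℝ (fun z : Euc n => 2 * m * (pdVec k b x ⬝ᵥ z.ofLp)) y :=
    ((polyMap_linear (pdVec k b x)).differentiable y).const_mul _
  have d3 : DifferentiableAt ℝ (fun z => 2 * m * (pdVec k b x ⬝ᵥ z.ofLp) / beta b x z) y :=
    differentiableAt_div d1' (differentiable_beta y) hy.ne'
  have hE := h.pdy_energy hF hx hy l
  rw [pdy] at hE
  have d4 : DifferentiableAt ℝ (fun z => lam m a b x z k) y := d2.fun_add d3
  have hsymm : (pdMat k a x)ᵀ = pdMat k a x := by
    ext i j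
    exact pd_congr (by filter_upwards [h.isOpen.mem_nhds hx] with z hz using h.symm_apply hz j i)
  rw [pdy, pd_congr e, pd_mul (h.differentiableAt_energy hF hx hy) d4]
  have e4 : pd l (fun z => lam m a b x z k) y =
      2 * (1 - m) * ((pdMat k a x *ᵥ y.ofLp) l / alphaSq a x y
        - quad (pdMat k a x) y.ofLp * (a x *ᵥ y.ofLp) l / alphaSq a x y ^ 2)
      + 2 * m * (pd k (b l) x / beta b x y
        - (pdVec k b x ⬝ᵥ y.ofLp) * b l x / beta b x y ^ 2) := by
    simp only [lam]
    rw [pd_add d2 d3, pd_div d1 (differentiable_alphaSq y) hA0,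
      pd_div d1' (differentiable_beta y) hy.ne', h.pd_alphaSq hx, pd_beta,
      pd_const_mul _ ((polyMap_quad _).differentiable y), pd_quad, hsymm,
      pd_const_mul _ ((polyMap_linear _).differentiable y), pd_linear]
    simp only [pdVec]
    ring
  rw [e4, hE]
  ring

/-- The action of the fundamental tensor on a vector. -/
theorem fundTensor_mulVec (h : UnitPair a b U) (hF : IsKropinaEnergy m a b U F) (hx : x ∈ U)
    (hy : 0 < beta b x y) (v : Fin n → ℝ) (i : Fin n) :
    (fundTensor F x y *ᵥ v) i = 1 / 2 * energy F x y *
      (ell m a b x y i * (2 * (1 - m) * (y.ofLp ⬝ᵥ a x *ᵥ v) / alphaSq a x y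
          + 2 * m * (cov b x ⬝ᵥ v) / beta b x y)
        + 2 * (1 - m) * ((a x *ᵥ v) i / alphaSq a x y
          - 2 * (a x *ᵥ y.ofLp) i * (y.ofLp ⬝ᵥ a x *ᵥ v) / alphaSq a x y ^ 2)
        - 2 * m * b i x * (cov b x ⬝ᵥ v) / beta b x y ^ 2) := by
  have h1 : (fundTensor F x y *ᵥ v) i = ∑ j, (1 / 2 * energy F x y *
      (ell m a b x y i * (2 * (1 - m) * ((a x *ᵥ y.ofLp) j * v j) / alphaSq a x y
          + 2 * m * (cov b x j * v j) / beta b x y)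
        + 2 * (1 - m) * (a x i j * v j / alphaSq a x y
          - 2 * (a x *ᵥ y.ofLp) i * ((a x *ᵥ y.ofLp) j * v j) / alphaSq a x y ^ 2)
        - 2 * m * b i x * (cov b x j * v j) / beta b x y ^ 2)) := by
    simp only [mulVec, dotProduct, fundTensor, of_apply]
    refine Finset.sum_congr rfl fun j _ => ?_
    rw [h.pdy_pdy_energy hF hx hy i j]
    simp only [ell, cov, mulVec, dotProduct]
    ring
  rw [h1, h.dot_symm hx]
  generalize ell m a b x y i = L
  generalize energy F x y = e
  rw [← Finset.mul_sum]
  congr 1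
  have e1 : (a x *ᵥ y.ofLp) ⬝ᵥ v = ∑ j, (a x *ᵥ y.ofLp) j * v j := rfl
  have e2 : cov b x ⬝ᵥ v = ∑ j, cov b x j * v j := rfl
  have e3 : (a x *ᵥ v) i = ∑ j, a x i j * v j := rfl
  rw [e1, e2, e3]
  generalize (a x *ᵥ y.ofLp) = w
  simp only [Finset.sum_add_distrib, Finset.sum_sub_distrib, ← Finset.mul_sum, ← Finset.sum_div]

theorem cov_dot_curlUp (h : UnitPair a b U) (hx : x ∈ U) (v : Fin n → ℝ) :
    cov b x ⬝ᵥ curlUp a b x *ᵥ v = bup a b x ⬝ᵥ curl b x *ᵥ v := by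
  rw [← h.bup_dot hx, h.mulVec_curlUp hx]

theorem dot_bup (h : UnitPair a b U) (hx : x ∈ U) (v : Fin n → ℝ) :
    v ⬝ᵥ a x *ᵥ bup a b x = cov b x ⬝ᵥ v := by
  rw [h.mulVec_bup hx, dotProduct_comm]

/-- The candidate spray is checked by applying the fundamental tensor to it, so that the inverse of
this tensor never has to be computed. -/
theorem fundTensor_mulVec_sprayK (h : UnitPair a b U) (hF : IsKropinaEnergy m a b U F)
    (hm1 : m ≠ 1) (hx : x ∈ U) (hy : 0 < beta b x y) (hD : discr a b m x y ≠ 0) (i : Fin n) :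
    (fundTensor F x y *ᵥ sprayK a b m x y) i =
      1 / 4 * (∑ k, pdy i (pdx k (energy F)) x y * y k - pdx i (energy F) x y) := by
  have hA := (h.alphaSq_pos hx hy).ne'
  have hB := hy.ne'
  have hm1' : 1 - m ≠ 0 := sub_ne_zero.2 hm1.symm
  have hsum : ∑ k, pdy i (pdx k (energy F)) x y * y k = energy F x y *
      (((1 - m) * (∑ k, quad (pdMat k a x) y.ofLp * y k) / alphaSq a x y
          + 2 * m * (∑ k, (pdVec k b x ⬝ᵥ y.ofLp) * y k) / beta b x y) * ell m a b x y i
        + 2 * (1 - m) * ((∑ k, (pdMat k a x *ᵥ y.ofLp) i * y k) / alphaSq a x y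
          - (∑ k, quad (pdMat k a x) y.ofLp * y k) * (a x *ᵥ y.ofLp) i / alphaSq a x y ^ 2)
        + 2 * m * ((∑ k, pd k (b i) x * y k) / beta b x y
          - (∑ k, (pdVec k b x ⬝ᵥ y.ofLp) * y k) * b i x / beta b x y ^ 2)) := by
    simp_rw [h.pdy_pdx_energy hF hx hy, lam]
    generalize ell m a b x y i = L
    generalize energy F x y = e
    simp only [Finset.sum_div, Finset.mul_sum, Finset.sum_mul, ← Finset.sum_add_distrib,
      ← Finset.sum_sub_distrib]
    exact Finset.sum_congr rfl fun k _ => by ring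
  have hcurl : (curl b x *ᵥ y.ofLp) i
      = 1 / 2 * (∑ k, pd k (b i) x * y k - pdVec i b x ⬝ᵥ y.ofLp) := by
    simp only [mulVec, dotProduct, curl, of_apply, pdVec, ← Finset.sum_sub_distrib, Finset.mul_sum]
    exact Finset.sum_congr rfl fun k _ => by ring
  have hpsum : ∑ k, pd k (b i) x * y k = 2 * (curl b x *ᵥ y.ofLp) i + pdVec i b x ⬝ᵥ y.ofLp := by
    linarith
  have hS := h.mulVec_sprayR hx y i
  have hPsum : ∑ k, (pdMat k a x *ᵥ y.ofLp) i * y k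
      = 2 * (a x *ᵥ sprayR a x y) i + 1 / 2 * quad (pdMat i a x) y.ofLp := by linarith
  have hb0 := cov_dot_sprayR (a := a) (b := b) (x := x) y
  have hbs : ∑ k, (pdVec k b x ⬝ᵥ y.ofLp) * y k
      = 2 * (cov b x ⬝ᵥ sprayR a x y) + quad (covD a b x) y.ofLp := by linarith
  have ha0 := h.dot_mulVec_sprayR hx y
  have has : ∑ k, quad (pdMat k a x) y.ofLp * y k
      = 4 * (y.ofLp ⬝ᵥ a x *ᵥ sprayR a x y) := by linarith
  have eyy : y.ofLp ⬝ᵥ a x *ᵥ y.ofLp = alphaSq a x y := rfl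
  have eby : cov b x ⬝ᵥ y.ofLp = beta b x y := rfl
  have eyb : y.ofLp ⬝ᵥ cov b x = beta b x y := dotProduct_comm _ _
  have ebi : cov b x i = b i x := rfl
  rw [hsum, h.pdx_energy hF hx hy, h.fundTensor_mulVec hF hx hy]
  simp only [sprayK, mulVec_add, mulVec_sub, mulVec_smul, dotProduct_add, dotProduct_sub,
    dotProduct_smul, smul_eq_mul, Pi.add_apply, Pi.sub_apply, Pi.smul_apply,
    h.mulVec_curlUp hx, eyb, h.mulVec_bup hx, h.cov_dot_curlUp hx, quad_curl, eyy, eby,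
    h.unit x hx, ebi, hpsum, hPsum, hbs, has, lam, ell, numer]
  have hDe : m * alphaSq a x y = discr a b m x y + (1 + m) * beta b x y ^ 2 := by
    rw [discr]; ring
  -- All derivatives of `a` and `b` are now expressed through `sprayR`, `covD`, `curl` and a few
  -- contractions that cancel. What remains is an identity of rational functions in free scalars,
  -- with D = mA - (1+m)B² as the only relation.
  generalize energy F x y = e
  generalize (a x *ᵥ y.ofLp) i = li
  generalize (curl b x *ᵥ y.ofLp) i = si
  generalize (a x *ᵥ sprayR a x y) i = gi
  generalize y.ofLp ⬝ᵥ a x *ᵥ sprayR a x y = yg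
  generalize cov b x ⬝ᵥ sprayR a x y = bg
  generalize quad (covD a b x) y.ofLp = r
  generalize bup a b x ⬝ᵥ curl b x *ᵥ y.ofLp = s
  generalize quad (pdMat i a x) y.ofLp = qa
  generalize pdVec i b x ⬝ᵥ y.ofLp = pb
  generalize b i x = bi
  generalize hAA : alphaSq a x y = A at *
  generalize hBB : beta b x y = B at *
  generalize hDD : discr a b m x y = D at *
  have hDe' : D = m * A - (1 + m) * B ^ 2 := by linarith
  clear hsum hcurl hpsum hS hPsum hb0 hbs ha0 has eyy eby eyb ebi hDe
  field_simp
  subst hDe'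
  ring

/-- A vector v in the kernel is contracted with y and with the dual vector of `b`. By homogeneity
the first contraction kills the logarithmic derivative of `F²` along v; the second then gives `b(v)
· discr = 0`. So b(v) and ⟨y, v⟩ vanish, which leaves a v = 0. -/
theorem det_fundTensor_ne_zero (h : UnitPair a b U) (hF : IsKropinaEnergy m a b U F)
    (hm1 : m ≠ 1) (hx : x ∈ U) (hy : 0 < beta b x y) (hD : discr a b m x y ≠ 0) :
    (fundTensor F x y).det ≠ 0 := by
  intro hdet
  obtain ⟨v, hv0, hv⟩ := exists_mulVec_eq_zero_iff.2 hdet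
  apply hv0
  have hA := h.alphaSq_pos hx hy
  have he : 0 < energy F x y := by
    rw [hF x hx y hy]; positivity
  have hm1' : 1 - m ≠ 0 := sub_ne_zero.2 hm1.symm
  set Y := y.ofLp ⬝ᵥ a x *ᵥ v with hY
  set Z := cov b x ⬝ᵥ v with hZ
  set L := 2 * (1 - m) * Y / alphaSq a x y + 2 * m * Z / beta b x y with hL
  have key : ∀ i, ell m a b x y i * L + 2 * (1 - m) * ((a x *ᵥ v) i / alphaSq a x y
      - 2 * (a x *ᵥ y.ofLp) i * Y / alphaSq a x y ^ 2)
      - 2 * m * b i x * Z / beta b x y ^ 2 = 0 := by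
    intro i
    have := congrFun hv i
    rw [h.fundTensor_mulVec hF hx hy, Pi.zero_apply] at this
    rcases mul_eq_zero.1 this with h0 | h0
    · exfalso; linarith
    · exact h0
  have contr : ∀ w : Fin n → ℝ,
      (2 * (1 - m) * (w ⬝ᵥ a x *ᵥ y.ofLp) / alphaSq a x y + 2 * m * (cov b x ⬝ᵥ w) / beta b x y) * L
      + 2 * (1 - m) * ((w ⬝ᵥ a x *ᵥ v) / alphaSq a x y
      - 2 * (w ⬝ᵥ a x *ᵥ y.ofLp) * Y / alphaSq a x y ^ 2)
      - 2 * m * (cov b x ⬝ᵥ w) * Z / beta b x y ^ 2 = 0 := by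
    intro w
    have h0 : ∑ i, w i * (ell m a b x y i * L + 2 * (1 - m) * ((a x *ᵥ v) i / alphaSq a x y
      - 2 * (a x *ᵥ y.ofLp) i * Y / alphaSq a x y ^ 2)
      - 2 * m * b i x * Z / beta b x y ^ 2) = 0 := Finset.sum_eq_zero fun i _ => by
        rw [key, mul_zero]
    rw [← h0]
    have e1 : w ⬝ᵥ a x *ᵥ y.ofLp = ∑ i, w i * (a x *ᵥ y.ofLp) i := rfl
    have e2 : cov b x ⬝ᵥ w = ∑ i, b i x * w i := rfl
    have e3 : w ⬝ᵥ a x *ᵥ v = ∑ i, w i * (a x *ᵥ v) i := rfl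
    rw [e1, e2, e3]
    simp only [ell]
    clear_value L Y Z
    generalize a x *ᵥ y.ofLp = w1
    generalize a x *ᵥ v = w2
    simp only [Finset.sum_div, Finset.mul_sum, Finset.sum_mul, ← Finset.sum_add_distrib,
      ← Finset.sum_sub_distrib]
    exact Finset.sum_congr rfl fun k _ => by ring
  have c1 := contr y.ofLp
  have c2 := contr (bup a b x)
  have eyy : y.ofLp ⬝ᵥ a x *ᵥ y.ofLp = alphaSq a x y := rfl
  have eby : cov b x ⬝ᵥ y.ofLp = beta b x y := rfl
  rw [eyy, eby, ← hY] at c1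
  rw [h.bup_dot hx, h.bup_dot hx, h.unit x hx, eby, ← hZ] at c2
  have hB := hy.ne'
  have hA' := hA.ne'
  have hL0 : L = 0 := by
    have : L = 2 * L + 2 * (1 - m) * (Y / alphaSq a x y - 2 * alphaSq a x y * Y / alphaSq a x y ^ 2)
      - 2 * m * beta b x y * Z / beta b x y ^ 2 := by
      rw [hL]; field_simp; ring
    rw [this, ← c1]; field_simp; ring
  -- L = 0 relates Y = ⟨y, v⟩ to Z = b(v); the contraction with the dual vector then involves Z
  -- alone.
  have hYZ : (1 - m) * Y * beta b x y = - m * Z * alphaSq a x y := by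
    have := hL0
    rw [hL] at this
    field_simp at this
    linarith
  have hZ0 : Z = 0 := by
    rw [hL0] at c2
    have h3 : Z * discr a b m x y = 0 := by
      have : Z * ((1 - m) * alphaSq a x y * beta b x y ^ 2)
        - 2 * beta b x y ^ 2 * ((1 - m) * Y * beta b x y) - m * Z * alphaSq a x y ^ 2 = 0 := by
        field_simp at c2
        linear_combination c2 / 2
      rw [hYZ] at this
      have h4 : alphaSq a x y * (Z * discr a b m x y) = 0 := by
        rw [discr]; linear_combination -this
      exact (mul_eq_zero.1 h4).resolve_left hA'
    exact (mul_eq_zero.1 h3).resolve_right hD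
  have hY0 : Y = 0 := by
    rw [hZ0] at hYZ
    simpa [hm1', hB] using hYZ
  have hav : a x *ᵥ v = 0 := by
    funext i
    have := key i
    rw [hL0, hY0, hZ0] at this
    simpa [hm1', hA'] using this
  have : (a x)⁻¹ *ᵥ (a x *ᵥ v) = v := by
    rw [mulVec_mulVec, nonsing_inv_mul _ (h.isUnit_det hx), one_mulVec]
  rw [← this, hav, mulVec_zero]

theorem discr_ne_zero_of_det (h : UnitPair a b U) (hF : IsKropinaEnergy m a b U F)
    (hm1 : m ≠ 1) (hx : x ∈ U) (hy : 0 < beta b x y) (hdet : (fundTensor F x y).det ≠ 0) :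
    discr a b m x y ≠ 0 := by
  intro hD
  apply hdet
  rw [← exists_mulVec_eq_zero_iff]
  have hA := (h.alphaSq_pos hx hy).ne'
  have hB := hy.ne'
  have hm1' : 1 - m ≠ 0 := sub_ne_zero.2 hm1.symm
  have eyy : y.ofLp ⬝ᵥ a x *ᵥ y.ofLp = alphaSq a x y := rfl
  have eby : cov b x ⬝ᵥ y.ofLp = beta b x y := rfl
  have eyb : y.ofLp ⬝ᵥ cov b x = beta b x y := dotProduct_comm _ _
  have ebi : ∀ i, cov b x i = b i x := fun _ => rfl
  have hD' : m * alphaSq a x y = (1 + m) * beta b x y ^ 2 := by rw [discr] at hD; linarith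
  -- Up to the factor 1/2 this is the direction along which `sprayK` has its pole at `discr = 0`. It
  -- is nonzero, since m times its β-component equals (1-m)β² there.
  refine ⟨alphaSq a x y • bup a b x - (2 * beta b x y) • y.ofLp, fun h0 => ?_, ?_⟩
  · have h1 : cov b x ⬝ᵥ (alphaSq a x y • bup a b x - (2 * beta b x y) • y.ofLp) = 0 := by
      rw [h0, dotProduct_zero]
    simp only [dotProduct_sub, dotProduct_smul, smul_eq_mul, eby, h.unit x hx] at h1
    have h2 : (1 - m) * beta b x y ^ 2 = 0 := by linear_combination m * h1 - hD'
    rcases mul_eq_zero.1 h2 with h3 | h3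
    · exact hm1' h3
    · exact hB (by simpa using h3)
  · funext i
    rw [h.fundTensor_mulVec hF hx hy]
    simp only [mulVec_sub, mulVec_smul, dotProduct_sub, dotProduct_smul, smul_eq_mul,
      Pi.sub_apply, Pi.smul_apply, h.mulVec_bup hx, h.unit x hx, eyy, eby, eyb, ebi,
      Pi.zero_apply]
    have h1 : 2 * (1 - m) * (alphaSq a x y * beta b x y - 2 * beta b x y * alphaSq a x y)
        / alphaSq a x y + 2 * m * (alphaSq a x y * 1 - 2 * beta b x y * beta b x y) / beta b x y
        = 0 := by
      field_simp
      linear_combination 2 * hD'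
    rw [h1]
    have h2 : 2 * (1 - m) * ((alphaSq a x y * b i x - 2 * beta b x y * (a x *ᵥ y.ofLp) i)
        / alphaSq a x y - 2 * (a x *ᵥ y.ofLp) i *
          (alphaSq a x y * beta b x y - 2 * beta b x y * alphaSq a x y) / alphaSq a x y ^ 2)
        - 2 * m * b i x * (alphaSq a x y * 1 - 2 * beta b x y * beta b x y) / beta b x y ^ 2
        = 0 := by
      field_simp
      linear_combination (-2 * b i x * alphaSq a x y) * hD'
    rw [mul_zero, zero_add, h2, mul_zero]

/-- The spray of the `m`-Kropina metric. -/
theorem spray_eq (h : UnitPair a b U) (hF : IsKropinaEnergy m a b U F)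
    (hm1 : m ≠ 1) (hx : x ∈ U) (hy : 0 < beta b x y) (hD : discr a b m x y ≠ 0) (i : Fin n) :
    spray F i x y = sprayK a b m x y i := by
  have hdet := (h.det_fundTensor_ne_zero hF hm1 hx hy hD).isUnit
  have h1 : (fun i => spray F i x y)
      = (fundTensor F x y)⁻¹ *ᵥ (fundTensor F x y *ᵥ sprayK a b m x y) := by
    funext i
    simp only [mulVec, dotProduct, spray]
    rw [Finset.mul_sum]
    refine Finset.sum_congr rfl fun l _ => ?_
    have := h.fundTensor_mulVec_sprayK hF hm1 hx hy hD l
    simp only [mulVec, dotProduct] at this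
    rw [this]
    ring
  rw [mulVec_mulVec, nonsing_inv_mul _ hdet, one_mulVec] at h1
  exact congrFun h1 i

end UnitPair

end MKropina

end

/-! ### Curvature of a spray with rational coefficients. -/

noncomputable section

namespace MKropina

open Filter Topology Matrix

section Slice

variable {n : ℕ}

/-- The Riemann curvature expressed through the spray coefficients `G^i` and their `x`-derivatives
`∂_j G^i` at a fixed point. -/
def curvOf (G : Fin n → Euc n → ℝ) (Gx : Fin n → Fin n → Euc n → ℝ) (i k : Fin n) (y : Euc n) :
    ℝ :=
  2 * Gx k i y - ∑ j, y j * pd k (Gx j i) y + 2 * ∑ j, G j y * pd k (pd j (G i)) y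
    - ∑ j, pd j (G i) y * pd k (G j) y

theorem riemCurv_eq_curvOf (F : Euc n → Euc n → ℝ) (i k : Fin n) (x y : Euc n) :
    riemCurv F i k x y
      = curvOf (fun i => spray F i x) (fun j i => pdx j (spray F i) x) i k y := rfl

/-- Only germs in y of the coefficients and of their x-derivatives enter. A formula for the spray
that is valid on an open set of vectors can therefore be substituted. -/
theorem curvOf_congr {G G' : Fin n → Euc n → ℝ} {Gx Gx' : Fin n → Fin n → Euc n → ℝ} {y : Euc n}
    (h : ∀ i, G i =ᶠ[𝓝 y] G' i) (hx : ∀ j i, Gx j i =ᶠ[𝓝 y] Gx' j i) (i k : Fin n) :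
    curvOf G Gx i k y = curvOf G' Gx' i k y := by
  have h2 : ∀ j i, pd k (pd j (G i)) y = pd k (pd j (G' i)) y := fun j i =>
    pd_congr ((h i).eventuallyEq_nhds.mono fun z hz => pd_congr hz)
  simp only [curvOf, (hx _ _).eq_of_nhds, pd_congr (hx _ _), (h _).eq_of_nhds, h2, pd_congr (h _)]

theorem PolyMap.eventually_ne {Q : Euc n → ℝ} (hQ : PolyMap Q) {y : Euc n} (hy : Q y ≠ 0) :
    ∀ᶠ z in 𝓝 y, Q z ≠ 0 :=
  hQ.differentiable.continuous.continuousAt.eventually_ne hy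

/-- The leading pole of the curvature of a spray with rational coefficients `H^i / Q`. -/
theorem curvOf_div {H : Fin n → Euc n → ℝ} {K : Fin n → Fin n → Euc n → ℝ} {Q : Euc n → ℝ}
    (hH : ∀ i, PolyMap (H i)) (hK : ∀ j i, PolyMap (K j i)) (hQ : PolyMap Q) :
    ∃ S : Fin n → Fin n → Euc n → ℝ, (∀ i k, PolyMap (S i k)) ∧ ∀ y, Q y ≠ 0 → ∀ i k,
      Q y ^ 4 * curvOf (fun i z => H i z / Q z) (fun j i z => K j i z / Q z ^ 2) i k y
        = 3 * H i y * (∑ j, H j y * pd j Q y) * pd k Q y + Q y * S i k y := by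
  refine ⟨fun i k y => 2 * Q y * K k i y
      - ∑ j, y j * (Q y * pd k (K j i) y - 2 * K j i y * pd k Q y)
      + ∑ j, (2 * H j y * (Q y * pd k (pd j (H i)) y - (pd j (H i) y * pd k Q y
          + pd k (H i) y * pd j Q y + H i y * pd k (pd j Q) y))
        - (Q y * pd j (H i) y * pd k (H j) y - pd j (H i) y * H j y * pd k Q y
          - H i y * pd j Q y * pd k (H j) y)), fun i k => ?_, fun y hy i k => ?_⟩
  · refine ((((PolyMap.const 2).mul hQ).mul (hK k i)).sub (PolyMap.sum fun j => ?_)).add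
      (PolyMap.sum fun j => ?_)
    · exact (PolyMap.coord j).mul ((hQ.mul ((hK j i).pd k)).sub
        (((PolyMap.const 2).mul (hK j i)).mul (hQ.pd k)))
    · exact (((PolyMap.const 2).mul (hH j)).mul ((hQ.mul (((hH i).pd j).pd k)).sub
        (((((hH i).pd j).mul (hQ.pd k)).add (((hH i).pd k).mul (hQ.pd j))).add
          ((hH i).mul ((hQ.pd j).pd k))))).sub
        ((((hQ.mul ((hH i).pd j)).mul ((hH j).pd k)).sub
          ((((hH i).pd j).mul (hH j)).mul (hQ.pd k))).sub
          (((hH i).mul (hQ.pd j)).mul ((hH j).pd k)))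
  · have hQd := hQ.differentiable
    have d1 : ∀ i j z, Q z ≠ 0 → pd j (fun z => H i z / Q z) z
        = pd j (H i) z / Q z - H i z * pd j Q z / Q z ^ 2 := fun i j z hz =>
      pd_div ((hH i).differentiable z) (hQd z) hz
    have d2 : ∀ j, pd k (fun z => pd j (fun z => H i z / Q z) z) y
        = pd k (pd j (H i)) y / Q y - (pd j (H i) y * pd k Q y
          + pd k (H i) y * pd j Q y + H i y * pd k (pd j Q) y) / Q y ^ 2
          + 2 * H i y * pd j Q y * pd k Q y / Q y ^ 3 := by
      intro j
      have e : (fun z => pd j (fun z => H i z / Q z) z) =ᶠ[𝓝 y]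
          fun z => pd j (H i) z / Q z - H i z * pd j Q z / Q z ^ 2 := by
        filter_upwards [hQ.eventually_ne hy] with z hz using d1 i j z hz
      have e1 : DifferentiableAt ℝ (fun z => pd j (H i) z / Q z) y :=
        UnitPair.differentiableAt_div (((hH i).pd j).differentiable y) (hQd y) hy
      have e2 : DifferentiableAt ℝ (fun z => H i z * pd j Q z) y :=
        ((hH i).mul (hQ.pd j)).differentiable y
      have e3 : DifferentiableAt ℝ (fun z => Q z ^ 2) y := (hQ.pow 2).differentiable y
      have e4 : pd k (fun z => Q z ^ 2) y = 2 * Q y * pd k Q y := by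
        simp only [pow_two]
        rw [pd_mul (hQd y) (hQd y)]; ring
      rw [pd_congr e, pd_sub e1 (UnitPair.differentiableAt_div e2 e3 (pow_ne_zero 2 hy)),
        pd_div (((hH i).pd j).differentiable y) (hQd y) hy, pd_div e2 e3 (pow_ne_zero 2 hy), e4,
        pd_mul ((hH i).differentiable y) ((hQ.pd j).differentiable y)]
      field_simp
      ring
    have d3 : ∀ j, pd k (fun z => K j i z / Q z ^ 2) y
        = pd k (K j i) y / Q y ^ 2 - 2 * K j i y * pd k Q y / Q y ^ 3 := by
      intro j
      have e3 : DifferentiableAt ℝ (fun z => Q z ^ 2) y := (hQ.pow 2).differentiable y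
      have e4 : pd k (fun z => Q z ^ 2) y = 2 * Q y * pd k Q y := by
        simp only [pow_two]
        rw [pd_mul (hQd y) (hQd y)]; ring
      rw [pd_div ((hK j i).differentiable y) e3 (pow_ne_zero 2 hy), e4]
      field_simp
    have d2' : ∀ j, pd k (pd j (fun z => H i z / Q z)) y = _ := d2
    simp only [curvOf]
    simp_rw [d3, d2', d1 _ _ y hy]
    have t1 : Q y ^ 4 * (2 * (K k i y / Q y ^ 2)) = Q y * (2 * Q y * K k i y) := by
      field_simp
    have t2 : Q y ^ 4 * ∑ j, y j * (pd k (K j i) y / Q y ^ 2 - 2 * K j i y * pd k Q y / Q y ^ 3)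
        = Q y * ∑ j, y j * (Q y * pd k (K j i) y - 2 * K j i y * pd k Q y) := by
      simp only [Finset.mul_sum]
      refine Finset.sum_congr rfl fun j _ => ?_
      field_simp
    -- The pole of order four: the term with second derivatives contributes 4, the product of first
    -- derivatives -1, whence the coefficient 3. All other terms carry a factor Q.
    have t3 : Q y ^ 4 * (2 * ∑ j, H j y / Q y * (pd k (pd j (H i)) y / Q y
          - (pd j (H i) y * pd k Q y + pd k (H i) y * pd j Q y + H i y * pd k (pd j Q) y) / Q y ^ 2
          + 2 * H i y * pd j Q y * pd k Q y / Q y ^ 3))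
        - Q y ^ 4 * ∑ j, (pd j (H i) y / Q y - H i y * pd j Q y / Q y ^ 2) *
          (pd k (H j) y / Q y - H j y * pd k Q y / Q y ^ 2)
        = 3 * H i y * (∑ j, H j y * pd j Q y) * pd k Q y
          + Q y * ∑ j, (2 * H j y * (Q y * pd k (pd j (H i)) y - (pd j (H i) y * pd k Q y
          + pd k (H i) y * pd j Q y + H i y * pd k (pd j Q) y))
        - (Q y * pd j (H i) y * pd k (H j) y - pd j (H i) y * H j y * pd k Q y
          - H i y * pd j Q y * pd k (H j) y)) := by
      simp only [Finset.mul_sum, Finset.sum_mul, ← Finset.sum_sub_distrib,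
        ← Finset.sum_add_distrib]
      refine Finset.sum_congr rfl fun j _ => ?_
      field_simp
      ring
    linear_combination t1 - t2 + t3

end Slice

/-! ### A divisibility argument in one variable. -/

section OneVariable

/-- A polynomial function of one real variable. -/
def IsPoly (f : ℝ → ℝ) : Prop := ∃ p : Polynomial ℝ, ∀ t, f t = p.eval t

namespace IsPoly

variable {f g : ℝ → ℝ}

theorem const (c : ℝ) : IsPoly (fun _ => c) := ⟨Polynomial.C c, by simp⟩

theorem id : IsPoly (fun t => t) := ⟨Polynomial.X, by simp⟩

theorem add (hf : IsPoly f) (hg : IsPoly g) : IsPoly (fun t => f t + g t) := by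
  obtain ⟨p, hp⟩ := hf; obtain ⟨r, hr⟩ := hg
  exact ⟨p + r, by simp [hp, hr]⟩

theorem sub (hf : IsPoly f) (hg : IsPoly g) : IsPoly (fun t => f t - g t) := by
  obtain ⟨p, hp⟩ := hf; obtain ⟨r, hr⟩ := hg
  exact ⟨p - r, by simp [hp, hr]⟩

theorem mul (hf : IsPoly f) (hg : IsPoly g) : IsPoly (fun t => f t * g t) := by
  obtain ⟨p, hp⟩ := hf; obtain ⟨r, hr⟩ := hg
  exact ⟨p * r, by simp [hp, hr]⟩

theorem sum {ι : Type*} {s : Finset ι} {f : ι → ℝ → ℝ} (hf : ∀ i, IsPoly (f i)) :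
    IsPoly (fun t => ∑ i ∈ s, f i t) := by
  choose p hp using hf
  exact ⟨∑ i ∈ s, p i, by simp [hp, Polynomial.eval_finsetSum]⟩

end IsPoly

/-- If `c t² N(t)² (1 + κt²)²` is divisible by `mκt² - 1` away from its zeros, then the cubic
`N` without constant term vanishes at the roots of `mκt² - 1`. -/
theorem cubic_eq_zero_of_dvd {m κ c n₁ n₂ n₃ : ℝ} {S : ℝ → ℝ} (hm0 : m ≠ 0) (hm : m ≠ -1)
    (hκ : κ ≠ 0) (hc : c ≠ 0) (hS : IsPoly S)
    (hid : ∀ t : ℝ, m * κ * t ^ 2 - 1 ≠ 0 →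
      c * t ^ 2 * (n₁ * t + n₂ * t ^ 2 + n₃ * t ^ 3) ^ 2 * (1 + κ * t ^ 2) ^ 2
        = (m * κ * t ^ 2 - 1) * S t) :
    n₂ = 0 ∧ n₁ * (m * κ) + n₃ = 0 := by
  obtain ⟨S, hS⟩ := hS
  open Polynomial in
  -- At zeros of mκt² - 1 nothing is assumed. Multiplying both sides by this nonzero polynomial
  -- makes the identity hold at all t, and the factor is cancelled as polynomials.
  have key : C c * X ^ 2 * (C n₁ * X + C n₂ * X ^ 2 + C n₃ * X ^ 3) ^ 2 * (1 + C κ * X ^ 2) ^ 2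
      = (C (m * κ) * X ^ 2 - 1) * S := by
    have hD : (C (m * κ) * X ^ 2 - 1 : ℝ[X]) ≠ 0 := by
      intro h
      have := congrArg (Polynomial.eval 0) h
      simp at this
    rw [← mul_right_inj' hD]
    refine Polynomial.funext fun t => ?_
    by_cases ht : m * κ * t ^ 2 - 1 = 0
    · simp [ht]
    · have := hid t ht
      rw [hS] at this
      simp only [eval_mul, eval_sub, eval_add, eval_pow, eval_C, eval_X, eval_one, this]
  -- The roots are not real when mκ < 0, so they are taken in ℂ.
  obtain ⟨τ, hτ⟩ : ∃ τ : ℂ, ((m * κ : ℝ) : ℂ) * τ ^ 2 = 1 := by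
    obtain ⟨τ, hτ⟩ := IsAlgClosed.exists_pow_nat_eq (((m * κ : ℝ) : ℂ)⁻¹) (n := 2) (by norm_num)
    refine ⟨τ, ?_⟩
    rw [hτ, mul_inv_cancel₀]
    exact_mod_cast mul_ne_zero hm0 hκ
  have root : ∀ τ : ℂ, ((m * κ : ℝ) : ℂ) * τ ^ 2 = 1 →
      (n₁ : ℂ) + n₂ * τ + n₃ * τ ^ 2 = 0 := by
    intro τ hτ
    have h0 : τ ≠ 0 := by
      rintro rfl
      simp at hτ
    have h1 := congrArg (Polynomial.aeval τ) key
    simp only [map_mul, map_add, map_sub, map_pow, Polynomial.aeval_C, Polynomial.aeval_X, map_one,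
      Complex.coe_algebraMap] at h1
    rw [show ((m : ℂ) * (κ : ℂ)) * τ ^ 2 - 1 = 0 by rw [← hτ]; push_cast; ring, zero_mul] at h1
    -- At a root this factor equals 1 + 1/m; here m ≠ -1 enters.
    have h2 : (1 + (κ : ℂ) * τ ^ 2) ≠ 0 := by
      intro h2
      have h3 : (m : ℂ) + 1 = 0 := by
        have : ((m * κ : ℝ) : ℂ) * τ ^ 2 = m * (κ * τ ^ 2) := by push_cast; ring
        rw [this] at hτ
        linear_combination m * h2 - hτ
      apply hm
      have : m + 1 = 0 := by exact_mod_cast h3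
      linarith
    have hc' : (c : ℂ) ≠ 0 := by exact_mod_cast hc
    have h3 : ((n₁ : ℂ) * τ + n₂ * τ ^ 2 + n₃ * τ ^ 3) = 0 := by
      simpa [h0, h2, hc'] using h1
    have h4 : τ * ((n₁ : ℂ) + n₂ * τ + n₃ * τ ^ 2) = 0 := by linear_combination h3
    exact (mul_eq_zero.1 h4).resolve_left h0
  have h0 : τ ≠ 0 := by
    rintro rfl
    simp at hτ
  have r1 := root τ hτ
  -- The roots come in pairs ±τ, which separates the even from the odd part.
  have r2 := root (-τ) (by rw [← hτ]; ring)
  constructor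
  · have : (n₂ : ℂ) * τ = 0 := by linear_combination (r1 - r2) / 2
    exact_mod_cast (mul_eq_zero.1 this).resolve_right h0
  · have : ((n₁ * (m * κ) + n₃ : ℝ) : ℂ) * τ ^ 2 = 0 := by
      push_cast at hτ ⊢
      linear_combination (r1 + r2) / 2 + n₁ * hτ
    have h2 := (mul_eq_zero.1 this).resolve_right (pow_ne_zero 2 h0)
    exact_mod_cast h2

end OneVariable

end MKropina

end

/-! ### The scalar curvature condition and the spray as a rational function. -/

noncomputable section

namespace MKropina

open Filter Topology Matrix

variable {n : ℕ}

/-- The curvature condition `R^i_k = λ (δ^i_k - y^i ∂ log F / ∂ y^k)` at a point. -/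
def IsScalarAt (m : ℝ) (a : Euc n → Matrix (Fin n) (Fin n) ℝ) (b : Fin n → Euc n → ℝ)
    (F : Euc n → Euc n → ℝ) (x : Euc n) : Prop :=
  ∃ lam : Euc n → ℝ, ∀ y, 0 < beta b x y → discr a b m x y ≠ 0 → ∀ i k,
    riemCurv F i k x y = lam y * ((if i = k then 1 else 0) - y i * (ell m a b x y k / 2))

/-- Every use of the curvature condition is a contraction with a covector w and a vector u, chosen
to keep or to kill the unknown factor c. -/
theorem sum_sum_scalar (c : ℝ) (w u y l : Fin n → ℝ) :
    ∑ i, ∑ k, w i * (c * ((if i = k then 1 else 0) - y i * (l k / 2))) * u k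
      = c * (w ⬝ᵥ u - (w ⬝ᵥ y) * (l ⬝ᵥ u) / 2) := by
  have e : ∀ i k, w i * (c * ((if i = k then 1 else 0) - y i * (l k / 2))) * u k
      = c * (if i = k then w i * u k else 0) - c / 2 * ((w i * y i) * (l k * u k)) := by
    intro i k
    split_ifs <;> ring
  simp_rw [e, Finset.sum_sub_distrib, ← Finset.mul_sum]
  rw [← Finset.sum_mul]
  simp only [Finset.sum_ite_eq, Finset.mem_univ, if_true, dotProduct]
  ring

namespace UnitPair

variable {m : ℝ} {a : Euc n → Matrix (Fin n) (Fin n) ℝ} {b : Fin n → Euc n → ℝ}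
  {U : Set (Euc n)} {F : Euc n → Euc n → ℝ} {x y : Euc n}

theorem fundTensor_symm (h : UnitPair a b U) (hF : IsKropinaEnergy m a b U F) (hx : x ∈ U)
    (hy : 0 < beta b x y) (i j : Fin n) : fundTensor F x y i j = fundTensor F x y j i := by
  simp only [fundTensor, of_apply]
  rw [h.pdy_pdy_energy hF hx hy, h.pdy_pdy_energy hF hx hy, h.symm_apply hx i j]
  ring

/-- Euler's identity: half of `F²` is homogeneous of degree two, so lowering y gives its
y-derivative. -/
theorem lowered_eq (h : UnitPair a b U) (hF : IsKropinaEnergy m a b U F) (hx : x ∈ U)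
    (hy : 0 < beta b x y) (k : Fin n) :
    lowered F k x y = energy F x y * (ell m a b x y k / 2) := by
  have h1 : lowered F k x y = (fundTensor F x y *ᵥ y.ofLp) k := by
    simp only [lowered, mulVec, dotProduct]
    exact Finset.sum_congr rfl fun i _ => by rw [h.fundTensor_symm hF hx hy]
  have eyy : y.ofLp ⬝ᵥ a x *ᵥ y.ofLp = alphaSq a x y := rfl
  have eby : cov b x ⬝ᵥ y.ofLp = beta b x y := rfl
  have hA := (h.alphaSq_pos hx hy).ne'
  have hB := hy.ne'
  rw [h1, h.fundTensor_mulVec hF hx hy, eyy, eby, ell]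
  field_simp
  ring

theorem isScalarAt (h : UnitPair a b U) (hF : IsKropinaEnergy m a b U F) (hm1 : m ≠ 1)
    (hx : x ∈ U) {K : Euc n → ℝ}
    (hK : ∀ y, 0 < beta b x y → (fundTensor F x y).det ≠ 0 → ∀ i k, riemCurv F i k x y
      = K y * (F x y ^ 2 * (if i = k then 1 else 0) - y i * lowered F k x y)) :
    IsScalarAt m a b F x := by
  -- By `lowered_eq` the factor `F²` splits off both terms and is absorbed in λ = KF².
  refine ⟨fun y => K y * F x y ^ 2, fun y hy hD i k => ?_⟩
  rw [hK y hy (h.det_fundTensor_ne_zero hF hm1 hx hy hD), h.lowered_eq hF hx hy, energy]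
  ring

/-! ### The spray as a quotient of polynomials -/

variable (m a b) in
/-- The part of the numerator of the spray that is divisible by `discr`. -/
def regularPart (x y : Euc n) (i : Fin n) : ℝ :=
  beta b x y * sprayR a x y i + m / (1 - m) * alphaSq a x y * (curlUp a b x *ᵥ y.ofLp) i

variable (m a b) in
/-- The numerator of the spray over the denominator `β (mα² - (1+m)β²)`. -/
def sprayNum (i : Fin n) (x y : Euc n) : ℝ :=
  discr a b m x y * regularPart m a b x y i
    + m * numer a b m x y * (alphaSq a x y * (1 / 2) * bup a b x i - beta b x y * y i)

variable (m a b) in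
/-- The denominator of the spray. -/
def sprayDen (x y : Euc n) : ℝ := beta b x y * discr a b m x y

theorem sprayK_eq_div (hB : beta b x y ≠ 0) (hD : discr a b m x y ≠ 0) (i : Fin n) :
    sprayK a b m x y i = sprayNum m a b i x y / sprayDen m a b x y := by
  simp only [sprayK, sprayNum, sprayDen, regularPart, Pi.add_apply, Pi.smul_apply, Pi.sub_apply,
    smul_eq_mul]
  field_simp

theorem polyJet_discr (h : UnitPair a b U) (hx : x ∈ U) : PolyJet x (discr a b m) :=
  ((PolyJet.const m).mul (h.polyJet_alphaSq hx)).sub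
    ((PolyJet.const (1 + m)).mul ((h.polyJet_beta hx).pow 2))

theorem polyJet_sprayR (h : UnitPair a b U) (hx : x ∈ U) (i : Fin n) :
    PolyJet x (fun x y => sprayR a x y i) :=
  (PolyJet.const (1 / 2)).mul (polyJet_quad (A := chrMat a i) fun j k =>
    (h.contDiffAt_chr hx i j k).differentiableAt (by simp))

theorem polyJet_curlUp (h : UnitPair a b U) (hx : x ∈ U) (i : Fin n) :
    PolyJet x (fun x y => (curlUp a b x *ᵥ y.ofLp) i) :=
  polyJet_mulVec (fun i j => (h.contDiffAt_curlUp hx i j).differentiableAt (by simp)) i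

theorem polyJet_numer (h : UnitPair a b U) (hx : x ∈ U) : PolyJet x (numer a b m) := by
  refine ((h.polyJet_beta hx).mul (polyJet_quad fun i j =>
    (h.contDiffAt_covD hx i j).differentiableAt (by simp))).sub
    (((PolyJet.const _).mul (h.polyJet_alphaSq hx)).mul ?_)
  exact PolyJet.sum (s := Finset.univ) fun i =>
    (PolyJet.of_base ((h.contDiffAt_bup hx i).differentiableAt (by simp))).mul
      (polyJet_mulVec (fun i j => (h.contDiffAt_curl hx i j).differentiableAt (by simp)) i)

theorem polyJet_regularPart (h : UnitPair a b U) (hx : x ∈ U) (i : Fin n) :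
    PolyJet x (fun x y => regularPart m a b x y i) :=
  ((h.polyJet_beta hx).mul (h.polyJet_sprayR hx i)).add
    (((PolyJet.const _).mul (h.polyJet_alphaSq hx)).mul (h.polyJet_curlUp hx i))

theorem polyJet_sprayNum (h : UnitPair a b U) (hx : x ∈ U) (i : Fin n) :
    PolyJet x (sprayNum m a b i) := by
  refine ((h.polyJet_discr hx).mul (h.polyJet_regularPart hx i)).add
    (((PolyJet.const m).mul (h.polyJet_numer hx)).mul (PolyJet.sub ?_ ?_))
  · exact ((h.polyJet_alphaSq hx).mul (PolyJet.const _)).mul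
      (PolyJet.of_base ((h.contDiffAt_bup hx i).differentiableAt (by simp)))
  · exact (h.polyJet_beta hx).mul (PolyJet.coord i)

theorem polyJet_sprayDen (h : UnitPair a b U) (hx : x ∈ U) : PolyJet x (sprayDen m a b) :=
  (h.polyJet_beta hx).mul (h.polyJet_discr hx)

theorem eventually_discr_ne (hD : discr a b m x y ≠ 0) : ∀ᶠ z in 𝓝 y, discr a b m x z ≠ 0 :=
  PolyMap.eventually_ne (((PolyMap.const m).mul (polyMap_quad (a x))).sub
    ((PolyMap.const (1 + m)).mul ((polyMap_linear (cov b x)).pow 2))) hD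

theorem eventually_discr_ne_base (h : UnitPair a b U) (hx : x ∈ U) (hD : discr a b m x y ≠ 0) :
    ∀ᶠ z in 𝓝 x, discr a b m z y ≠ 0 :=
  ((h.polyJet_discr hx).diff y).continuousAt.eventually_ne hD

/-- The curvature is determined by the coefficients `sprayK` and their `x`-derivatives. -/
theorem riemCurv_eq_sprayK (h : UnitPair a b U) (hF : IsKropinaEnergy m a b U F) (hm1 : m ≠ 1)
    (hx : x ∈ U) (hy : 0 < beta b x y) (hD : discr a b m x y ≠ 0) (i k : Fin n) :
    riemCurv F i k x y = curvOf (fun i z => sprayK a b m x z i)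
      (fun j i z => pd j (fun x => sprayK a b m x z i) x) i k y := by
  rw [riemCurv_eq_curvOf]
  refine curvOf_congr (fun i => ?_) (fun j i => ?_) i k
  · filter_upwards [eventually_beta_pos hy, eventually_discr_ne hD] with z hz hz'
      using h.spray_eq hF hm1 hx hz hz' i
  · filter_upwards [eventually_beta_pos hy, eventually_discr_ne hD] with z hz hz'
    refine pd_congr ?_
    filter_upwards [h.eventually_beta_pos_base hx hz, h.eventually_discr_ne_base hx hz',
      h.isOpen.mem_nhds hx] with w hw hw' hwU
      using h.spray_eq hF hm1 hwU hw hw' i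

/-- The remainders S are polynomials in y, although nothing else is known about them. Modulo the
denominator only the explicit leading term of the curvature survives. -/
theorem riemCurv_pole (h : UnitPair a b U) (hF : IsKropinaEnergy m a b U F) (hm1 : m ≠ 1)
    (hx : x ∈ U) : ∃ S : Fin n → Fin n → Euc n → ℝ, (∀ i k, PolyMap (S i k)) ∧
      ∀ y, 0 < beta b x y → discr a b m x y ≠ 0 → ∀ i k,
      sprayDen m a b x y ^ 4 * riemCurv F i k x y = 3 * sprayNum m a b i x y *
        (∑ j, sprayNum m a b j x y * pd j (sprayDen m a b x) y) * pd k (sprayDen m a b x) y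
        + sprayDen m a b x y * S i k y := by
  have hH := fun i => h.polyJet_sprayNum (m := m) hx i
  have hQ := h.polyJet_sprayDen (m := m) hx
  obtain ⟨S, hS, hS'⟩ := curvOf_div (H := fun i => sprayNum m a b i x)
    -- The quotient rule in x: the x-derivative of a quotient of polynomials is a polynomial over
    -- the squared denominator.
    (K := fun j i y => pdx j (sprayNum m a b i) x y * sprayDen m a b x y
      - sprayNum m a b i x y * pdx j (sprayDen m a b) x y) (fun i => (hH i).poly)
    (fun j i => (((hH i).pdx_poly j).mul hQ.poly).sub ((hH i).poly.mul (hQ.pdx_poly j))) hQ.poly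
  refine ⟨S, hS, fun y hy hD i k => ?_⟩
  rw [← hS' y (mul_ne_zero hy.ne' hD) i k, h.riemCurv_eq_sprayK hF hm1 hx hy hD]
  congr 1
  refine curvOf_congr (fun i => ?_) (fun j i => ?_) i k
  · filter_upwards [eventually_beta_pos hy, eventually_discr_ne hD] with z hz hz'
      using sprayK_eq_div hz.ne' hz' i
  · filter_upwards [eventually_beta_pos hy, eventually_discr_ne hD] with z hz hz'
    have e : (fun x => sprayK a b m x z i) =ᶠ[𝓝 x]
        fun x => sprayNum m a b i x z / sprayDen m a b x z := by
      filter_upwards [h.eventually_beta_pos_base hx hz, h.eventually_discr_ne_base hx hz']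
        with w hw hw' using sprayK_eq_div hw.ne' hw' i
    have h0 : sprayDen m a b x z ≠ 0 := mul_ne_zero hz.ne' hz'
    rw [pd_congr e, pd_div ((hH i).diff z) (hQ.diff z) h0]
    simp only [pdx]
    field_simp

/-! ### The covariant derivative of a form of constant length -/

theorem bup_dot_covD (h : UnitPair a b U) (hx : x ∈ U) (w : Fin n → ℝ) :
    bup a b x ⬝ᵥ covD a b x *ᵥ w = 0 := by
  suffices hs : ∀ j, ∑ i, bup a b x i * covD a b x i j = 0 by
    rw [dotProduct_mulVec]
    have : bup a b x ᵥ* covD a b x = 0 := funext hs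
    rw [this, zero_dotProduct]
  intro j
  have dX : ∀ i, DifferentiableAt ℝ (fun z => bup a b z i) x := fun i =>
    (h.contDiffAt_bup hx i).differentiableAt (by simp)
  have db := h.differentiableAt_b hx
  have da := h.differentiableAt_a hx
  set X := bup a b x with hX
  -- The unit length is differentiated in two forms, b_i bⁱ = 1 and a_ij bⁱ bʲ = 1. Eliminating the
  -- derivatives of bⁱ between them avoids differentiating the inverse matrix.
  have e1 : ∑ i, (pd j (b i) x * X i + b i x * pd j (fun z => bup a b z i) x) = 0 := by
    have : (fun z => ∑ i, b i z * bup a b z i) =ᶠ[𝓝 x] fun _ => 1 := by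
      filter_upwards [h.isOpen.mem_nhds hx] with z hz using h.unit z hz
    have h2 := pd_congr (k := j) this
    rw [pd_const, pd_sum fun i _ => (db i).fun_mul (dX i)] at h2
    rw [← h2]
    exact Finset.sum_congr rfl fun i _ => (pd_mul (db i) (dX i)).symm
  have e2 : quad (pdMat j a x) X + 2 * ∑ i, b i x * pd j (fun z => bup a b z i) x = 0 := by
    have : (fun z => ∑ i, ∑ k, a z i k * bup a b z i * bup a b z k) =ᶠ[𝓝 x] fun _ => 1 := by
      filter_upwards [h.isOpen.mem_nhds hx] with z hz
      have h3 : quad (a z) (bup a b z) = 1 := by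
        rw [quad, h.bup_dot hz, h.unit z hz]
      rw [← h3, quad_eq_sum]
    have h2 := pd_congr (k := j) this
    have d3 : ∀ i k, DifferentiableAt ℝ (fun z => a z i k * bup a b z i * bup a b z k) x :=
      fun i k => ((da i k).fun_mul (dX i)).fun_mul (dX k)
    have h4 : ∀ i k, pd j (fun z => a z i k * bup a b z i * bup a b z k) x
        = pdMat j a x i k * X i * X k + pd j (fun z => bup a b z i) x * (a x i k * X k)
          + a x i k * X i * pd j (fun z => bup a b z k) x := by
      intro i k
      rw [pd_mul ((da i k).fun_mul (dX i)) (dX k), pd_mul (da i k) (dX i)]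
      simp only [pdMat, of_apply, ← hX]
      ring
    rw [pd_const, pd_sum fun i _ => DifferentiableAt.fun_sum fun k _ => d3 i k] at h2
    simp_rw [pd_sum fun k _ => d3 _ k, h4, Finset.sum_add_distrib, ← Finset.mul_sum] at h2
    have h5 : ∀ i, ∑ k, a x i k * X k = b i x := fun i => congrFun (h.mulVec_bup hx) i
    have h6 : ∑ i, ∑ k, a x i k * X i * pd j (fun z => bup a b z k) x
        = ∑ k, b k x * pd j (fun z => bup a b z k) x := by
      rw [Finset.sum_comm]
      refine Finset.sum_congr rfl fun k _ => ?_
      rw [← Finset.sum_mul, ← h5 k]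
      congr 1
      exact Finset.sum_congr rfl fun i _ => by rw [h.symm_apply hx]
    simp_rw [h5] at h2
    rw [h6] at h2
    rw [quad_eq_sum, ← h2, two_mul]
    have h7 : ∑ i, pd j (fun z => bup a b z i) x * b i x
      = ∑ i, b i x * pd j (fun z => bup a b z i) x :=
      Finset.sum_congr rfl fun i _ => mul_comm _ _
    rw [h7]; ring
  have e3 : ∑ i, X i * ∑ k, chr a k i j x * b k x = 1 / 2 * quad (pdMat j a x) X := by
    have h5 : ∀ k, b k x = ∑ l, a x l k * X l := fun k => by
      rw [show b k x = (a x *ᵥ X) k from (congrFun (h.mulVec_bup hx) k).symm]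
      change ∑ l, a x k l * X l = _
      exact Finset.sum_congr rfl fun l _ => by rw [h.symm_apply hx k l]
    have h6 : ∑ i, X i * ∑ k, chr a k i j x * b k x
        = ∑ i, ∑ l, (∑ k, a x l k * chr a k i j x) * X i * X l := by
      refine Finset.sum_congr rfl fun i _ => ?_
      simp_rw [h5, Finset.mul_sum]
      rw [Finset.sum_comm]
      refine Finset.sum_congr rfl fun l _ => ?_
      simp only [Finset.sum_mul]
      exact Finset.sum_congr rfl fun k _ => by ring
    rw [h6]
    simp_rw [h.sum_a_chr hx]
    have h7 : ∑ i, ∑ l, pd i (fun z => a z l j) x * X i * X l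
        = ∑ i, ∑ l, pd l (fun z => a z i j) x * X i * X l := by
      rw [Finset.sum_comm]
      exact Finset.sum_congr rfl fun i _ => Finset.sum_congr rfl fun l _ => by ring
    have h8 : ∑ i, ∑ l, pd j (fun z => a z l i) x * X i * X l = quad (pdMat j a x) X := by
      rw [quad_eq_sum, Finset.sum_comm]
      exact Finset.sum_congr rfl fun i _ => Finset.sum_congr rfl fun l _ => by
        simp only [pdMat, of_apply]; ring
    have h9 : ∑ i, ∑ l, 1 / 2 * (pd i (fun z => a z l j) x + pd j (fun z => a z l i) x
        - pd l (fun z => a z i j) x) * X i * X l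
        = 1 / 2 * (∑ i, ∑ l, pd i (fun z => a z l j) x * X i * X l
          + ∑ i, ∑ l, pd j (fun z => a z l i) x * X i * X l
          - ∑ i, ∑ l, pd l (fun z => a z i j) x * X i * X l) := by
      simp only [← Finset.sum_add_distrib, ← Finset.sum_sub_distrib, Finset.mul_sum]
      exact Finset.sum_congr rfl fun i _ => Finset.sum_congr rfl fun l _ => by ring
    rw [h9, h7, h8]; ring
  have e4 : ∑ i, X i * covD a b x i j
      = ∑ i, pd j (b i) x * X i - ∑ i, X i * ∑ k, chr a k i j x * b k x := by
    rw [← Finset.sum_sub_distrib]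
    exact Finset.sum_congr rfl fun i _ => by simp only [covD, of_apply]; ring
  rw [Finset.sum_add_distrib] at e1
  rw [e4, e3]
  linarith

end UnitPair

end MKropina

end

/-! ### Poles along the degenerate quadric: the form is Killing. -/

noncomputable section

namespace MKropina

open Filter Topology Matrix

variable {n : ℕ}

/-- Two linear equations in at least three unknowns; this is where the dimension enters. -/
theorem exists_ne_zero_dot_eq_zero (hn : 3 ≤ n) (u v : Fin n → ℝ) :
    ∃ z : Fin n → ℝ, z ≠ 0 ∧ u ⬝ᵥ z = 0 ∧ v ⬝ᵥ z = 0 := by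
  let M : Matrix (Fin 2) (Fin n) ℝ := Matrix.of ![u, v]
  obtain ⟨z, hz, hz0⟩ : ∃ z ∈ LinearMap.ker M.mulVecLin, z ≠ 0 := by
    refine (Submodule.ne_bot_iff _).1 (LinearMap.ker_ne_bot_of_finrank_lt ?_)
    simp
    omega
  have hz' : M *ᵥ z = 0 := by simpa using hz
  exact ⟨z, hz0, congrFun hz' 0, congrFun hz' 1⟩

/-- The two orthogonality conditions annihilate both terms of the scalar form, and with them the
unknown factor. -/
theorem IsScalarAt.contract {m : ℝ} {a : Euc n → Matrix (Fin n) (Fin n) ℝ}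
    {b : Fin n → Euc n → ℝ} {F : Euc n → Euc n → ℝ} {x y : Euc n} (hS : IsScalarAt m a b F x)
    (hy : 0 < beta b x y) (hD : discr a b m x y ≠ 0) {w u : Fin n → ℝ} (hwu : w ⬝ᵥ u = 0)
    (hwy : w ⬝ᵥ y.ofLp = 0) : ∑ i, ∑ k, w i * riemCurv F i k x y * u k = 0 := by
  obtain ⟨lam, hlam⟩ := hS
  simp_rw [hlam y hy hD]
  rw [sum_sum_scalar (lam y) w u y.ofLp (ell m a b x y), hwu, hwy]
  ring

namespace UnitPair

variable {m : ℝ} {a : Euc n → Matrix (Fin n) (Fin n) ℝ} {b : Fin n → Euc n → ℝ}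
  {U : Set (Euc n)} {F : Euc n → Euc n → ℝ} {x y : Euc n}

theorem pd_discr (h : UnitPair a b U) (hx : x ∈ U) (k : Fin n) :
    pd k (discr a b m x) y
      = 2 * m * (a x *ᵥ y.ofLp) k - 2 * (1 + m) * beta b x y * b k x := by
  have dA := differentiable_alphaSq (a := a) (x := x) y
  have dB := differentiable_beta (b := b) (x := x) y
  have : discr a b m x
      = fun y => m * alphaSq a x y - (1 + m) * (beta b x y * beta b x y) := by
    funext y; rw [discr, pow_two]
  rw [this, pd_sub (dA.const_mul _) ((dB.fun_mul dB).const_mul _), pd_const_mul _ dA,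
    pd_const_mul _ (dB.fun_mul dB), pd_mul dB dB, h.pd_alphaSq hx, pd_beta]
  ring

theorem pd_sprayDen (h : UnitPair a b U) (hx : x ∈ U) (k : Fin n) :
    pd k (sprayDen m a b x) y = b k x * discr a b m x y
      + beta b x y * (2 * m * (a x *ᵥ y.ofLp) k - 2 * (1 + m) * beta b x y * b k x) := by
  have dB := differentiable_beta (b := b) (x := x) y
  have dD : DifferentiableAt ℝ (discr a b m x) y := (h.polyJet_discr hx).poly.differentiable y
  rw [← h.pd_discr hx, show sprayDen m a b x = fun y => beta b x y * discr a b m x y from rfl,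
    pd_mul dB dD, pd_beta]

theorem sum_pd_sprayDen (h : UnitPair a b U) (hx : x ∈ U) (v : Fin n → ℝ) :
    ∑ k, v k * pd k (sprayDen m a b x) y = (cov b x ⬝ᵥ v) * discr a b m x y
      + beta b x y * (2 * m * (v ⬝ᵥ a x *ᵥ y.ofLp)
        - 2 * (1 + m) * beta b x y * (cov b x ⬝ᵥ v)) := by
  simp_rw [h.pd_sprayDen hx]
  have e1 : cov b x ⬝ᵥ v = ∑ k, b k x * v k := rfl
  have e2 : v ⬝ᵥ a x *ᵥ y.ofLp = ∑ k, v k * (a x *ᵥ y.ofLp) k := rfl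
  rw [e1, e2]
  simp only [Finset.mul_sum, Finset.sum_mul, ← Finset.sum_sub_distrib, ← Finset.sum_add_distrib]
  exact Finset.sum_congr rfl fun k _ => by ring

/-- Only the last term matters modulo `discr`; together with `dot_sprayNum` it shows that the
leading pole is quadratic in `numer`. -/
theorem sum_sprayNum_pd_sprayDen (h : UnitPair a b U) (hx : x ∈ U) :
    ∑ j, sprayNum m a b j x y * pd j (sprayDen m a b x) y
      = discr a b m x y * (∑ j, regularPart m a b x y j * pd j (sprayDen m a b x) y
          + m * numer a b m x y * (alphaSq a x y / 2 - 3 * beta b x y ^ 2))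
        - m * numer a b m x y * alphaSq a x y * beta b x y ^ 2 := by
  have e1 := h.sum_pd_sprayDen (m := m) (y := y) hx (bup a b x)
  have e2 := h.sum_pd_sprayDen (m := m) (y := y) hx y.ofLp
  rw [h.bup_dot hx, h.unit x hx] at e1
  have eyy : y.ofLp ⬝ᵥ a x *ᵥ y.ofLp = alphaSq a x y := rfl
  have eby : cov b x ⬝ᵥ y.ofLp = beta b x y := rfl
  rw [eby] at e1
  rw [eyy, eby] at e2
  have e3 : ∑ j, sprayNum m a b j x y * pd j (sprayDen m a b x) y
      = discr a b m x y * ∑ j, regularPart m a b x y j * pd j (sprayDen m a b x) y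
        + m * numer a b m x y * (alphaSq a x y * (1 / 2) * ∑ j, bup a b x j * pd j (sprayDen m a b x) y
          - beta b x y * ∑ j, y j * pd j (sprayDen m a b x) y) := by
    simp only [sprayNum, Finset.mul_sum, ← Finset.sum_sub_distrib, ← Finset.sum_add_distrib]
    exact Finset.sum_congr rfl fun k _ => by ring
  rw [e3, e1, e2]
  simp only [discr]
  ring

theorem dot_sprayNum {w : Fin n → ℝ} (hw : w ⬝ᵥ y.ofLp = 0) :
    ∑ i, w i * sprayNum m a b i x y = discr a b m x y * ∑ i, w i * regularPart m a b x y i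
      + m * numer a b m x y * alphaSq a x y / 2 * (w ⬝ᵥ bup a b x) := by
  have e3 : ∑ i, w i * sprayNum m a b i x y = discr a b m x y * ∑ i, w i * regularPart m a b x y i
      + m * numer a b m x y * (alphaSq a x y * (1 / 2) * ∑ i, w i * bup a b x i
        - beta b x y * ∑ i, w i * y i) := by
    simp only [sprayNum, Finset.mul_sum, ← Finset.sum_sub_distrib, ← Finset.sum_add_distrib]
    exact Finset.sum_congr rfl fun k _ => by ring
  have e4 : ∑ i, w i * y i = 0 := hw
  rw [e3, e4, dotProduct]
  ring

theorem quad_pos (h : UnitPair a b U) (hx : x ∈ U) {w : Fin n → ℝ} (hw : w ≠ 0) :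
    0 < quad (a x) w := by
  simpa [quad] using (h.posDef x hx).dotProduct_mulVec_pos hw

/-- Along y = X + tw one has β = 1, so the denominator of the spray reduces to D = mκt² - 1. The
contracted curvature is zero, hence D divides the product of the three factors of its leading pole.
Modulo D they are mNAtκ/2, -mNA and 2mtκζ, with N = `numer` and A = 1 + κt². -/
theorem numer_line_divisible (h : UnitPair a b U) (hF : IsKropinaEnergy m a b U F) (hm1 : m ≠ 1)
    (hx : x ∈ U) (hS : IsScalarAt m a b F x) {w z : Fin n → ℝ} (hw : cov b x ⬝ᵥ w = 0)
    (hz : cov b x ⬝ᵥ z = 0) (hwz : z ⬝ᵥ a x *ᵥ w = 0) :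
    ∃ S : ℝ → ℝ, IsPoly S ∧ ∀ t, m * quad (a x) w * t ^ 2 - 1 ≠ 0 →
      3 * m ^ 3 * quad (a x) w ^ 2 * quad (a x) z * t ^ 2
        * numer a b m x (WithLp.toLp 2 (bup a b x + t • w)) ^ 2 * (1 + quad (a x) w * t ^ 2) ^ 2
        = (m * quad (a x) w * t ^ 2 - 1) * S t := by
  obtain ⟨S, hSp, hS'⟩ := h.riemCurv_pole hF hm1 hx
  set κ := quad (a x) w with hκ
  set ζ := quad (a x) z with hζ
  set Y : ℝ → Euc n := fun t => WithLp.toLp 2 (bup a b x + t • w) with hY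
  have hYline : ∀ t, Y t = WithLp.toLp 2 (bup a b x) + t • WithLp.toLp 2 w := fun t => rfl
  have line : ∀ {f : Euc n → ℝ}, PolyMap f → IsPoly (fun t => f (Y t)) := fun {f} hf => by
    simp_rw [hYline]; exact hf.exists_line _ _
  -- W annihilates both y = X + tw and u, as `contract` requires, while W(X) = tκ does not vanish
  -- identically. The direction z is what makes W(u) = 0 compatible with a nonzero derivative of the
  -- denominator along u.
  set W : ℝ → Fin n → ℝ := fun t => (t * κ) • cov b x - a x *ᵥ w + a x *ᵥ z with hW
  set u : Fin n → ℝ := ζ • w + κ • z with hu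
  have hwz' : w ⬝ᵥ a x *ᵥ z = 0 := by rw [h.dot_symm hx, dotProduct_comm]; exact hwz
  have hww : w ⬝ᵥ a x *ᵥ w = κ := rfl
  have hzz : z ⬝ᵥ a x *ᵥ z = ζ := rfl
  have hcX : (a x *ᵥ w) ⬝ᵥ bup a b x = 0 := by rw [dotProduct_comm, h.bup_dot hx, hw]
  have hcX' : (a x *ᵥ z) ⬝ᵥ bup a b x = 0 := by rw [dotProduct_comm, h.bup_dot hx, hz]
  have s1 : (a x *ᵥ w) ⬝ᵥ w = κ := by rw [dotProduct_comm]; rfl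
  have s2 : (a x *ᵥ w) ⬝ᵥ z = 0 := by rw [dotProduct_comm]; exact hwz
  have s3 : (a x *ᵥ z) ⬝ᵥ z = ζ := by rw [dotProduct_comm]; rfl
  have s4 : (a x *ᵥ z) ⬝ᵥ w = 0 := by rw [dotProduct_comm]; exact hwz'
  have hWu : ∀ t, W t ⬝ᵥ u = 0 := by
    intro t
    simp only [hW, hu, add_dotProduct, sub_dotProduct, smul_dotProduct, dotProduct_add,
      dotProduct_smul, smul_eq_mul, hw, hz, s1, s2, s3, s4]
    ring
  have hWX : ∀ t, W t ⬝ᵥ bup a b x = t * κ := by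
    intro t
    simp only [hW, add_dotProduct, sub_dotProduct, smul_dotProduct, smul_eq_mul, h.unit x hx, hcX,
      hcX']
    ring
  have hWY : ∀ t, W t ⬝ᵥ (Y t).ofLp = 0 := by
    intro t
    have : (Y t).ofLp = bup a b x + t • w := rfl
    rw [this, dotProduct_add, hWX, dotProduct_smul]
    simp only [hW, add_dotProduct, sub_dotProduct, smul_dotProduct, smul_eq_mul, hw, s1, s4]
    ring
  have hB : ∀ t, beta b x (Y t) = 1 := by
    intro t
    have : beta b x (Y t) = cov b x ⬝ᵥ (bup a b x + t • w) := rfl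
    rw [this, dotProduct_add, dotProduct_smul, hw, h.unit x hx]
    simp
  have hA : ∀ t, alphaSq a x (Y t) = 1 + κ * t ^ 2 := by
    intro t
    have : alphaSq a x (Y t) = (bup a b x + t • w) ⬝ᵥ a x *ᵥ (bup a b x + t • w) := rfl
    rw [this, add_dotProduct, h.bup_dot hx, mulVec_add, h.mulVec_bup hx, mulVec_smul]
    simp only [dotProduct_add, smul_dotProduct, dotProduct_smul, smul_eq_mul, hw, h.unit x hx, hww,
      dotProduct_comm w (cov b x)]
    ring
  have hD : ∀ t, discr a b m x (Y t) = m * κ * t ^ 2 - 1 := by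
    intro t; rw [discr, hA, hB]; ring
  have hQu : ∀ t, ∑ k, u k * pd k (sprayDen m a b x) (Y t) = 2 * m * t * κ * ζ := by
    intro t
    have hcu : cov b x ⬝ᵥ u = 0 := by simp [hu, hw, hz]
    have hYl : (Y t).ofLp = bup a b x + t • w := rfl
    have hau : u ⬝ᵥ a x *ᵥ (Y t).ofLp = t * κ * ζ := by
      rw [hYl, mulVec_add, h.mulVec_bup hx, mulVec_smul, dotProduct_add, dotProduct_comm, hcu,
        dotProduct_smul]
      simp only [hu, add_dotProduct, smul_dotProduct, hww, hwz, smul_eq_mul]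
      ring
    rw [h.sum_pd_sprayDen hx, hcu, hau, hB]
    ring
  set X1 : ℝ → ℝ := fun t => ∑ i, W t i * regularPart m a b x (Y t) i with hX1
  set X3 : ℝ → ℝ := fun t => ∑ j, regularPart m a b x (Y t) j * pd j (sprayDen m a b x) (Y t)
          + m * numer a b m x (Y t) * ((1 + κ * t ^ 2) / 2 - 3) with hX3
  set X4 : ℝ → ℝ := fun t => ∑ i, ∑ k, W t i * S i k (Y t) * u k with hX4
  have pN : IsPoly (fun t => numer a b m x (Y t)) := line (h.polyJet_numer hx).poly
  have pA : IsPoly (fun t => 1 + κ * t ^ 2) := by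
    simp_rw [← hA]; exact line (h.polyJet_alphaSq hx).poly
  have pW : ∀ i, IsPoly (fun t => W t i) := fun i =>
    (((IsPoly.id.mul (IsPoly.const κ)).mul (IsPoly.const _)).sub (IsPoly.const _)).add
      (IsPoly.const _)
  have pR : ∀ i, IsPoly (fun t => regularPart m a b x (Y t) i) := fun i =>
    line (h.polyJet_regularPart hx i).poly
  have p1 : IsPoly X1 := IsPoly.sum fun i => (pW i).mul (pR i)
  have p3 : IsPoly X3 := by
    refine (IsPoly.sum fun j => (pR j).mul (line ((h.polyJet_sprayDen hx).poly.pd j))).add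
      (((IsPoly.const m).mul pN).mul (IsPoly.sub ?_ (IsPoly.const 3)))
    simp only [div_eq_mul_inv]
    exact pA.mul (IsPoly.const _)
  have p4 : IsPoly X4 := IsPoly.sum fun i => IsPoly.sum fun k =>
    ((pW i).mul (line (hSp i k))).mul (IsPoly.const _)
  -- The quotient by D of everything in the expanded product except the term without D, plus the
  -- contracted remainder X4.
  refine ⟨fun t => 6 * m * t * κ * ζ * ((m * κ * t ^ 2 - 1) * X1 t * X3 t
      - X1 t * (m * numer a b m x (Y t) * (1 + κ * t ^ 2))
      + X3 t * (m * numer a b m x (Y t) * (1 + κ * t ^ 2) * (1 / 2) * (t * κ))) + X4 t, ?_, ?_⟩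
  · have pm : IsPoly (fun t => m * numer a b m x (Y t) * (1 + κ * t ^ 2)) :=
      ((IsPoly.const m).mul pN).mul pA
    have pD : IsPoly (fun t => m * κ * t ^ 2 - 1) := by
      simp_rw [← hD]; exact line (h.polyJet_discr hx).poly
    refine IsPoly.add (IsPoly.mul ?_ ?_) p4
    · exact (((IsPoly.const (6 * m)).mul IsPoly.id).mul (IsPoly.const _)).mul (IsPoly.const _)
    · exact (((pD.mul p1).mul p3).sub (p1.mul pm)).add
        (p3.mul ((pm.mul (IsPoly.const _)).mul (IsPoly.id.mul (IsPoly.const _))))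
  · intro t ht
    have hBt : 0 < beta b x (Y t) := by rw [hB]; exact one_pos
    have hDt : discr a b m x (Y t) ≠ 0 := by rw [hD]; exact ht
    have c0 := hS.contract hBt hDt (hWu t) (hWY t)
    have hQ : sprayDen m a b x (Y t) = m * κ * t ^ 2 - 1 := by rw [sprayDen, hB, hD, one_mul]
    have c1 : 3 * (∑ i, W t i * sprayNum m a b i x (Y t))
        * (∑ j, sprayNum m a b j x (Y t) * pd j (sprayDen m a b x) (Y t))
        * (∑ k, u k * pd k (sprayDen m a b x) (Y t)) + (m * κ * t ^ 2 - 1) * X4 t = 0 := by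
      have c2 : sprayDen m a b x (Y t) ^ 4 *
          ∑ i, ∑ k, W t i * riemCurv F i k x (Y t) * u k = 0 := by rw [c0, mul_zero]
      rw [← c2, hX4]
      generalize hT : ∑ j, sprayNum m a b j x (Y t) * pd j (sprayDen m a b x) (Y t) = T
      have c3 : ∀ i k, sprayDen m a b x (Y t) ^ 4 * (W t i * riemCurv F i k x (Y t) * u k)
          = W t i * (3 * sprayNum m a b i x (Y t) * T * pd k (sprayDen m a b x) (Y t)
            + (m * κ * t ^ 2 - 1) * S i k (Y t)) * u k := by
        intro i k
        have := hS' (Y t) hBt hDt i k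
        rw [hT, hQ] at this
        rw [hQ, ← this]; ring
      have c4 : ∀ i k, W t i * (3 * sprayNum m a b i x (Y t) * T * pd k (sprayDen m a b x) (Y t)
            + (m * κ * t ^ 2 - 1) * S i k (Y t)) * u k
          = 3 * (W t i * sprayNum m a b i x (Y t)) * T * (u k * pd k (sprayDen m a b x) (Y t))
            + (m * κ * t ^ 2 - 1) * (W t i * S i k (Y t) * u k) := fun i k => by ring
      rw [Finset.mul_sum]
      simp_rw [Finset.mul_sum (a := sprayDen m a b x (Y t) ^ 4), c3, c4, Finset.sum_add_distrib,
        ← Finset.mul_sum, ← Finset.sum_mul, ← Finset.mul_sum]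
    rw [dot_sprayNum (hWY t), h.sum_sprayNum_pd_sprayDen hx, hQu, hWX, hD, hA, hB] at c1
    simp only [one_pow, mul_one] at c1
    have c5 : ∑ i, W t i * regularPart m a b x (Y t) i = X1 t := rfl
    have c6 : ∑ j, regularPart m a b x (Y t) j * pd j (sprayDen m a b x) (Y t)
          + m * numer a b m x (Y t) * ((1 + κ * t ^ 2) / 2 - 3) = X3 t := rfl
    rw [c5, c6] at c1
    clear_value X1 X3 X4
    linear_combination -c1

/-- The first consequence of scalar curvature: `β` is a Killing form whose dual field is
geodesic. -/
theorem killing (h : UnitPair a b U) (hF : IsKropinaEnergy m a b U F) (hn : 3 ≤ n) (hm0 : m ≠ 0)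
    (hm1 : m ≠ 1) (hm : m ≠ -1) (hx : x ∈ U) (hS : IsScalarAt m a b F x) :
    (∀ v, quad (covD a b x) v = 0) ∧ ∀ w, bup a b x ⬝ᵥ curl b x *ᵥ w = 0 := by
  have hm1' : 1 - m ≠ 0 := sub_ne_zero.2 hm1.symm
  set X := bup a b x with hX
  have hXc : ∀ w, X ⬝ᵥ covD a b x *ᵥ w = 0 := h.bup_dot_covD hx
  have hcurl : ∀ v w, v ⬝ᵥ curl b x *ᵥ w
      = 1 / 2 * (v ⬝ᵥ covD a b x *ᵥ w - w ⬝ᵥ covD a b x *ᵥ v) := by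
    intro v w
    -- The symmetric Christoffel terms cancel, so the curl is the antisymmetric part of the
    -- covariant derivative.
    have : curl b x = (1 / 2 : ℝ) • (covD a b x - (covD a b x)ᵀ) := by
      ext i j; rw [h.curl_eq_covD hx]; simp
    rw [this, smul_mulVec, sub_mulVec, dotProduct_smul, dotProduct_sub, smul_eq_mul,
      dotProduct_mulVec v (covD a b x)ᵀ, ← mulVec_transpose, transpose_transpose,
      dotProduct_comm _ w]
  have key : ∀ w, cov b x ⬝ᵥ w = 0 → w ≠ 0 →
      quad (covD a b x) w = 0 ∧ w ⬝ᵥ covD a b x *ᵥ X = 0 := by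
    intro w hw hw0
    obtain ⟨z, hz0, hz, hwz⟩ := exists_ne_zero_dot_eq_zero hn (cov b x) (a x *ᵥ w)
    obtain ⟨S, hSp, hid⟩ := h.numer_line_divisible hF hm1 hx hS hw hz
      (by rw [dotProduct_comm]; exact hwz)
    set κ := quad (a x) w with hκ
    set ζ := quad (a x) z with hζ
    have hκ0 : κ ≠ 0 := (h.quad_pos hx hw0).ne'
    have hζ0 : ζ ≠ 0 := (h.quad_pos hx hz0).ne'
    set ρ := w ⬝ᵥ covD a b x *ᵥ X with hρ
    -- Because X annihilates the covariant derivative from the left, only r(w, w) and ρ = w ·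
    -- b_{i|j} X enter. The latter appears through r₀₀ and again, with factor -1/2, through the
    -- curl.
    have hN : ∀ t : ℝ, numer a b m x (WithLp.toLp 2 (X + t • w))
        = (ρ * (1 + m / (1 - m))) * t + quad (covD a b x) w * t ^ 2
          + (m / (1 - m) * κ * ρ) * t ^ 3 := by
      intro t
      have e1 : beta b x (WithLp.toLp 2 (X + t • w)) = 1 := by
        change cov b x ⬝ᵥ (X + t • w) = 1
        rw [dotProduct_add, dotProduct_smul, hw, h.unit x hx]; simp
      have e2 : alphaSq a x (WithLp.toLp 2 (X + t • w)) = 1 + κ * t ^ 2 := by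
        change (X + t • w) ⬝ᵥ a x *ᵥ (X + t • w) = _
        have hww : w ⬝ᵥ a x *ᵥ w = κ := rfl
        have hbX : cov b x ⬝ᵥ X = 1 := h.unit x hx
        rw [add_dotProduct, h.bup_dot hx, mulVec_add, h.mulVec_bup hx, mulVec_smul]
        simp only [dotProduct_add, smul_dotProduct, dotProduct_smul, smul_eq_mul, hw,
          hbX, hww, dotProduct_comm w (cov b x)]
        ring
      have e3 : quad (covD a b x) (X + t • w) = ρ * t + quad (covD a b x) w * t ^ 2 := by
        simp only [quad, mulVec_add, mulVec_smul, dotProduct_add, add_dotProduct, smul_dotProduct,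
          dotProduct_smul, smul_eq_mul, hXc, ← hρ]
        ring
      have e4 : X ⬝ᵥ curl b x *ᵥ (X + t • w) = - (1 / 2) * ρ * t := by
        rw [hcurl, hXc, add_dotProduct, hXc, smul_dotProduct, ← hρ, smul_eq_mul]; ring
      rw [numer, e1, e2]
      simp only [← hX, e3, e4]
      ring
    simp_rw [← hX, hN] at hid
    obtain ⟨h1, h2⟩ := cubic_eq_zero_of_dvd hm0 hm hκ0
      (c := 3 * m ^ 3 * κ ^ 2 * ζ) (by positivity) hSp hid
    refine ⟨h1, ?_⟩
    -- Since 1 + m/(1-m) = 1/(1-m), the relation n₁mκ + n₃ = 0 reads 2mκρ/(1-m) = 0.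
    have h3 : 2 * m * κ * ρ = 0 := by
      field_simp at h2
      linear_combination h2
    simpa [hm0, hκ0] using h3
  have key1 : ∀ w, cov b x ⬝ᵥ w = 0 → quad (covD a b x) w = 0 ∧ w ⬝ᵥ covD a b x *ᵥ X = 0 := by
    intro w hw
    by_cases hw0 : w = 0
    · simp [hw0, quad]
    · exact key w hw hw0
  -- Every vector splits into a multiple of X and a vector in the kernel of `b`.
  have dec : ∀ v, ∃ w, cov b x ⬝ᵥ w = 0 ∧ v = (cov b x ⬝ᵥ v) • X + w := fun v =>
    ⟨v - (cov b x ⬝ᵥ v) • X, by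
      rw [dotProduct_sub, dotProduct_smul, h.unit x hx]; simp, by simp⟩
  refine ⟨fun v => ?_, fun v => ?_⟩
  · obtain ⟨w, hw, hv⟩ := dec v
    obtain ⟨h1, h2⟩ := key1 w hw
    rw [hv]
    simp only [quad, mulVec_add, mulVec_smul, dotProduct_add, add_dotProduct, smul_dotProduct,
          dotProduct_smul, smul_eq_mul, hXc, h2] at h1 ⊢
    rw [h1]; ring
  · obtain ⟨w, hw, hv⟩ := dec v
    obtain ⟨h1, h2⟩ := key1 w hw
    rw [hcurl, hXc, hv, add_dotProduct, smul_dotProduct, hXc, h2]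
    simp

end UnitPair

end MKropina

end

/-! ### Curvature of a spray with a pole along a hyperplane. -/

noncomputable section

namespace MKropina

open Filter Topology Matrix

variable {n : ℕ}

/-- The poles of the curvature of a spray with coefficients `Γ^i + P^i / B`, where `B` is a linear
form with `B(P) = 0`. -/
theorem curvOf_linear_pole {Γ P : Fin n → Euc n → ℝ} {Γx Px : Fin n → Fin n → Euc n → ℝ}
    {v : Fin n → ℝ} {T : Matrix (Fin n) (Fin n) ℝ} {B : Euc n → ℝ} {Bx : Fin n → Euc n → ℝ}
    (hΓ : ∀ i, PolyMap (Γ i)) (hP : ∀ i, PolyMap (P i)) (hΓx : ∀ j i, PolyMap (Γx j i))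
    (hPx : ∀ j i, PolyMap (Px j i)) (hB : ∀ y, B y = v ⬝ᵥ y.ofLp)
    (hBx : ∀ j y, Bx j y = T j ⬝ᵥ y.ofLp)
    (hvP : ∀ y, ∑ j, P j y * v j = 0) (hvΓ : ∀ y : Euc n, ∑ j, y j * Bx j y = 2 * ∑ j, Γ j y * v j) :
    ∃ (V : Fin n → Euc n → ℝ) (S : Fin n → Fin n → Euc n → ℝ), (∀ i, PolyMap (V i)) ∧
      (∀ i k, PolyMap (S i k)) ∧ ∀ y, B y ≠ 0 → ∀ i k,
      B y ^ 3 * curvOf (fun i z => Γ i z + P i z / B z)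
        (fun j i z => Γx j i z + Px j i z / B z - P i z * Bx j z / B z ^ 2) i k y
        = - (v k * ∑ j, P j y * pd j (P i) y)
          + B y * (v k * V i y + (P i y * (∑ j, y j * T j k - 2 * Bx k y + ∑ j, v j * pd k (Γ j) y)
            + 2 * ∑ j, P j y * pd k (pd j (P i)) y - ∑ j, pd j (P i) y * pd k (P j) y))
          + B y ^ 2 * S i k y := by
  obtain rfl : B = fun y => v ⬝ᵥ y.ofLp := funext hB
  obtain rfl : Bx = fun j y => T j ⬝ᵥ y.ofLp := by funext j y; exact hBx j y
  clear hB hBx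
  have pB : PolyMap (fun y : Euc n => v ⬝ᵥ y.ofLp) := polyMap_linear v
  refine ⟨fun i y => ∑ j, y j * Px j i y - 2 * ∑ j, Γ j y * pd j (P i) y
      + ∑ j, pd j (Γ i) y * P j y,
    fun i k y => (2 * Px k i y - ∑ j, y j * pd k (Px j i) y
      + 2 * (∑ j, Γ j y * pd k (pd j (P i)) y + ∑ j, P j y * pd k (pd j (Γ i)) y)
      - (∑ j, pd j (Γ i) y * pd k (P j) y + ∑ j, pd j (P i) y * pd k (Γ j) y))
      + (v ⬝ᵥ y.ofLp) * (2 * Γx k i y - ∑ j, y j * pd k (Γx j i) y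
        + 2 * ∑ j, Γ j y * pd k (pd j (Γ i)) y - ∑ j, pd j (Γ i) y * pd k (Γ j) y),
    fun i => ?_, fun i k => ?_, fun y hy i k => ?_⟩
  · exact ((PolyMap.sum fun j => (PolyMap.coord j).mul (hPx j i)).sub
      ((PolyMap.const 2).mul (PolyMap.sum fun j => (hΓ j).mul ((hP i).pd j)))).add
      (PolyMap.sum fun j => ((hΓ i).pd j).mul (hP j))
  · refine PolyMap.add (((((PolyMap.const 2).mul (hPx k i)).sub (PolyMap.sum fun j => ?_)).add
      ((PolyMap.const 2).mul ((PolyMap.sum fun j => ?_).add (PolyMap.sum fun j => ?_)))).sub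
      ((PolyMap.sum fun j => ?_).add (PolyMap.sum fun j => ?_))) (pB.mul
      (((((PolyMap.const 2).mul (hΓx k i)).sub (PolyMap.sum fun j => ?_)).add
      ((PolyMap.const 2).mul (PolyMap.sum fun j => ?_))).sub (PolyMap.sum fun j => ?_)))
    · exact (PolyMap.coord j).mul ((hPx j i).pd k)
    · exact (hΓ j).mul (((hP i).pd j).pd k)
    · exact (hP j).mul (((hΓ i).pd j).pd k)
    · exact ((hΓ i).pd j).mul ((hP j).pd k)
    · exact ((hP i).pd j).mul ((hΓ j).pd k)
    · exact (PolyMap.coord j).mul ((hΓx j i).pd k)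
    · exact (hΓ j).mul (((hΓ i).pd j).pd k)
    · exact ((hΓ i).pd j).mul ((hΓ j).pd k)
  · set B : Euc n → ℝ := fun y => v ⬝ᵥ y.ofLp with hBdef
    have pB' : ∀ k z, pd k B z = v k := fun k z => pd_linear v k z
    have pBx : ∀ j k z, pd k (fun z : Euc n => T j ⬝ᵥ z.ofLp) z = T j k := fun j k z =>
      pd_linear (T j) k z
    have dBx : ∀ j z, DifferentiableAt ℝ (fun z : Euc n => T j ⬝ᵥ z.ofLp) z := fun j z =>
      (polyMap_linear (T j)).differentiable z
    have dB := pB.differentiable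
    have dB2 : DifferentiableAt ℝ (fun z => B z ^ 2) y := (pB.pow 2).differentiable y
    have pB2 : pd k (fun z => B z ^ 2) y = 2 * B y * v k := by
      simp only [pow_two]
      rw [pd_mul (dB y) (dB y), pB']; ring
    have hB2 : B y ^ 2 ≠ 0 := pow_ne_zero 2 hy
    have d1 : ∀ i j z, B z ≠ 0 → pd j (fun z => Γ i z + P i z / B z) z
        = pd j (Γ i) z + pd j (P i) z / B z - P i z * v j / B z ^ 2 := by
      intro i j z hz
      rw [pd_add ((hΓ i).differentiable z)
        (UnitPair.differentiableAt_div ((hP i).differentiable z) (dB z) hz),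
        pd_div ((hP i).differentiable z) (dB z) hz, pB']
      ring
    have d2 : ∀ j, pd k (pd j (fun z => Γ i z + P i z / B z)) y
        = pd k (pd j (Γ i)) y + pd k (pd j (P i)) y / B y
          - (pd j (P i) y * v k + pd k (P i) y * v j) / B y ^ 2
          + 2 * P i y * v j * v k / B y ^ 3 := by
      intro j
      have e : pd j (fun z => Γ i z + P i z / B z) =ᶠ[𝓝 y]
          fun z => pd j (Γ i) z + pd j (P i) z / B z - P i z * v j / B z ^ 2 := by
        filter_upwards [pB.eventually_ne hy] with z hz using d1 i j z hz
      have e1 := UnitPair.differentiableAt_div (((hP i).pd j).differentiable y) (dB y) hy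
      have e2 : DifferentiableAt ℝ (fun z => P i z * v j) y :=
        ((hP i).differentiable y).mul_const _
      rw [pd_congr e, pd_sub ((((hΓ i).pd j).differentiable y).fun_add e1)
        (UnitPair.differentiableAt_div e2 dB2 hB2), pd_add (((hΓ i).pd j).differentiable y) e1,
        pd_div (((hP i).pd j).differentiable y) (dB y) hy, pd_div e2 dB2 hB2, pB2, pB',
        pd_mul_const _ ((hP i).differentiable y)]
      field_simp
      ring
    have d3 : ∀ j, pd k (fun z => Γx j i z + Px j i z / B z - P i z * (T j ⬝ᵥ z.ofLp) / B z ^ 2) y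
        = pd k (Γx j i) y + pd k (Px j i) y / B y
          - (Px j i y * v k + pd k (P i) y * (T j ⬝ᵥ y.ofLp) + P i y * T j k) / B y ^ 2
          + 2 * P i y * (T j ⬝ᵥ y.ofLp) * v k / B y ^ 3 := by
      intro j
      have e1 := UnitPair.differentiableAt_div ((hPx j i).differentiable y) (dB y) hy
      have e2 : DifferentiableAt ℝ (fun z : Euc n => P i z * (T j ⬝ᵥ z.ofLp)) y :=
        ((hP i).differentiable y).fun_mul (dBx j y)
      rw [pd_sub (((hΓx j i).differentiable y).fun_add e1)
        (UnitPair.differentiableAt_div e2 dB2 hB2), pd_add ((hΓx j i).differentiable y) e1,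
        pd_div ((hPx j i).differentiable y) (dB y) hy, pd_div e2 dB2 hB2, pB2, pB',
        pd_mul ((hP i).differentiable y) (dBx j y), pBx]
      field_simp
      ring
    have c8 := hvP y
    have c6 := hvΓ y
    have d7 : ∑ j, v j * pd k (P j) y = 0 := by
      have : pd k (fun y => ∑ j, P j y * v j) y = 0 := by
        rw [show (fun y => ∑ j, P j y * v j) = fun _ => 0 from funext hvP, pd_const]
      rw [pd_sum fun j _ => ((hP j).differentiable y).mul_const _] at this
      rw [← this]
      exact Finset.sum_congr rfl fun j _ => by
        rw [pd_mul_const _ ((hP j).differentiable y), mul_comm]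
    simp only [curvOf]
    simp_rw [d3, d2, d1 _ _ y hy]
    have t1 : ∑ j, y j * (pd k (Γx j i) y + pd k (Px j i) y / B y
          - (Px j i y * v k + pd k (P i) y * (T j ⬝ᵥ y.ofLp) + P i y * T j k) / B y ^ 2
          + 2 * P i y * (T j ⬝ᵥ y.ofLp) * v k / B y ^ 3)
        = ∑ j, y j * pd k (Γx j i) y + (∑ j, y j * pd k (Px j i) y) / B y
          - ((∑ j, y j * Px j i y) * v k + pd k (P i) y * (∑ j, y j * (T j ⬝ᵥ y.ofLp))
            + P i y * ∑ j, y j * T j k) / B y ^ 2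
          + 2 * P i y * (∑ j, y j * (T j ⬝ᵥ y.ofLp)) * v k / B y ^ 3 := by
      simp only [Finset.mul_sum, Finset.sum_mul, Finset.sum_div, ← Finset.sum_add_distrib,
        ← Finset.sum_sub_distrib]
      exact Finset.sum_congr rfl fun j _ => by ring
    have t2 : ∑ j, (Γ j y + P j y / B y) * (pd k (pd j (Γ i)) y + pd k (pd j (P i)) y / B y
          - (pd j (P i) y * v k + pd k (P i) y * v j) / B y ^ 2
          + 2 * P i y * v j * v k / B y ^ 3)
        = ∑ j, Γ j y * pd k (pd j (Γ i)) y + (∑ j, Γ j y * pd k (pd j (P i)) y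
            + ∑ j, P j y * pd k (pd j (Γ i)) y) / B y
          + (∑ j, P j y * pd k (pd j (P i)) y - v k * ∑ j, Γ j y * pd j (P i) y
            - pd k (P i) y * ∑ j, Γ j y * v j) / B y ^ 2
          + (2 * P i y * v k * (∑ j, Γ j y * v j) - v k * (∑ j, P j y * pd j (P i) y)
            - pd k (P i) y * ∑ j, P j y * v j) / B y ^ 3
          + 2 * P i y * v k * (∑ j, P j y * v j) / B y ^ 4 := by
      simp only [Finset.mul_sum, Finset.sum_div, ← Finset.sum_add_distrib,
        ← Finset.sum_sub_distrib]
      exact Finset.sum_congr rfl fun j _ => by ring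
    have t3 : ∑ j, (pd j (Γ i) y + pd j (P i) y / B y - P i y * v j / B y ^ 2)
          * (pd k (Γ j) y + pd k (P j) y / B y - P j y * v k / B y ^ 2)
        = ∑ j, pd j (Γ i) y * pd k (Γ j) y + (∑ j, pd j (Γ i) y * pd k (P j) y
            + ∑ j, pd j (P i) y * pd k (Γ j) y) / B y
          + (∑ j, pd j (P i) y * pd k (P j) y - v k * ∑ j, pd j (Γ i) y * P j y
            - P i y * ∑ j, v j * pd k (Γ j) y) / B y ^ 2
          - (v k * (∑ j, P j y * pd j (P i) y) + P i y * ∑ j, v j * pd k (P j) y) / B y ^ 3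
          + P i y * v k * (∑ j, P j y * v j) / B y ^ 4 := by
      simp only [Finset.mul_sum, Finset.sum_div, ← Finset.sum_add_distrib,
        ← Finset.sum_sub_distrib]
      exact Finset.sum_congr rfl fun j _ => by ring
    -- The condition B(P) = 0 removes the pole of order four. The condition `hvΓ`, which says that B
    -- is constant along the geodesics of Γ, cancels the terms with P_i v_k in order three and those
    -- with the derivatives ∂_k P_i in order two.
    rw [t1, t2, t3, c8, d7, c6]
    have hBy : v ⬝ᵥ y.ofLp = B y := rfl
    rw [hBy]
    clear_value B
    field_simp
    ring

end MKropina

end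

/-! ### Curvature of the Kropina metric of a Killing form. -/

noncomputable section

namespace MKropina

open Filter Topology Matrix

variable {n : ℕ}

namespace UnitPair

variable {m : ℝ} {a : Euc n → Matrix (Fin n) (Fin n) ℝ} {b : Fin n → Euc n → ℝ}
  {U : Set (Euc n)} {F : Euc n → Euc n → ℝ} {x y : Euc n}

variable (b) in
/-- The matrix `(∂_j b_k)_{jk}`. -/
def gradMat (x : Euc n) : Matrix (Fin n) (Fin n) ℝ := Matrix.of fun j k => pd j (b k) x

theorem curl_eq_gradMat : curl b x = (1 / 2 : ℝ) • ((gradMat b x)ᵀ - gradMat b x) := by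
  ext i j
  simp [curl, gradMat]

variable (m a b) in
/-- The numerator `m/(1-m) α² s^i_0` of the singular part of the spray of a Killing form. -/
def killNum (i : Fin n) (x y : Euc n) : ℝ :=
  m / (1 - m) * alphaSq a x y * (curlUp a b x *ᵥ y.ofLp) i

/-- The vanishing of `numer` removes the pole along `discr = 0`; only the one along β = 0 stays. -/
theorem sprayK_of_killing
    (hk : (∀ v, quad (covD a b x) v = 0) ∧ ∀ w, bup a b x ⬝ᵥ curl b x *ᵥ w = 0) (i : Fin n) :
    sprayK a b m x y i = sprayR a x y i + killNum m a b i x y / beta b x y := by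
  have hN : numer a b m x y = 0 := by simp [numer, hk.1, hk.2]
  simp only [sprayK, hN, killNum, Pi.add_apply, Pi.smul_apply, smul_eq_mul]
  ring

theorem polyJet_killNum (h : UnitPair a b U) (hx : x ∈ U) (i : Fin n) :
    PolyJet x (killNum m a b i) :=
  ((PolyJet.const _).mul (h.polyJet_alphaSq hx)).mul (h.polyJet_curlUp hx i)

theorem low_dot_curlUp (h : UnitPair a b U) (hx : x ∈ U) (v w : Fin n → ℝ) :
    (a x *ᵥ v) ⬝ᵥ curlUp a b x *ᵥ w = v ⬝ᵥ curl b x *ᵥ w := by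
  rw [← h.dot_symm hx, h.mulVec_curlUp hx]

theorem pd_killNum (h : UnitPair a b U) (hx : x ∈ U) (i j : Fin n) :
    pd j (killNum m a b i x) y = m / (1 - m) * (2 * (a x *ᵥ y.ofLp) j * (curlUp a b x *ᵥ y.ofLp) i
      + alphaSq a x y * curlUp a b x i j) := by
  have dA := differentiable_alphaSq (a := a) (x := x) y
  have dS := (polyMap_mulVec (curlUp a b x) i).differentiable y
  rw [show killNum m a b i x = fun y => m / (1 - m) * alphaSq a x y * (curlUp a b x *ᵥ y.ofLp) i
    from rfl, pd_mul (dA.const_mul _) dS, pd_const_mul _ dA, h.pd_alphaSq hx, pd_mulVec]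
  ring

theorem pd_pd_killNum (h : UnitPair a b U) (hx : x ∈ U) (i j k : Fin n) :
    pd k (pd j (killNum m a b i x)) y = m / (1 - m) * (2 * a x j k * (curlUp a b x *ᵥ y.ofLp) i
      + 2 * (a x *ᵥ y.ofLp) j * curlUp a b x i k
      + 2 * (a x *ᵥ y.ofLp) k * curlUp a b x i j) := by
  have e : pd j (killNum m a b i x) = fun y => m / (1 - m) *
      (2 * (a x *ᵥ y.ofLp) j * (curlUp a b x *ᵥ y.ofLp) i + alphaSq a x y * curlUp a b x i j) := by
    funext y; exact h.pd_killNum hx i j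
  have dA := differentiable_alphaSq (a := a) (x := x) y
  have dS := (polyMap_mulVec (curlUp a b x) i).differentiable y
  have dL := (polyMap_mulVec (a x) j).differentiable y
  rw [e, pd_const_mul _ (((dL.const_mul 2).fun_mul dS).fun_add (dA.mul_const _)),
    pd_add ((dL.const_mul 2).fun_mul dS) (dA.mul_const _), pd_mul (dL.const_mul 2) dS,
    pd_const_mul _ dL, pd_mulVec, pd_mulVec, pd_mul_const _ dA, h.pd_alphaSq hx]

/-- The polar terms of orders three and two are explicit, except for b_k V. This unspecified part
disappears after contraction with u such that b(u) = 0, and in other contractions it only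
contributes to lower order. -/
theorem riemCurv_of_killing (h : UnitPair a b U) (hF : IsKropinaEnergy m a b U F) (hm1 : m ≠ 1)
    (hk : ∀ x ∈ U, (∀ v, quad (covD a b x) v = 0) ∧ ∀ w, bup a b x ⬝ᵥ curl b x *ᵥ w = 0)
    (hx : x ∈ U) :
    ∃ (V : Fin n → Euc n → ℝ) (S : Fin n → Fin n → Euc n → ℝ), (∀ i, PolyMap (V i)) ∧
      (∀ i k, PolyMap (S i k)) ∧ ∀ y, 0 < beta b x y → discr a b m x y ≠ 0 → ∀ i k,
      beta b x y ^ 3 * riemCurv F i k x y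
        = - (b k x * ((m / (1 - m)) ^ 2 * alphaSq a x y ^ 2
            * (curlUp a b x *ᵥ curlUp a b x *ᵥ y.ofLp) i))
          + beta b x y * (b k x * V i y
            + ((3 * (m / (1 - m)) + 6 * (m / (1 - m)) ^ 2) * alphaSq a x y
                * (curlUp a b x *ᵥ y.ofLp) i * (curl b x *ᵥ y.ofLp) k
              + (m / (1 - m)) ^ 2 * alphaSq a x y * (2 * (a x *ᵥ y.ofLp) k
                * (curlUp a b x *ᵥ curlUp a b x *ᵥ y.ofLp) i
                - alphaSq a x y * (curlUp a b x * curlUp a b x) i k)))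
          + beta b x y ^ 2 * S i k y := by
  have hkx := hk x hx
  have hΓ := fun i => h.polyJet_sprayR hx i
  have hP := fun i => h.polyJet_killNum (m := m) hx i
  have hPd : ∀ y, (fun j => killNum m a b j x y)
      = (m / (1 - m) * alphaSq a x y) • (curlUp a b x *ᵥ y.ofLp) := fun y => rfl
  have hvP : ∀ y, ∑ j, killNum m a b j x y * cov b x j = 0 := by
    intro y
    change (fun j => killNum m a b j x y) ⬝ᵥ cov b x = 0
    rw [hPd, smul_dotProduct, dotProduct_comm, h.cov_dot_curlUp hx, hkx.2, smul_zero]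
  -- For r₀₀ = 0 the form β is constant along the geodesics of `a`; this is the hypothesis `hvΓ` of
  -- `curvOf_linear_pole`.
  have hvΓ' : ∀ y : Euc n, cov b x ⬝ᵥ sprayR a x y = 1 / 2 * quad (gradMat b x) y.ofLp := by
    intro y
    rw [cov_dot_sprayR, hkx.1, sub_zero]
    congr 1
    simp only [quad, dotProduct]
    exact Finset.sum_congr rfl fun j _ => mul_comm _ _
  obtain ⟨V, S, hV, hS, hid⟩ := curvOf_linear_pole (Γ := fun i z => sprayR a x z i)
    (P := fun i z => killNum m a b i x z) (Γx := fun j i => pdx j (fun x z => sprayR a x z i) x)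
    (Px := fun j i => pdx j (killNum m a b i) x) (v := cov b x) (T := gradMat b x)
    (B := beta b x) (Bx := fun j z => gradMat b x j ⬝ᵥ z.ofLp)
    (fun i => (hΓ i).poly) (fun i => (hP i).poly) (fun j i => (hΓ i).pdx_poly j)
    (fun j i => (hP i).pdx_poly j) (fun y => rfl) (fun j y => rfl) hvP (fun y => by
      have := hvΓ' y
      rw [show ∑ j, sprayR a x y j * cov b x j = cov b x ⬝ᵥ sprayR a x y from
        dotProduct_comm _ _, this]
      change quad (gradMat b x) y.ofLp = _
      ring)
  refine ⟨V, S, hV, hS, fun y hy hD i k => ?_⟩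
  have e0 : riemCurv F i k x y = curvOf (fun i z => sprayR a x z i + killNum m a b i x z / beta b x z)
      (fun j i z => pdx j (fun x z => sprayR a x z i) x z
        + pdx j (killNum m a b i) x z / beta b x z
        - killNum m a b i x z * (gradMat b x j ⬝ᵥ z.ofLp) / beta b x z ^ 2) i k y := by
    rw [h.riemCurv_eq_sprayK hF hm1 hx hy hD]
    refine curvOf_congr (fun i => ?_) (fun j i => ?_) i k
    · filter_upwards with z using sprayK_of_killing hkx i
    · filter_upwards [eventually_beta_pos hy] with z hz
      have e : (fun x => sprayK a b m x z i) =ᶠ[𝓝 x]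
          fun x => sprayR a x z i + killNum m a b i x z / beta b x z := by
        filter_upwards [h.isOpen.mem_nhds hx] with w hw using sprayK_of_killing (hk w hw) i
      have eB : pd j (fun x => beta b x z) x = gradMat b x j ⬝ᵥ z.ofLp :=
        pdx_linear (h.differentiableAt_b hx) j z.ofLp
      rw [pd_congr e, pd_add ((hΓ i).diff z) (differentiableAt_div ((hP i).diff z)
        ((h.polyJet_beta hx).diff z) hz.ne'), pd_div ((hP i).diff z) ((h.polyJet_beta hx).diff z)
        hz.ne', eB]
      simp only [pdx]
      ring
  rw [e0, hid y hy.ne' i k]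
  set q := m / (1 - m) with hq
  set A := alphaSq a x y with hA
  set σ := curlUp a b x *ᵥ y.ofLp with hσ
  have hPy : ∀ j, killNum m a b j x y = q * A * σ j := fun j => rfl
  have hlow : ∑ j, (a x *ᵥ y.ofLp) j * σ j = 0 := by
    change (a x *ᵥ y.ofLp) ⬝ᵥ σ = 0
    rw [h.low_dot_curlUp hx, quad_curl]
  have hσσ : ∀ i, ∑ j, curlUp a b x i j * σ j = (curlUp a b x *ᵥ σ) i := fun i => rfl
  have haσ : ∀ k, ∑ j, a x j k * σ j = (curl b x *ᵥ y.ofLp) k := by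
    intro k
    rw [← h.mulVec_curlUp hx]
    exact Finset.sum_congr rfl fun j _ => by rw [h.symm_apply hx j k]
  have hsa : ∑ j, (a x *ᵥ y.ofLp) j * curlUp a b x j k = - (curl b x *ᵥ y.ofLp) k := by
    have e1 : (a x *ᵥ y.ofLp) ᵥ* curlUp a b x = - (curl b x *ᵥ y.ofLp) := by
      rw [← mulVec_transpose, curlUp, transpose_mul, h.inv_symm hx, curl_transpose,
        ← mulVec_mulVec, mulVec_mulVec _ (a x)⁻¹, nonsing_inv_mul _ (h.isUnit_det hx), one_mulVec,
        neg_mulVec]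
    exact congrFun e1 k
  have E1 : ∑ j, killNum m a b j x y * pd j (killNum m a b i x) y
      = q ^ 2 * A ^ 2 * (curlUp a b x *ᵥ σ) i := by
    have : ∀ j, killNum m a b j x y * pd j (killNum m a b i x) y
        = 2 * q ^ 2 * A * σ i * ((a x *ᵥ y.ofLp) j * σ j)
          + q ^ 2 * A ^ 2 * (curlUp a b x i j * σ j) := fun j => by
      rw [h.pd_killNum hx, hPy]; ring
    rw [Finset.sum_congr rfl fun j _ => this j]
    simp_rw [Finset.sum_add_distrib, ← Finset.mul_sum, hlow, hσσ]
    ring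
  -- Symmetric parts of the derivatives of b cancel and three times the curl remains: the 3 in the
  -- coefficient 3q + 6q². The 6q² is made of 4 from `E3`, doubled there, and 2 from `E4`.
  have E2 : ∑ j, y j * gradMat b x j k - 2 * (gradMat b x k ⬝ᵥ y.ofLp)
      + ∑ j, cov b x j * pd k (fun z => sprayR a x z j) y = 3 * (curl b x *ᵥ y.ofLp) k := by
    have e1 : ∑ j, cov b x j * pd k (fun z => sprayR a x z j) y
        = 1 / 2 * ((gradMat b x *ᵥ y.ofLp) k + ((gradMat b x)ᵀ *ᵥ y.ofLp) k) := by
      rw [← pd_quad, ← pd_const_mul _ ((polyMap_quad _).differentiable y)]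
      have : (fun z : Euc n => 1 / 2 * quad (gradMat b x) z.ofLp)
          = fun z => ∑ j, cov b x j * sprayR a x z j := by
        funext z; exact (hvΓ' z).symm
      rw [this, pd_sum fun j _ => ((hΓ j).poly.differentiable y).const_mul _]
      exact Finset.sum_congr rfl fun j _ =>
        (pd_const_mul _ ((hΓ j).poly.differentiable y)).symm
    have e2 : ∑ j, y j * gradMat b x j k = ((gradMat b x)ᵀ *ᵥ y.ofLp) k :=
      Finset.sum_congr rfl fun j _ => mul_comm _ _
    have e3 : gradMat b x k ⬝ᵥ y.ofLp = (gradMat b x *ᵥ y.ofLp) k := rfl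
    rw [e1, e2, e3, curl_eq_gradMat, smul_mulVec, sub_mulVec]
    simp only [Pi.smul_apply, Pi.sub_apply, smul_eq_mul]
    ring
  have E3 : ∑ j, killNum m a b j x y * pd k (pd j (killNum m a b i x)) y
      = q ^ 2 * A * (2 * (curl b x *ᵥ y.ofLp) k * σ i
        + 2 * (a x *ᵥ y.ofLp) k * (curlUp a b x *ᵥ σ) i) := by
    have : ∀ j, killNum m a b j x y * pd k (pd j (killNum m a b i x)) y
        = 2 * q ^ 2 * A * σ i * (a x j k * σ j)
          + 2 * q ^ 2 * A * curlUp a b x i k * ((a x *ᵥ y.ofLp) j * σ j)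
          + 2 * q ^ 2 * A * (a x *ᵥ y.ofLp) k * (curlUp a b x i j * σ j) := fun j => by
      rw [h.pd_pd_killNum hx, hPy]; ring
    rw [Finset.sum_congr rfl fun j _ => this j]
    simp_rw [Finset.sum_add_distrib, ← Finset.mul_sum, hlow, hσσ, haσ]
    ring
  have E4 : ∑ j, pd j (killNum m a b i x) y * pd k (killNum m a b j x) y
      = q ^ 2 * A * (- 2 * (curl b x *ᵥ y.ofLp) k * σ i
        + 2 * (a x *ᵥ y.ofLp) k * (curlUp a b x *ᵥ σ) i
        + A * (curlUp a b x * curlUp a b x) i k) := by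
    have : ∀ j, pd j (killNum m a b i x) y * pd k (killNum m a b j x) y
        = 4 * q ^ 2 * (a x *ᵥ y.ofLp) k * σ i * ((a x *ᵥ y.ofLp) j * σ j)
          + 2 * q ^ 2 * A * σ i * ((a x *ᵥ y.ofLp) j * curlUp a b x j k)
          + 2 * q ^ 2 * A * (a x *ᵥ y.ofLp) k * (curlUp a b x i j * σ j)
          + q ^ 2 * A ^ 2 * (curlUp a b x i j * curlUp a b x j k) := fun j => by
      rw [h.pd_killNum hx, h.pd_killNum hx]; ring
    have hmm : ∑ j, curlUp a b x i j * curlUp a b x j k = (curlUp a b x * curlUp a b x) i k := rfl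
    rw [Finset.sum_congr rfl fun j _ => this j]
    simp_rw [Finset.sum_add_distrib, ← Finset.mul_sum, hlow, hσσ, hsa, hmm]
    ring
  change - (cov b x k * ∑ j, killNum m a b j x y * pd j (killNum m a b i x) y)
    + beta b x y * (cov b x k * V i y + (killNum m a b i x y *
      (∑ j, y j * gradMat b x j k - 2 * (gradMat b x k ⬝ᵥ y.ofLp)
      + ∑ j, cov b x j * pd k (fun z => sprayR a x z j) y)
      + 2 * ∑ j, killNum m a b j x y * pd k (pd j (killNum m a b i x)) y
      - ∑ j, pd j (killNum m a b i x) y * pd k (killNum m a b j x) y))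
    + beta b x y ^ 2 * S i k y = _
  rw [E1, E2, E3, E4, hPy, show cov b x k = b k x from rfl]
  ring

end UnitPair

end MKropina

end

/-! ### Poles along β = 0: the Killing form is closed, hence parallel. -/

noncomputable section

namespace MKropina

open Filter Topology Matrix

variable {n : ℕ}

theorem PolyMap.continuous {f : Euc n → ℝ} (hf : PolyMap f) : Continuous f :=
  hf.differentiable.continuous

namespace UnitPair

variable {m : ℝ} {a : Euc n → Matrix (Fin n) (Fin n) ℝ} {b : Fin n → Euc n → ℝ}
  {U : Set (Euc n)} {F : Euc n → Euc n → ℝ} {x y : Euc n}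

theorem ell_dot (h : UnitPair a b U) (hx : x ∈ U) (u : Fin n → ℝ) :
    ell m a b x y ⬝ᵥ u = 2 * (1 - m) * (y.ofLp ⬝ᵥ a x *ᵥ u) / alphaSq a x y
      + 2 * m * (cov b x ⬝ᵥ u) / beta b x y := by
  have e1 : y.ofLp ⬝ᵥ a x *ᵥ u = ∑ i, (a x *ᵥ y.ofLp) i * u i := h.dot_symm hx _ _
  have e2 : cov b x ⬝ᵥ u = ∑ i, b i x * u i := rfl
  rw [e1, e2]
  simp only [dotProduct, ell, Finset.mul_sum, Finset.sum_div, ← Finset.sum_add_distrib]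
  exact Finset.sum_congr rfl fun i _ => by ring

/-- The contracted curvature of a Killing form, compared with the curvature condition. -/
theorem contract_of_killing (h : UnitPair a b U) (hF : IsKropinaEnergy m a b U F) (hm1 : m ≠ 1)
    (hk : ∀ x ∈ U, (∀ v, quad (covD a b x) v = 0) ∧ ∀ w, bup a b x ⬝ᵥ curl b x *ᵥ w = 0)
    (hx : x ∈ U) {lam : Euc n → ℝ} (hlam : ∀ y, 0 < beta b x y → discr a b m x y ≠ 0 → ∀ i k,
      riemCurv F i k x y = lam y * ((if i = k then 1 else 0) - y i * (ell m a b x y k / 2)))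
    (w u : Fin n → ℝ) :
    ∃ (f g : Euc n → ℝ), Continuous f ∧ Continuous g ∧
      ((cov b x ⬝ᵥ u) = 0 → f = fun _ => 0) ∧
      ∀ y, 0 < beta b x y → discr a b m x y ≠ 0 →
      beta b x y ^ 3 * (lam y * (w ⬝ᵥ u - (w ⬝ᵥ y.ofLp) * (ell m a b x y ⬝ᵥ u) / 2))
        = - ((cov b x ⬝ᵥ u) * ((m / (1 - m)) ^ 2 * alphaSq a x y ^ 2
            * (w ⬝ᵥ curlUp a b x *ᵥ curlUp a b x *ᵥ y.ofLp)))
          + beta b x y * (f y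
            + ((3 * (m / (1 - m)) + 6 * (m / (1 - m)) ^ 2) * alphaSq a x y
                * (w ⬝ᵥ curlUp a b x *ᵥ y.ofLp) * (u ⬝ᵥ curl b x *ᵥ y.ofLp)
              + (m / (1 - m)) ^ 2 * alphaSq a x y * (2 * (u ⬝ᵥ a x *ᵥ y.ofLp)
                * (w ⬝ᵥ curlUp a b x *ᵥ curlUp a b x *ᵥ y.ofLp)
                - alphaSq a x y * (w ⬝ᵥ (curlUp a b x * curlUp a b x) *ᵥ u))))
          + beta b x y ^ 2 * g y := by
  obtain ⟨V, S, hV, hSp, hid⟩ := h.riemCurv_of_killing hF hm1 hk hx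
  -- The unknown V occurs only with b_k, so its contraction carries the factor b(u).
  refine ⟨fun y => (cov b x ⬝ᵥ u) * ∑ i, w i * V i y, fun y => ∑ i, ∑ k, w i * S i k y * u k,
    continuous_const.mul (continuous_finsetSum _ fun i _ => continuous_const.mul (hV i).continuous),
    continuous_finsetSum _ fun i _ => continuous_finsetSum _ fun k _ =>
      (continuous_const.mul (hSp i k).continuous).mul continuous_const,
    fun h0 => by simp [h0], fun y hy hD => ?_⟩
  have h1 := sum_sum_scalar (lam y) w u y.ofLp (ell m a b x y)
  simp_rw [← hlam y hy hD] at h1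
  rw [← h1]
  set q := m / (1 - m)
  set A := alphaSq a x y
  set B := beta b x y
  have h2 : B ^ 3 * ∑ i, ∑ k, w i * riemCurv F i k x y * u k
      = ∑ i, ∑ k, w i * (- (b k x * (q ^ 2 * A ^ 2 * (curlUp a b x *ᵥ curlUp a b x *ᵥ y.ofLp) i))
          + B * (b k x * V i y + ((3 * q + 6 * q ^ 2) * A
                * (curlUp a b x *ᵥ y.ofLp) i * (curl b x *ᵥ y.ofLp) k
              + q ^ 2 * A * (2 * (a x *ᵥ y.ofLp) k * (curlUp a b x *ᵥ curlUp a b x *ᵥ y.ofLp) i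
                - A * (curlUp a b x * curlUp a b x) i k))) + B ^ 2 * S i k y) * u k := by
    simp only [Finset.mul_sum]
    refine Finset.sum_congr rfl fun i _ => Finset.sum_congr rfl fun k _ => ?_
    rw [← hid y hy hD i k]; ring
  rw [h2]
  have e1 : cov b x ⬝ᵥ u = ∑ k, b k x * u k := rfl
  have e2 : u ⬝ᵥ curl b x *ᵥ y.ofLp = ∑ k, u k * (curl b x *ᵥ y.ofLp) k := rfl
  have e3 : u ⬝ᵥ a x *ᵥ y.ofLp = ∑ k, u k * (a x *ᵥ y.ofLp) k := rfl
  have e4 : w ⬝ᵥ (curlUp a b x * curlUp a b x) *ᵥ u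
      = ∑ i, ∑ k, w i * (curlUp a b x * curlUp a b x) i k * u k := by
    simp only [dotProduct, mulVec, Finset.mul_sum, mul_assoc]
  have e5 : ∀ z, w ⬝ᵥ curlUp a b x *ᵥ z = ∑ i, w i * (curlUp a b x *ᵥ z) i := fun z => rfl
  rw [e1, e2, e3, e4, e5, e5]
  generalize curlUp a b x *ᵥ curlUp a b x *ᵥ y.ofLp = ss
  generalize curlUp a b x *ᵥ y.ofLp = s
  generalize curl b x *ᵥ y.ofLp = c
  generalize a x *ᵥ y.ofLp = l
  generalize curlUp a b x * curlUp a b x = M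
  have h3 : ∀ i k, w i * (- (b k x * (q ^ 2 * A ^ 2 * ss i))
          + B * (b k x * V i y + ((3 * q + 6 * q ^ 2) * A * s i * c k
              + q ^ 2 * A * (2 * l k * ss i - A * M i k))) + B ^ 2 * S i k y) * u k
      = - (q ^ 2 * A ^ 2) * ((w i * ss i) * (b k x * u k)) + B * ((w i * V i y) * (b k x * u k))
        + B * (3 * q + 6 * q ^ 2) * A * ((w i * s i) * (u k * c k))
        + 2 * B * q ^ 2 * A * ((w i * ss i) * (u k * l k))
        - B * q ^ 2 * A ^ 2 * (w i * M i k * u k) + B ^ 2 * (w i * S i k y * u k) := by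
    intro i k; ring
  simp_rw [h3, Finset.sum_add_distrib, Finset.sum_sub_distrib, Finset.sum_add_distrib,
    ← Finset.mul_sum, ← Finset.sum_mul]
  ring

/-- The second consequence of scalar curvature: a Killing form is closed. -/
theorem curlUp_mulVec_eq_zero (h : UnitPair a b U) (hF : IsKropinaEnergy m a b U F)
    (hm0 : m ≠ 0) (hm1 : m ≠ 1) (hm : m ≠ -1)
    (hk : ∀ x ∈ U, (∀ v, quad (covD a b x) v = 0) ∧ ∀ w, bup a b x ⬝ᵥ curl b x *ᵥ w = 0)
    (hx : x ∈ U) (hS : IsScalarAt m a b F x) {w : Fin n → ℝ} (hw : cov b x ⬝ᵥ w = 0) :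
    curlUp a b x *ᵥ w = 0 := by
  by_contra hp0
  have hw0 : w ≠ 0 := by rintro rfl; simp at hp0
  have hm1' : 1 - m ≠ 0 := sub_ne_zero.2 hm1.symm
  set s := curlUp a b x with hs
  set p := s *ᵥ w with hp
  set X := bup a b x with hX
  set q := m / (1 - m) with hq
  have hq0 : q ≠ 0 := div_ne_zero hm0 hm1'
  set κ := quad (a x) w with hκ
  set ρ := quad (a x) p with hρ
  have hκ0 : 0 < κ := h.quad_pos hx hw0
  have hρ0 : 0 < ρ := h.quad_pos hx hp0
  have hcs : ∀ v, cov b x ⬝ᵥ s *ᵥ v = 0 := fun v => by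
    rw [h.cov_dot_curlUp hx]; exact (hk x hx).2 v
  have hbX : cov b x ⬝ᵥ X = 1 := h.unit x hx
  have has : ∀ u v, (a x *ᵥ u) ⬝ᵥ s *ᵥ v = u ⬝ᵥ curl b x *ᵥ v := h.low_dot_curlUp hx
  have hpc : p ⬝ᵥ curl b x *ᵥ w = ρ := by
    rw [← h.mulVec_curlUp hx]; rfl
  have hwsp : (a x *ᵥ w) ⬝ᵥ s *ᵥ p = -ρ := by
    rw [has, dot_curl, hpc]
  have hwp : (a x *ᵥ p) ⬝ᵥ w = 0 := by
    rw [← h.dot_symm hx, dotProduct_comm, has, quad_curl]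
  -- The hyperplane is approached from inside the domain: β(w + tX) = t. In the limit the
  -- discriminant is mκ ≠ 0, so the metric is nondegenerate for small t > 0.
  set Y : ℝ → Euc n := fun t => WithLp.toLp 2 (w + t • X) with hY
  have hYc : Continuous Y := (PiLp.continuous_toLp 2 _).comp (by fun_prop)
  have hY0 : (Y 0).ofLp = w := by simp [hY]
  have hYt : ∀ t, (Y t).ofLp = w + t • X := fun t => rfl
  have hB : ∀ t, beta b x (Y t) = t := by
    intro t
    change cov b x ⬝ᵥ (w + t • X) = t
    rw [dotProduct_add, dotProduct_smul, hw, hbX]; simp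
  have hA0 : alphaSq a x (Y 0) = κ := by rw [alphaSq, hY0]
  have cA : Continuous (fun t => alphaSq a x (Y t)) :=
    (differentiable_alphaSq (a := a) (x := x)).continuous.comp hYc
  have hD0 : discr a b m x (Y 0) = m * κ := by rw [discr, hA0, hB]; ring
  have evD : ∀ᶠ t in 𝓝[>] (0 : ℝ), 0 < t ∧ discr a b m x (Y t) ≠ 0 := by
    have c : ContinuousAt (fun t => discr a b m x (Y t)) 0 :=
      ((h.polyJet_discr hx).poly.continuous.comp hYc).continuousAt
    have : ∀ᶠ t in 𝓝 (0 : ℝ), discr a b m x (Y t) ≠ 0 :=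
      c.eventually_ne (by rw [hD0]; exact mul_ne_zero hm0 hκ0.ne')
    filter_upwards [self_mem_nhdsWithin, this.filter_mono nhdsWithin_le_nhds] with t h1 h2
      using ⟨h1, h2⟩
  have clin : ∀ (M : Matrix (Fin n) (Fin n) ℝ) (v : Fin n → ℝ),
      Continuous (fun t => v ⬝ᵥ M *ᵥ (Y t).ofLp) := by
    intro M v
    simp_rw [dotProduct_mulVec]
    exact (polyMap_linear (v ᵥ* M)).continuous.comp hYc
  have cs : ∀ v : Fin n → ℝ, Continuous (fun t => v ⬝ᵥ s *ᵥ s *ᵥ (Y t).ofLp) := by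
    intro v
    simp_rw [mulVec_mulVec]
    exact clin _ v
  obtain ⟨lam, hlam⟩ := hS
  -- contractions with `bup`
  have contrX : ∀ v, cov b x ⬝ᵥ v = 0 → ∃ Φ : ℝ → ℝ,
      Tendsto Φ (𝓝[>] 0) (𝓝 (- (q ^ 2 * κ ^ 2 * ((a x *ᵥ v) ⬝ᵥ s *ᵥ p)))) ∧
      ∀ t, 0 < t → discr a b m x (Y t) ≠ 0 → Φ t = - ((a x *ᵥ v) ⬝ᵥ w) * (lam (Y t) * t ^ 2)
        * ((1 - m) * t ^ 2 / alphaSq a x (Y t) + m) := by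
    intro v hv
    obtain ⟨f, g, hf, hg, -, hid⟩ := h.contract_of_killing hF hm1 hk hx hlam (a x *ᵥ v) X
    refine ⟨fun t => - (q ^ 2 * alphaSq a x (Y t) ^ 2 * ((a x *ᵥ v) ⬝ᵥ s *ᵥ s *ᵥ (Y t).ofLp))
      + t * (f (Y t) + ((3 * q + 6 * q ^ 2) * alphaSq a x (Y t)
                * ((a x *ᵥ v) ⬝ᵥ s *ᵥ (Y t).ofLp) * (X ⬝ᵥ curl b x *ᵥ (Y t).ofLp)
              + q ^ 2 * alphaSq a x (Y t) * (2 * (X ⬝ᵥ a x *ᵥ (Y t).ofLp)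
                * ((a x *ᵥ v) ⬝ᵥ s *ᵥ s *ᵥ (Y t).ofLp)
                - alphaSq a x (Y t) * ((a x *ᵥ v) ⬝ᵥ (s * s) *ᵥ X)))) + t ^ 2 * g (Y t), ?_, ?_⟩
    · have c1 : Continuous (fun t => (a x *ᵥ v) ⬝ᵥ s *ᵥ (Y t).ofLp) := clin s _
      have c2 : Continuous (fun t => X ⬝ᵥ curl b x *ᵥ (Y t).ofLp) := clin _ _
      have c3 : Continuous (fun t => X ⬝ᵥ a x *ᵥ (Y t).ofLp) := clin _ _
      have c4 := cs (a x *ᵥ v)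
      have c5 := hf.comp hYc
      have c6 := hg.comp hYc
      refine Tendsto.mono_left (Continuous.tendsto' ?_ _ _ ?_) nhdsWithin_le_nhds
      · simp only [Function.comp_def] at c5 c6
        fun_prop
      · rw [hA0, hY0]; simp [hp]
    · intro t ht hD
      have := hid (Y t) (by rw [hB]; exact ht) hD
      rw [hbX, h.ell_dot hx, h.dot_bup hx, show cov b x ⬝ᵥ (Y t).ofLp = beta b x (Y t) from rfl, hB,
        hbX, dotProduct_comm (a x *ᵥ v) X, h.bup_dot hx, hv, hYt, dotProduct_add, dotProduct_smul,
        dotProduct_comm (a x *ᵥ v) X, h.bup_dot hx, hv, smul_zero, add_zero, one_mul, ← hYt] at this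
      refine Eq.trans this.symm ?_
      have hA := (h.alphaSq_pos hx (y := Y t) (by rw [hB]; exact ht)).ne'
      field_simp
      ring
  -- Contracting with w and X isolates the order-three pole: λβ² has a finite limit determined by κ
  -- = |w|² and ρ = |sw|².
  have limLam : Tendsto (fun t => lam (Y t) * t ^ 2) (𝓝[>] 0) (𝓝 (- (q ^ 2 * κ * ρ / m))) := by
    obtain ⟨Φ, hΦ, hΦ'⟩ := contrX w hw
    have hden : Tendsto (fun t => - κ * ((1 - m) * t ^ 2 / alphaSq a x (Y t) + m)) (𝓝[>] 0)
        (𝓝 (-κ * m)) := by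
      refine Tendsto.mono_left (ContinuousAt.tendsto (f := fun t =>
        - κ * ((1 - m) * t ^ 2 / alphaSq a x (Y t) + m)) ?_ |>.trans ?_) nhdsWithin_le_nhds
      · have := cA.continuousAt (x := 0)
        have h0 : alphaSq a x (Y 0) ≠ 0 := by rw [hA0]; exact hκ0.ne'
        fun_prop (disch := assumption)
      · simp
    have hne : -κ * m ≠ 0 := mul_ne_zero (neg_ne_zero.2 hκ0.ne') hm0
    have := hΦ.div hden hne
    rw [hwsp] at this
    have e : - (q ^ 2 * κ ^ 2 * -ρ) / (-κ * m) = - (q ^ 2 * κ * ρ / m) := by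
      field_simp
    rw [e] at this
    refine this.congr' ?_
    have hww : (a x *ᵥ w) ⬝ᵥ w = κ := by rw [dotProduct_comm]; rfl
    filter_upwards [evD, hden.eventually_ne hne] with t ht hnt
    simp only [Pi.div_apply]
    rw [hΦ' t ht.1 ht.2, hww, div_eq_iff hnt]
    ring
  have hsp : s *ᵥ p = - (ρ / κ) • w := by
    -- v is the part of s²w orthogonal to w. Contracting with v and X kills the λ term, so v is
    -- orthogonal to s²w as well; hence |v|² = 0.
    set v := s *ᵥ p + (ρ / κ) • w with hv
    have hvb : cov b x ⬝ᵥ v = 0 := by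
      rw [hv, dotProduct_add, hcs, dotProduct_smul, hw]; simp
    have hvw : (a x *ᵥ v) ⬝ᵥ w = 0 := by
      rw [← h.dot_symm hx, dotProduct_comm, hv, dotProduct_add, hwsp, dotProduct_smul,
        show (a x *ᵥ w) ⬝ᵥ w = κ by rw [dotProduct_comm]; rfl, smul_eq_mul]
      field_simp
      ring
    obtain ⟨Φ, hΦ, hΦ'⟩ := contrX v hvb
    have h0 : Tendsto Φ (𝓝[>] 0) (𝓝 0) := by
      refine tendsto_const_nhds.congr' ?_
      filter_upwards [evD] with t ht
      rw [hΦ' t ht.1 ht.2, hvw]; ring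
    have h1 := tendsto_nhds_unique hΦ h0
    have h2 : (a x *ᵥ v) ⬝ᵥ s *ᵥ p = 0 := by
      have : q ^ 2 * κ ^ 2 ≠ 0 := by positivity
      simpa [this, hq0, hκ0.ne'] using h1
    have h3 : quad (a x) v = 0 := by
      have : quad (a x) v = (a x *ᵥ v) ⬝ᵥ (s *ᵥ p + (ρ / κ) • w) := by
        rw [quad, dotProduct_comm]
      rw [this, dotProduct_add, h2, dotProduct_smul, hvw]; simp
    have h4 : v = 0 := by
      by_contra h4
      exact (h.quad_pos hx h4).ne' h3
    rw [hv] at h4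
    rw [neg_smul]
    exact eq_neg_of_add_eq_zero_left h4
  -- Contracting with p = sw, where b(p) = 0, removes the order-three pole and the unknown V. After
  -- division by t the order-two pole gives λβ²ρ a limit.
  have limP : Tendsto (fun t => lam (Y t) * t ^ 2 * ρ) (𝓝[>] 0)
      (𝓝 ((3 * q + 6 * q ^ 2) * κ * ρ ^ 2 + q ^ 2 * κ * ρ ^ 2)) := by
    obtain ⟨f, g, hf, hg, hf0, hid⟩ := h.contract_of_killing hF hm1 hk hx hlam (a x *ᵥ p) p
    have hbp : cov b x ⬝ᵥ p = 0 := hcs w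
    have hap : (a x *ᵥ p) ⬝ᵥ p = ρ := by rw [dotProduct_comm]; rfl
    have hssp : (s * s) *ᵥ p = - (ρ / κ) • p := by
      rw [← mulVec_mulVec, hsp, mulVec_smul]
    set Ψ : ℝ → ℝ := fun t => ((3 * q + 6 * q ^ 2) * alphaSq a x (Y t)
                * ((a x *ᵥ p) ⬝ᵥ s *ᵥ (Y t).ofLp) * (p ⬝ᵥ curl b x *ᵥ (Y t).ofLp)
              + q ^ 2 * alphaSq a x (Y t) * (2 * (p ⬝ᵥ a x *ᵥ (Y t).ofLp)
                * ((a x *ᵥ p) ⬝ᵥ s *ᵥ s *ᵥ (Y t).ofLp)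
                - alphaSq a x (Y t) * ((a x *ᵥ p) ⬝ᵥ (s * s) *ᵥ p))) + t * g (Y t) with hΨ
    have hΨ0 : Ψ 0 = (3 * q + 6 * q ^ 2) * κ * ρ ^ 2 + q ^ 2 * κ * ρ ^ 2 := by
      have e1 : p ⬝ᵥ a x *ᵥ w = 0 := by rw [h.dot_symm hx]; exact hwp
      simp only [hΨ, hA0, hY0, ← hp, hap, hpc, e1, hssp, dotProduct_smul, smul_eq_mul]
      field_simp
      ring
    have hΨc : Continuous Ψ := by
      have c1 : Continuous (fun t => (a x *ᵥ p) ⬝ᵥ s *ᵥ (Y t).ofLp) := clin s _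
      have c2 : Continuous (fun t => p ⬝ᵥ curl b x *ᵥ (Y t).ofLp) := clin _ _
      have c3 : Continuous (fun t => p ⬝ᵥ a x *ᵥ (Y t).ofLp) := clin _ _
      have c4 := cs (a x *ᵥ p)
      have c6 := hg.comp hYc
      simp only [Function.comp_def] at c6
      rw [hΨ]
      fun_prop
    refine Tendsto.congr' ?_ ((hΨc.tendsto' 0 _ hΨ0).mono_left nhdsWithin_le_nhds)
    filter_upwards [evD] with t ht
    have := hid (Y t) (by rw [hB]; exact ht.1) ht.2
    have hpY : (a x *ᵥ p) ⬝ᵥ (Y t).ofLp = 0 := by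
      rw [hYt, dotProduct_add, hwp, dotProduct_smul, dotProduct_comm (a x *ᵥ p) X, h.bup_dot hx,
        hbp]; simp
    rw [hf0 hbp, hbp, hap, hpY, hB] at this
    have ht0 := ht.1.ne'
    have h5 : t * (lam (Y t) * t ^ 2 * ρ) = t * Ψ t := by
      rw [hΨ]
      linear_combination this
    exact (mul_left_cancel₀ ht0 h5).symm
  -- The two limits agree only if 3q + 7q² = -q²/m with q = m/(1-m), that is, 4(m + 1) = 0.
  have hfin := tendsto_nhds_unique limP (limLam.mul_const ρ)
  rw [hq] at hfin
  field_simp at hfin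
  exact hm (by linarith)

/-- The Killing equation kills the symmetric part of the covariant derivative and closedness the
antisymmetric part. The curl vanishes on the kernel of `b` and on the dual vector, which together
span. -/
theorem covD_eq_zero (h : UnitPair a b U) (hF : IsKropinaEnergy m a b U F) (hn : 3 ≤ n)
    (hm0 : m ≠ 0) (hm1 : m ≠ 1) (hm : m ≠ -1) (hS : ∀ x ∈ U, IsScalarAt m a b F x) (hx : x ∈ U) :
    covD a b x = 0 := by
  have hk := fun x hx => h.killing hF hn hm0 hm1 hm (x := x) hx (hS x hx)
  have h1 : ∀ v, curlUp a b x *ᵥ v = 0 := by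
    intro v
    have h2 : curlUp a b x *ᵥ bup a b x = 0 := by
      have : curl b x *ᵥ bup a b x = 0 := by
        refine dotProduct_eq_zero _ fun w => ?_
        rw [dotProduct_comm, dot_curl, (hk x hx).2, neg_zero]
      rw [curlUp, ← mulVec_mulVec, this, mulVec_zero]
    have h3 := h.curlUp_mulVec_eq_zero hF hm0 hm1 hm hk hx (hS x hx)
      (w := v - (cov b x ⬝ᵥ v) • bup a b x) (by
        rw [dotProduct_sub, dotProduct_smul, h.unit x hx]; simp)
    rw [mulVec_sub, mulVec_smul, h2, smul_zero, sub_zero] at h3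
    exact h3
  have h2 : ∀ i j, curl b x i j = 0 := by
    intro i j
    have := congrFun (h.mulVec_curlUp hx (Pi.single j 1)) i
    rw [h1, mulVec_zero, mulVec_single_one] at this
    exact this.symm
  have hq := (hk x hx).1
  ext i j
  have h3 : covD a b x i j - covD a b x j i = 0 := by
    have := h2 i j
    rw [h.curl_eq_covD hx] at this
    linarith
  -- Polarisation of r₀₀ = 0.
  have h4 : ∀ u v : Fin n → ℝ, u ⬝ᵥ covD a b x *ᵥ v + v ⬝ᵥ covD a b x *ᵥ u = 0 := by
    intro u v
    have := hq (u + v)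
    have e1 := hq u
    have e2 := hq v
    simp only [quad, mulVec_add, dotProduct_add, add_dotProduct] at this e1 e2
    linarith
  have h5 := h4 (Pi.single i 1) (Pi.single j 1)
  simp only [mulVec_single_one, single_one_dotProduct, col_apply] at h5
  simp only [Matrix.zero_apply]
  linarith

end UnitPair

end MKropina

end

/-! ### A parallel form: the metric is flat. -/

noncomputable section

namespace MKropina

open Filter Topology Matrix

variable {n : ℕ}

theorem PolyMap.eq_zero_of_eventually {f : Euc n → ℝ} (hf : PolyMap f) {y₀ : Euc n}
    (h : ∀ᶠ y in 𝓝 y₀, f y = 0) (y : Euc n) : f y = 0 := by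
  obtain ⟨p, hp⟩ := hf.exists_line y₀ (y - y₀)
  have hc : Tendsto (fun t : ℝ => y₀ + t • (y - y₀)) (𝓝 0) (𝓝 y₀) :=
    Continuous.tendsto' (by fun_prop) _ _ (by simp)
  have h0 : p = 0 := by
    refine Polynomial.eq_zero_of_infinite_isRoot p ?_
    have h1 : {t : ℝ | p.IsRoot t} ∈ 𝓝 (0 : ℝ) := by
      filter_upwards [hc.eventually h] with t ht
      change p.eval t = 0
      rw [← hp, ht]
    -- On the line through y₀ and y the polynomial has infinitely many zeros near t = 0; its value
    -- at t = 1 is f(y).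
    exact infinite_of_mem_nhds 0 h1
  have := hp 1
  rw [h0] at this
  simpa using this

/-- The Riemann curvature of a spray with quadratic coefficients. -/
theorem curvOf_quad {C : Fin n → Matrix (Fin n) (Fin n) ℝ}
    {D : Fin n → Fin n → Matrix (Fin n) (Fin n) ℝ} (hC : ∀ i, (C i)ᵀ = C i)
    (hD : ∀ j i, (D j i)ᵀ = D j i) (i k : Fin n) (y : Euc n) :
    curvOf (fun i z => 1 / 2 * quad (C i) z.ofLp) (fun j i z => 1 / 2 * quad (D j i) z.ofLp) i k y
      = quad (Matrix.of fun j l => D k i j l - D j i k l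
          + ∑ p, (C i k p * C p j l - C i j p * C p k l)) y.ofLp := by
  have d1 : ∀ (Q : Matrix (Fin n) (Fin n) ℝ), Qᵀ = Q → ∀ k (z : Euc n),
      pd k (fun z : Euc n => 1 / 2 * quad Q z.ofLp) z = (Q *ᵥ z.ofLp) k := by
    intro Q hQ k z
    rw [pd_const_mul _ ((polyMap_quad Q).differentiable z), pd_quad, hQ]; ring
  have d2 : ∀ j, pd k (pd j (fun z : Euc n => 1 / 2 * quad (C i) z.ofLp)) y = C i j k := by
    intro j
    rw [show pd j (fun z : Euc n => 1 / 2 * quad (C i) z.ofLp) = fun z => (C i *ᵥ z.ofLp) j from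
      funext fun z => d1 _ (hC i) j z, pd_mulVec]
  simp only [curvOf, d2, d1 _ (hC _), d1 _ (hD _ _)]
  simp only [quad_eq_sum, mulVec, dotProduct, of_apply]
  have e1 : 2 * ∑ j, 1 / 2 * (∑ p, ∑ l, C j p l * y p * y l) * C i j k
      = ∑ p, ∑ l, (∑ j, C i k j * C j p l) * y p * y l := by
    simp only [Finset.mul_sum, Finset.sum_mul]
    rw [Finset.sum_comm]
    refine Finset.sum_congr rfl fun p _ => ?_
    rw [Finset.sum_comm]
    refine Finset.sum_congr rfl fun l _ => Finset.sum_congr rfl fun j _ => ?_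
    rw [← congrFun (congrFun (hC i) j) k, transpose_apply]; ring
  have e2 : ∑ j, (∑ l, C i j l * y l) * ∑ l, C j k l * y l
      = ∑ p, ∑ l, (∑ j, C i p j * C j k l) * y p * y l := by
    simp_rw [Finset.sum_mul_sum, Finset.sum_mul]
    rw [Finset.sum_comm]
    refine Finset.sum_congr rfl fun p _ => ?_
    rw [Finset.sum_comm]
    refine Finset.sum_congr rfl fun l _ => Finset.sum_congr rfl fun j _ => ?_
    rw [← congrFun (congrFun (hC i) j) p, transpose_apply]; ring
  have e3 : ∑ j, y j * ∑ l, D j i k l * y l = ∑ j, ∑ l, D j i k l * y j * y l := by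
    simp only [Finset.mul_sum]
    exact Finset.sum_congr rfl fun j _ => Finset.sum_congr rfl fun l _ => by ring
  rw [e1, e2, e3]
  simp only [Finset.sum_sub_distrib, add_mul, sub_mul, Finset.sum_add_distrib]
  ring

namespace UnitPair

variable {m : ℝ} {a : Euc n → Matrix (Fin n) (Fin n) ℝ} {b : Fin n → Euc n → ℝ}
  {U : Set (Euc n)} {F : Euc n → Euc n → ℝ} {x y : Euc n}

theorem pd_chr_symm (h : UnitPair a b U) (hx : x ∈ U) (q k i j : Fin n) :
    pd q (chr a k i j) x = pd q (chr a k j i) x :=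
  pd_congr (by filter_upwards [h.isOpen.mem_nhds hx] with z hz using h.chr_symm hz k i j)

theorem sprayK_of_parallel (h : UnitPair a b U) (hx : x ∈ U) (h0 : covD a b x = 0) :
    sprayK a b m x y = sprayR a x y := by
  have hc : curl b x = 0 := by
    ext i j
    rw [h.curl_eq_covD hx, h0]; simp
  simp [sprayK, numer, curlUp, hc, h0, quad]

/-- The spray is quadratic in y and equals that of `a`, so the Finsler curvature is the Riemannian
curvature contracted twice with y. -/
theorem riemCurv_of_parallel (h : UnitPair a b U) (hF : IsKropinaEnergy m a b U F) (hm1 : m ≠ 1)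
    (h0 : ∀ x ∈ U, covD a b x = 0) (hx : x ∈ U) (hy : 0 < beta b x y) (hD : discr a b m x y ≠ 0)
    (i k : Fin n) :
    riemCurv F i k x y = quad (Matrix.of fun j l => riem a i l k j x) y.ofLp := by
  rw [h.riemCurv_eq_sprayK hF hm1 hx hy hD]
  have e1 : (fun i (z : Euc n) => sprayK a b m x z i)
      = fun i z => 1 / 2 * quad (chrMat a i x) z.ofLp := by
    funext i z
    rw [h.sprayK_of_parallel hx (h0 x hx)]; rfl
  have e2 : (fun j i (z : Euc n) => pd j (fun x => sprayK a b m x z i) x)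
      = fun j i z => 1 / 2 * quad (pdMat j (chrMat a i) x) z.ofLp := by
    funext j i z
    have hd : ∀ p q, DifferentiableAt ℝ (fun z => chrMat a i z p q) x := fun p q =>
      (h.contDiffAt_chr hx i p q).differentiableAt (by simp)
    have : (fun x => sprayK a b m x z i) =ᶠ[𝓝 x] fun x => 1 / 2 * quad (chrMat a i x) z.ofLp := by
      filter_upwards [h.isOpen.mem_nhds hx] with w hw
      rw [h.sprayK_of_parallel hw (h0 w hw)]; rfl
    rw [pd_congr this, pd_const_mul _ ((polyJet_quad hd).diff z), pdx_quad hd]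
  rw [e1, e2, curvOf_quad]
  · congr 1
  · intro i
    ext p q
    exact h.chr_symm hx i q p
  · intro j i
    ext p q
    exact h.pd_chr_symm hx j i q p

/-- The Ricci identity for a parallel form. -/
theorem sum_b_riem (h : UnitPair a b U) (h0 : ∀ x ∈ U, covD a b x = 0) (hx : x ∈ U)
    (k i j : Fin n) : ∑ l, b l x * riem a l k i j x = 0 := by
  have hb : ∀ z ∈ U, ∀ k j, pd j (b k) z = ∑ l, chr a l k j z * b l z := by
    intro z hz k j
    have := congrFun (congrFun (h0 z hz) k) j
    simp only [covD, of_apply, Matrix.zero_apply] at this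
    linarith
  -- Differentiating ∂b = Γb a second time; antisymmetrising in i and j then produces the curvature.
  have key : ∀ i j, pd i (pd j (b k)) x = ∑ l, b l x * (pd i (chr a l j k) x
      + ∑ p, chr a l i p x * chr a p j k x) := by
    intro i j
    have e : pd j (b k) =ᶠ[𝓝 x] fun z => ∑ l, chr a l k j z * b l z := by
      filter_upwards [h.isOpen.mem_nhds hx] with z hz using hb z hz k j
    have dc : ∀ l, DifferentiableAt ℝ (chr a l k j) x := fun l =>
      (h.contDiffAt_chr hx l k j).differentiableAt (by simp)
    rw [pd_congr e, pd_sum fun l _ => (dc l).fun_mul (h.differentiableAt_b hx l)]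
    simp_rw [pd_mul (dc _) (h.differentiableAt_b hx _), hb x hx, Finset.sum_add_distrib, mul_add,
      Finset.mul_sum]
    rw [Finset.sum_add_distrib]
    congr 1
    · refine Finset.sum_congr rfl fun l _ => ?_
      rw [h.pd_chr_symm hx]; ring
    · rw [Finset.sum_comm]
      refine Finset.sum_congr rfl fun l _ => Finset.sum_congr rfl fun p _ => ?_
      rw [h.chr_symm hx p k j, h.chr_symm hx l p i]; ring
  have := pd_comm (h.contDiffAt_b hx k) i j
  rw [key, key, ← sub_eq_zero, ← Finset.sum_sub_distrib] at this
  rw [← this]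
  refine Finset.sum_congr rfl fun l _ => ?_
  rw [riem, Finset.sum_sub_distrib]
  ring

/-- By `sum_b_riem` the covector b annihilates Rⁱ_k. Contracting the scalar form with b and a vector
w with b(w) = 0 leaves a multiple of λβ⟨y, w⟩/α² with nonzero coefficient, so λ vanishes where ⟨y,
w⟩ ≠ 0. A polynomial in y that vanishes on an open set is zero. -/
theorem riem_eq_zero (h : UnitPair a b U) (hF : IsKropinaEnergy m a b U F) (hn : 3 ≤ n)
    (hm1 : m ≠ 1) (h0 : ∀ x ∈ U, covD a b x = 0) (hx : x ∈ U) (hS : IsScalarAt m a b F x)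
    (l k i j : Fin n) : riem a l k i j x = 0 := by
  obtain ⟨lam, hlam⟩ := hS
  obtain ⟨w, hw0, hw, -⟩ := exists_ne_zero_dot_eq_zero hn (cov b x) 0
  have hm1' : 1 - m ≠ 0 := sub_ne_zero.2 hm1.symm
  set X := bup a b x with hX
  have hκ : 0 < quad (a x) w := h.quad_pos hx hw0
  have hlam0 : ∀ y : Euc n, 0 < beta b x y → discr a b m x y ≠ 0 → w ⬝ᵥ a x *ᵥ y.ofLp ≠ 0 →
      lam y = 0 := by
    intro y hy hD hwy
    have h1 := sum_sum_scalar (lam y) (cov b x) w y.ofLp (ell m a b x y)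
    simp_rw [← hlam y hy hD, h.riemCurv_of_parallel hF hm1 h0 hx hy hD] at h1
    have h2 : ∀ k, ∑ i, cov b x i * quad (Matrix.of fun j l => riem a i l k j x) y.ofLp = 0 := by
      intro k
      simp only [quad_eq_sum, of_apply, Finset.mul_sum]
      rw [Finset.sum_comm]
      refine Finset.sum_eq_zero fun j _ => ?_
      rw [Finset.sum_comm]
      refine Finset.sum_eq_zero fun l _ => ?_
      have := h.sum_b_riem h0 hx l k j
      calc _ = (∑ p, b p x * riem a p l k j x) * (y j * y l) := by
            rw [Finset.sum_mul]
            exact Finset.sum_congr rfl fun p _ => by simp only [cov]; ring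
        _ = 0 := by rw [this, zero_mul]
    rw [Finset.sum_comm] at h1
    simp_rw [← Finset.sum_mul, h2, zero_mul, Finset.sum_const_zero] at h1
    rw [h.ell_dot hx, hw, h.dot_symm hx, dotProduct_comm (a x *ᵥ y.ofLp)] at h1
    have hA := (h.alphaSq_pos hx hy).ne'
    have hB := hy.ne'
    rw [show cov b x ⬝ᵥ y.ofLp = beta b x y from rfl] at h1
    field_simp at h1
    simpa [hA, hB, hwy, hm1'] using h1.symm
  -- At X + tw the discriminant is mκt² - 1; t = 1 works unless mκ = 1, and then t = 2 gives 3.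
  obtain ⟨t, ht0, ht⟩ : ∃ t : ℝ, t ≠ 0 ∧ m * quad (a x) w * t ^ 2 - 1 ≠ 0 := by
    by_cases h1 : m * quad (a x) w = 1
    · exact ⟨2, two_ne_zero, by rw [h1]; norm_num⟩
    · exact ⟨1, one_ne_zero, by simpa [sub_eq_zero] using h1⟩
  set y₀ : Euc n := WithLp.toLp 2 (X + t • w) with hy₀
  have hB0 : beta b x y₀ = 1 := by
    change cov b x ⬝ᵥ (X + t • w) = 1
    rw [dotProduct_add, dotProduct_smul, hw, h.unit x hx]; simp
  have hXw : X ⬝ᵥ a x *ᵥ w = 0 := by rw [h.bup_dot hx, hw]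
  have hwX : w ⬝ᵥ a x *ᵥ X = 0 := by rw [h.dot_symm hx, dotProduct_comm, hXw]
  have hXX : X ⬝ᵥ a x *ᵥ X = 1 := by rw [h.bup_dot hx, h.unit x hx]
  have hwy0 : w ⬝ᵥ a x *ᵥ y₀.ofLp ≠ 0 := by
    change w ⬝ᵥ a x *ᵥ (X + t • w) ≠ 0
    rw [mulVec_add, mulVec_smul, dotProduct_add, dotProduct_smul, hwX, zero_add]
    exact mul_ne_zero ht0 hκ.ne'
  have hA0 : alphaSq a x y₀ = 1 + t ^ 2 * quad (a x) w := by
    change (X + t • w) ⬝ᵥ a x *ᵥ (X + t • w) = _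
    simp only [mulVec_add, mulVec_smul, dotProduct_add, dotProduct_smul, add_dotProduct,
      smul_dotProduct, hwX, hXw, hXX, smul_eq_mul, quad]
    ring
  have hD0 : discr a b m x y₀ ≠ 0 := by
    rw [discr, hA0, hB0]
    intro h1
    exact ht (by linear_combination h1)
  have hwc : ∀ᶠ y : Euc n in 𝓝 y₀, w ⬝ᵥ a x *ᵥ y.ofLp ≠ 0 := by
    have : PolyMap (fun y : Euc n => w ⬝ᵥ a x *ᵥ y.ofLp) := by
      simp_rw [dotProduct_mulVec]
      exact polyMap_linear _
    exact this.eventually_ne hwy0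
  have hR : ∀ i k (y : Euc n), quad (Matrix.of fun j l => riem a i l k j x) y.ofLp = 0 := by
    intro i k
    refine (polyMap_quad _).eq_zero_of_eventually (y₀ := y₀) ?_
    filter_upwards [eventually_beta_pos (b := b) (x := x) (y := y₀) (by rw [hB0]; exact one_pos), eventually_discr_ne hD0, hwc]
      with y h1 h2 h3
    rw [← h.riemCurv_of_parallel hF hm1 h0 hx h1 h2, hlam y h1 h2, hlam0 y h1 h2 h3, zero_mul]
  -- Polarisation gives antisymmetry in a second pair of indices. With the antisymmetry `h5` in the
  -- last pair, the three terms of the first Bianchi identity `h6` become equal.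
  have h4 : ∀ i l k j, riem a i l k j x + riem a i j k l x = 0 := by
    intro i l k j
    have e := fun u : Fin n → ℝ => hR i k (WithLp.toLp 2 u)
    have e1 := e (Pi.single j 1 + Pi.single l 1)
    have e2 := e (Pi.single j 1)
    have e3 := e (Pi.single l 1)
    simp only [quad, mulVec_add, dotProduct_add, add_dotProduct, mulVec_single_one,
      single_one_dotProduct, col_apply, of_apply] at e1 e2 e3
    linarith
  have h5 : ∀ l k i j, riem a l k i j x = - riem a l k j i x := by
    intro l k i j
    simp only [riem, Finset.sum_sub_distrib]; ring
  have h6 : riem a l k i j x + riem a l i j k x + riem a l j k i x = 0 := by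
    simp only [riem, Finset.sum_sub_distrib]
    rw [h.pd_chr_symm hx i l j k, h.pd_chr_symm hx j l i k, h.pd_chr_symm hx k l j i]
    simp_rw [h.chr_symm hx _ j k, h.chr_symm hx _ i k, h.chr_symm hx _ j i]
    ring
  have h7 := h4 l k i j
  have h8 := h4 l i j k
  have h9 := h4 l j k i
  have h10 := h5 l k j i
  have h11 := h5 l i k j
  have h12 := h5 l j i k
  linarith

/-- A metric formed with a flat metric and a parallel form has vanishing curvature. -/
theorem riemCurv_eq_zero (h : UnitPair a b U) (hF : IsKropinaEnergy m a b U F) (hm1 : m ≠ 1)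
    (h0 : ∀ x ∈ U, covD a b x = 0) (hx : x ∈ U) (hR : ∀ l k i j, riem a l k i j x = 0)
    (hy : 0 < beta b x y) (hD : (fundTensor F x y).det ≠ 0) (i k : Fin n) :
    riemCurv F i k x y = 0 := by
  rw [h.riemCurv_of_parallel hF hm1 h0 hx hy]
  · simp [quad_eq_sum, hR]
  · exact h.discr_ne_zero_of_det hF hm1 hx hy hD

end UnitPair

end MKropina

end

/-! ### Frobenius' theorem for linear systems. -/

noncomputable section

namespace MKropina

open Filter Topology Set

section Frobenius

set_option maxSynthPendingDepth 3

variable {E W : Type*} [NormedAddCommGroup E] [NormedSpace ℝ E] [NormedAddCommGroup W]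
  [NormedSpace ℝ W]

/-- Grönwall's inequality on the unit interval. -/
theorem norm_le_of_norm_deriv_le {g g' : ℝ → W} {δ ε : ℝ}
    (hg : ∀ t ∈ Icc (0 : ℝ) 1, HasDerivWithinAt g (g' t) (Icc 0 1) t) (h0 : ‖g 0‖ ≤ δ)
    (hε : 0 ≤ ε) (hb : ∀ t ∈ Icc (0 : ℝ) 1, ‖g' t‖ ≤ ‖g t‖ + ε) :
    ∀ t ∈ Icc (0 : ℝ) 1, ‖g t‖ ≤ 3 * δ + 2 * ε := by
  intro t ht
  have h1 := norm_le_gronwallBound_of_norm_deriv_right_le (K := 1) (δ := δ) (ε := ε)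
    (fun t ht => (hg t ht).continuousWithinAt)
    (fun t ht => (hg t (Ico_subset_Icc_self ht)).mono_of_mem_nhdsWithin (Icc_mem_nhdsGE_of_mem ht))
    h0 (fun t ht => by simpa using hb t (Ico_subset_Icc_self ht)) t ht
  rw [gronwallBound_of_K_ne_0 one_ne_zero] at h1
  have hδ : 0 ≤ δ := (norm_nonneg _).trans h0
  -- With K = 1 the Grönwall bound is δeᵗ + ε(eᵗ - 1), and eᵗ ≤ 3 on the interval.
  have he : Real.exp (1 * (t - 0)) ≤ 3 :=
    (Real.exp_le_exp.2 (by linarith [ht.2])).trans Real.exp_one_lt_three.le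
  refine h1.trans ?_
  rw [div_one]
  nlinarith [mul_le_mul_of_nonneg_left he hδ, mul_le_mul_of_nonneg_left he hε]

/-- A linear differential equation with small coefficients is solvable on the unit interval. -/
theorem exists_solution_of_norm_le [CompleteSpace W] {A : ℝ → W →L[ℝ] W} (hA : ContinuousOn A (Icc 0 1)) {w₀ : W}
    {κ : ℝ} (hκ : ∀ t ∈ Icc (0 : ℝ) 1, ‖A t‖ ≤ κ) (h1 : κ * (‖w₀‖ + 1) ≤ 1) :
    ∃ γ : ℝ → W, γ 0 = w₀ ∧ ∀ t ∈ Icc (0 : ℝ) 1, HasDerivWithinAt γ (A t (γ t)) (Icc 0 1) t := by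
  have hκ0 : 0 ≤ κ := (norm_nonneg _).trans (hκ 0 (by simp))
  -- Picard's theorem on the ball of radius 1 about w₀: `h1` bounds the field there by 1, so the
  -- solution stays inside for unit time.
  refine IsPicardLindelof.exists_eq_forall_mem_Icc_hasDerivWithinAt₀ (f := fun t w => A t w)
    (t₀ := ⟨0, by simp⟩) (x₀ := w₀) (a := 1) (L := 1) (K := κ.toNNReal) ⟨?_, ?_, ?_, ?_⟩
  · intro t ht
    refine ((A t).lipschitz.weaken ?_).lipschitzOnWith
    rw [← NNReal.coe_le_coe, Real.coe_toNNReal _ hκ0]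
    exact hκ t ht
  · intro w _
    exact hA.clm_apply continuousOn_const
  · intro t ht w hw
    have hw' : ‖w‖ ≤ ‖w₀‖ + 1 := by
      have h2 : ‖w - w₀‖ ≤ 1 := by simpa [dist_eq_norm] using hw
      have := norm_le_norm_add_norm_sub' w w₀
      linarith
    calc ‖A t w‖ ≤ ‖A t‖ * ‖w‖ := (A t).le_opNorm w
      _ ≤ κ * (‖w₀‖ + 1) := mul_le_mul (hκ t ht) hw' (norm_nonneg _) hκ0
      _ ≤ _ := by simpa using h1
  · simp

/-- Bounds for a smooth coefficient field and its derivative on a ball. -/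
structure CoeffBound {V : Type*} [NormedAddCommGroup V] [NormedSpace ℝ V] (Ω : E → V) (x₀ : E) (r C : ℝ) : Prop where
  nonneg : 0 ≤ C
  r_le : r ≤ 1
  small : C * r ≤ 1
  bound : ∀ p ∈ Metric.ball x₀ r, ‖Ω p‖ ≤ C
  diff : ∀ p ∈ Metric.ball x₀ r, DifferentiableAt ℝ Ω p
  bound_fderiv : ∀ p ∈ Metric.ball x₀ r, ‖fderiv ℝ Ω p‖ ≤ C
  lipschitz : ∀ p ∈ Metric.ball x₀ r, ∀ q ∈ Metric.ball x₀ r, ‖Ω q - Ω p‖ ≤ C * ‖q - p‖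
  taylor : ∀ p ∈ Metric.ball x₀ r, ∀ q ∈ Metric.ball x₀ r,
    ‖Ω q - Ω p - fderiv ℝ Ω p (q - p)‖ ≤ C * ‖q - p‖ ^ 2

theorem ray_mem_ball {x₀ x : E} {r : ℝ} (hx : ‖x‖ < r) {t : ℝ} (ht : t ∈ Icc (0 : ℝ) 1) :
    x₀ + t • x ∈ Metric.ball x₀ r := by
  simp only [mem_ball_iff_norm, add_sub_cancel_left, norm_smul, Real.norm_eq_abs, abs_of_nonneg ht.1]
  exact (mul_le_of_le_one_left (norm_nonneg _) ht.2).trans_lt hx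

/-- The total differential of the solutions along rays of an integrable linear system. -/
theorem CoeffBound.norm_sub_le {Ω : E → E →L[ℝ] W →L[ℝ] W} {x₀ : E} {r C : ℝ}
    (h : CoeffBound Ω x₀ r C)
    (hint : ∀ p ∈ Metric.ball x₀ r, ∀ u v w, fderiv ℝ Ω p u v w + Ω p v (Ω p u w)
      = fderiv ℝ Ω p v u w + Ω p u (Ω p v w)) {w₀ : W} {x w : E} (hx : ‖x‖ < r)
    (hxw : ‖x + w‖ < r) {γ η : ℝ → W} (hγ0 : γ 0 = w₀) (hη0 : η 0 = w₀)
    (hγ : ∀ t ∈ Icc (0 : ℝ) 1, HasDerivWithinAt γ (Ω (x₀ + t • x) x (γ t)) (Icc 0 1) t)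
    (hη : ∀ t ∈ Icc (0 : ℝ) 1, HasDerivWithinAt η (Ω (x₀ + t • (x + w)) (x + w) (η t))
      (Icc 0 1) t) :
    ‖η 1 - γ 1 - Ω (x₀ + x) w (γ 1)‖ ≤ (12 * C + 48 * C ^ 2) * ‖w₀‖ * ‖w‖ ^ 2 := by
  have hC := h.nonneg
  have hr0 : 0 < r := (norm_nonneg _).trans_lt hx
  have hw0 := norm_nonneg w₀
  have hww := norm_nonneg w
  have hx1 : ‖x‖ ≤ 1 := hx.le.trans h.r_le
  have hxw1 : ‖x + w‖ ≤ 1 := hxw.le.trans h.r_le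
  have hCx : C * ‖x‖ ≤ 1 := (mul_le_mul_of_nonneg_left hx.le hC).trans h.small
  have hCxw : C * ‖x + w‖ ≤ 1 := (mul_le_mul_of_nonneg_left hxw.le hC).trans h.small
  have apply_le : ∀ (T : E →L[ℝ] W →L[ℝ] W) (u : E) (v : W), ‖T u v‖ ≤ ‖T‖ * ‖u‖ * ‖v‖ :=
    fun T u v => T.le_opNorm₂ u v
  have mulVec_le : ∀ p ∈ Metric.ball x₀ r, ∀ u v, ‖Ω p u v‖ ≤ C * ‖u‖ * ‖v‖ := fun p hp u v =>
    (apply_le _ _ _).trans (by gcongr; exact h.bound p hp)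
  have bγ : ∀ t ∈ Icc (0 : ℝ) 1, ‖γ t‖ ≤ 3 * ‖w₀‖ := by
    intro t ht
    have := norm_le_of_norm_deriv_le hγ (δ := ‖w₀‖) (ε := 0) (by rw [hγ0]) le_rfl (fun t ht => by
      refine (mulVec_le _ (ray_mem_ball hx ht) _ _).trans ?_
      nlinarith [norm_nonneg (γ t)]) t ht
    linarith
  have bη : ∀ t ∈ Icc (0 : ℝ) 1, ‖η t‖ ≤ 3 * ‖w₀‖ := by
    intro t ht
    have := norm_le_of_norm_deriv_le hη (δ := ‖w₀‖) (ε := 0) (by rw [hη0]) le_rfl (fun t ht => by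
      refine (mulVec_le _ (ray_mem_ball hxw ht) _ _).trans ?_
      nlinarith [norm_nonneg (η t)]) t ht
    linarith
  have hPQ : ∀ t ∈ Icc (0 : ℝ) 1, ‖x₀ + t • (x + w) - (x₀ + t • x)‖ ≤ ‖w‖ := by
    intro t ht
    have : x₀ + t • (x + w) - (x₀ + t • x) = t • w := by rw [smul_add]; abel
    rw [this, norm_smul, Real.norm_eq_abs, abs_of_nonneg ht.1]
    exact mul_le_of_le_one_left hww ht.2
  have hdΩ : ∀ t ∈ Icc (0 : ℝ) 1, ‖Ω (x₀ + t • (x + w)) - Ω (x₀ + t • x)‖ ≤ C * ‖w‖ := fun t ht =>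
    (h.lipschitz _ (ray_mem_ball hx ht) _ (ray_mem_ball hxw ht)).trans (by gcongr; exact hPQ t ht)
  -- The solutions along neighbouring rays differ by O(‖w‖), by Grönwall with a forcing term of that
  -- size.
  have be : ∀ t ∈ Icc (0 : ℝ) 1, ‖η t - γ t‖ ≤ 12 * C * ‖w₀‖ * ‖w‖ := by
    intro t ht
    have := norm_le_of_norm_deriv_le (fun t ht => (hη t ht).sub (hγ t ht)) (δ := 0)
      (ε := 6 * C * ‖w₀‖ * ‖w‖) (by simp [hη0, hγ0]) (by positivity) (fun t ht => ?_) t ht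
    · simp only [Pi.sub_apply] at this
      linarith
    have e : Ω (x₀ + t • (x + w)) (x + w) (η t) - Ω (x₀ + t • x) x (γ t)
        = Ω (x₀ + t • x) x (η t - γ t)
          + ((Ω (x₀ + t • (x + w)) - Ω (x₀ + t • x)) (x + w) (η t) + Ω (x₀ + t • x) w (η t)) := by
      simp only [map_add, map_sub, _root_.sub_apply, _root_.add_apply]
      abel
    rw [e]
    refine (norm_add_le _ _).trans (add_le_add ?_ ((norm_add_le _ _).trans ?_))
    · refine (mulVec_le _ (ray_mem_ball hx ht) _ _).trans ?_
      simp only [Pi.sub_apply]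
      nlinarith [norm_nonneg (η t - γ t)]
    · have h1 : ‖(Ω (x₀ + t • (x + w)) - Ω (x₀ + t • x)) (x + w) (η t)‖
          ≤ C * ‖w‖ * 1 * (3 * ‖w₀‖) := (apply_le _ _ _).trans (by
        gcongr
        · exact hdΩ t ht
        · exact bη t ht)
      have h2 : ‖Ω (x₀ + t • x) w (η t)‖ ≤ C * ‖w‖ * (3 * ‖w₀‖) :=
        (mulVec_le _ (ray_mem_ball hx ht) _ _).trans (by gcongr; exact bη t ht)
      nlinarith
  -- The expected first variation of γ when the ray turns by w is t Ω(w) γ; δ is the error.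
  -- Integrability makes δ satisfy the same linear equation with a forcing term quadratic in w.
  set δ : ℝ → W := fun t => η t - γ t - t • Ω (x₀ + t • x) w (γ t) with hδ
  have hδ' : ∀ t ∈ Icc (0 : ℝ) 1, HasDerivWithinAt δ (Ω (x₀ + t • x) x (δ t)
      + ((Ω (x₀ + t • (x + w)) - Ω (x₀ + t • x)
          - fderiv ℝ Ω (x₀ + t • x) (x₀ + t • (x + w) - (x₀ + t • x))) x (η t)
        + t • fderiv ℝ Ω (x₀ + t • x) w x (η t - γ t)
        + (Ω (x₀ + t • (x + w)) - Ω (x₀ + t • x)) w (η t)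
        + Ω (x₀ + t • x) w (η t - γ t))) (Icc 0 1) t := by
    intro t ht
    have hP : HasDerivWithinAt (fun t : ℝ => x₀ + t • x) x (Icc 0 1) t := by
      simpa using ((hasDerivWithinAt_id t (Icc (0 : ℝ) 1)).smul_const x).const_add x₀
    have hΩ := (h.diff _ (ray_mem_ball hx ht)).hasFDerivAt.comp_hasDerivWithinAt t hP
    have hΩw := (hΩ.clm_apply (hasDerivWithinAt_const t (Icc (0 : ℝ) 1) w)).clm_apply (hγ t ht)
    have hs := (hasDerivWithinAt_id t (Icc (0 : ℝ) 1)).smul hΩw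
    refine (((hη t ht).sub (hγ t ht)).sub hs).congr_deriv ?_
    have := hint _ (ray_mem_ball hx ht) x w (γ t)
    simp only [hδ, Function.comp_apply, id, map_sub, map_add, map_smul, map_zero, add_zero,
      _root_.sub_apply, _root_.add_apply, _root_.smul_apply,
      one_smul, smul_add, smul_sub] at this ⊢
    linear_combination (norm := module) (-t) • this
  have bδ := norm_le_of_norm_deriv_le hδ' (δ := 0)
    (ε := (6 * C + 24 * C ^ 2) * ‖w₀‖ * ‖w‖ ^ 2) (by simp [hδ, hη0, hγ0]) (by positivity)
    (fun t ht => ?_) 1 (by simp)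
  · simp only [hδ, one_smul] at bδ
    linarith
  refine (norm_add_le _ _).trans (add_le_add ?_ ?_)
  · refine (mulVec_le _ (ray_mem_ball hx ht) _ _).trans ?_
    nlinarith [norm_nonneg (δ t)]
  · have h1 : ‖(Ω (x₀ + t • (x + w)) - Ω (x₀ + t • x)
          - fderiv ℝ Ω (x₀ + t • x) (x₀ + t • (x + w) - (x₀ + t • x))) x (η t)‖
        ≤ C * ‖w‖ ^ 2 * 1 * (3 * ‖w₀‖) := (apply_le _ _ _).trans (by
      gcongr
      · refine (h.taylor _ (ray_mem_ball hx ht) _ (ray_mem_ball hxw ht)).trans ?_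
        gcongr
        exact hPQ t ht
      · exact bη t ht)
    have h2 : ‖t • fderiv ℝ Ω (x₀ + t • x) w x (η t - γ t)‖
        ≤ 1 * (C * ‖w‖ * 1 * (12 * C * ‖w₀‖ * ‖w‖)) := by
      rw [norm_smul, Real.norm_eq_abs, abs_of_nonneg ht.1]
      refine mul_le_mul ht.2 ((apply_le _ _ _).trans ?_) (norm_nonneg _) zero_le_one
      gcongr
      · refine ((fderiv ℝ Ω (x₀ + t • x)).le_opNorm w).trans ?_
        gcongr
        exact h.bound_fderiv _ (ray_mem_ball hx ht)
      · exact be t ht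
    have h3 : ‖(Ω (x₀ + t • (x + w)) - Ω (x₀ + t • x)) w (η t)‖ ≤ C * ‖w‖ * ‖w‖ * (3 * ‖w₀‖) :=
      (apply_le _ _ _).trans (by
        gcongr
        · exact hdΩ t ht
        · exact bη t ht)
    have h4 : ‖Ω (x₀ + t • x) w (η t - γ t)‖ ≤ C * ‖w‖ * (12 * C * ‖w₀‖ * ‖w‖) :=
      (mulVec_le _ (ray_mem_ball hx ht) _ _).trans (by gcongr; exact be t ht)
    refine (norm_add_le _ _).trans ((add_le_add (norm_add₃_le) h4).trans ?_)
    linarith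

/-- The local bounds hold near every point. -/
theorem exists_coeffBound {V : Type*} [NormedAddCommGroup V] [NormedSpace ℝ V] {Ω : E → V} {x₀ : E}
    (hΩ : ContDiffAt ℝ ∞ Ω x₀) (K : ℝ) :
    ∃ r C : ℝ, 0 < r ∧ CoeffBound Ω x₀ r C ∧ C * r * K ≤ 1 := by
  have h1 : ContDiffAt ℝ ∞ (fderiv ℝ Ω) x₀ := hΩ.fderiv_right (m := ∞) (by simp)
  have h2 : ContDiffAt ℝ ∞ (fderiv ℝ (fderiv ℝ Ω)) x₀ := h1.fderiv_right (m := ∞) (by simp)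
  set C := max (max (‖Ω x₀‖ + 1) (‖fderiv ℝ Ω x₀‖ + 1)) (‖fderiv ℝ (fderiv ℝ Ω) x₀‖ + 1) with hC
  have b0 : ‖Ω x₀‖ < C := lt_of_lt_of_le (lt_add_one _) ((le_max_left _ _).trans (le_max_left _ _))
  have b1 : ‖fderiv ℝ Ω x₀‖ < C :=
    lt_of_lt_of_le (lt_add_one _) ((le_max_right _ _).trans (le_max_left _ _))
  have b2 : ‖fderiv ℝ (fderiv ℝ Ω) x₀‖ < C := lt_of_lt_of_le (lt_add_one _) (le_max_right _ _)
  have hC0 : 0 < C := (norm_nonneg _).trans_lt b0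
  have ev : ∀ᶠ p in 𝓝 x₀, ‖Ω p‖ ≤ C ∧ ‖fderiv ℝ Ω p‖ ≤ C ∧ ‖fderiv ℝ (fderiv ℝ Ω) p‖ ≤ C ∧
      DifferentiableAt ℝ Ω p ∧ DifferentiableAt ℝ (fderiv ℝ Ω) p := by
    filter_upwards [hΩ.continuousAt.norm.eventually_lt_const b0,
      h1.continuousAt.norm.eventually_lt_const b1, h2.continuousAt.norm.eventually_lt_const b2,
      (hΩ.of_le (m := 1) (by simp)).eventually (by simp),
      (h1.of_le (m := 1) (by simp)).eventually (by simp)] with p e0 e1 e2 e3 e4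
    exact ⟨e0.le, e1.le, e2.le, e3.differentiableAt one_ne_zero, e4.differentiableAt one_ne_zero⟩
  obtain ⟨s, hs, hball⟩ := Metric.eventually_nhds_iff_ball.1 ev
  have hK1 : 0 < |K| + 1 := by positivity
  -- The radius is small enough for the bounds to hold, for r ≤ 1, and for both C r and C r K to be
  -- at most 1.
  set r := min (min s 1) ((C * (|K| + 1))⁻¹) with hr
  have hrs : r ≤ s := (min_le_left _ _).trans (min_le_left _ _)
  have hr0 : 0 < r := lt_min (lt_min hs one_pos) (by positivity)
  have hsub : ∀ p ∈ Metric.ball x₀ r, p ∈ Metric.ball x₀ s := fun p hp =>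
    Metric.ball_subset_ball hrs hp
  have hrC : C * r * (|K| + 1) ≤ 1 := by
    have : r ≤ (C * (|K| + 1))⁻¹ := min_le_right _ _
    calc C * r * (|K| + 1) = r * (C * (|K| + 1)) := by ring
      _ ≤ (C * (|K| + 1))⁻¹ * (C * (|K| + 1)) := by gcongr
      _ = 1 := inv_mul_cancel₀ (by positivity)
  have hCr : 0 ≤ C * r := by positivity
  have hconv := convex_ball x₀ r
  have lip1 : ∀ p ∈ Metric.ball x₀ r, ∀ q ∈ Metric.ball x₀ r,
      ‖fderiv ℝ Ω q - fderiv ℝ Ω p‖ ≤ C * ‖q - p‖ := fun p hp q hq =>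
    hconv.norm_image_sub_le_of_norm_fderiv_le (𝕜 := ℝ) (fun z hz => (hball z (hsub z hz)).2.2.2.2)
      (fun z hz => (hball z (hsub z hz)).2.2.1) hp hq
  refine ⟨r, C, hr0, ⟨hC0.le, (min_le_left _ _).trans (min_le_right _ _), ?_,
    fun p hp => (hball p (hsub p hp)).1, fun p hp => (hball p (hsub p hp)).2.2.2.1,
    fun p hp => (hball p (hsub p hp)).2.1, fun p hp q hq =>
      hconv.norm_image_sub_le_of_norm_fderiv_le (𝕜 := ℝ) (fun z hz => (hball z (hsub z hz)).2.2.2.1)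
      (fun z hz => (hball z (hsub z hz)).2.1) hp hq, ?_⟩, ?_⟩
  · nlinarith [abs_nonneg K]
  · intro p hp q hq
    have hseg : segment ℝ p q ⊆ Metric.ball x₀ r := hconv.segment_subset hp hq
    -- The mean value inequality for Ω minus its linear part at p, with the Lipschitz bound of the
    -- derivative.
    have := (convex_segment p q).norm_image_sub_le_of_norm_hasFDerivWithin_le' (𝕜 := ℝ)
      (f := Ω) (f' := fun z => fderiv ℝ Ω z) (φ := fderiv ℝ Ω p) (C := C * ‖q - p‖)
      (fun z hz => (hball z (hsub z (hseg hz))).2.2.2.1.hasFDerivAt.hasFDerivWithinAt)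
      (fun z hz => (lip1 p hp z (hseg hz)).trans ?_) (left_mem_segment ℝ p q)
      (right_mem_segment ℝ p q)
    · rw [pow_two, ← mul_assoc]; exact this
    · gcongr
      obtain ⟨θ, hθ, rfl⟩ := (segment_eq_image' ℝ p q ▸ hz)
      simp only [add_sub_cancel_left, norm_smul, Real.norm_eq_abs, abs_of_nonneg hθ.1]
      exact mul_le_of_le_one_left (norm_nonneg _) hθ.2
  · nlinarith [le_abs_self K]

/-- **Frobenius' theorem** for linear systems: an integrable system `df = Ω f` is locally solvable
with a prescribed initial value. -/
theorem exists_hasFDerivAt_of_integrable [CompleteSpace W] {Ω : E → E →L[ℝ] W →L[ℝ] W} {U : Set E} (hU : IsOpen U)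
    (hΩ : ContDiffOn ℝ ∞ Ω U)
    (hint : ∀ p ∈ U, ∀ u v w, fderiv ℝ Ω p u v w + Ω p v (Ω p u w)
      = fderiv ℝ Ω p v u w + Ω p u (Ω p v w)) {x₀ : E} (hx₀ : x₀ ∈ U) (w₀ : W) :
    ∃ f : E → W, f x₀ = w₀ ∧ ∀ᶠ x in 𝓝 x₀, HasFDerivAt f ((Ω x).flip (f x)) x := by
  obtain ⟨s, hs, hsU⟩ := Metric.isOpen_iff.1 hU x₀ hx₀
  obtain ⟨r', C, hr', hC', hK'⟩ := exists_coeffBound (hΩ.contDiffAt (hU.mem_nhds hx₀)) (‖w₀‖ + 1)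
  obtain ⟨r, hr, hrU, hC, hK⟩ : ∃ r, 0 < r ∧ Metric.ball x₀ r ⊆ U ∧ CoeffBound Ω x₀ r C ∧
      C * r * (‖w₀‖ + 1) ≤ 1 := by
    have hle : min r' s ≤ r' := min_le_left _ _
    have hsub : Metric.ball x₀ (min r' s) ⊆ Metric.ball x₀ r' := Metric.ball_subset_ball hle
    have hC0 := hC'.nonneg
    refine ⟨min r' s, lt_min hr' hs, (Metric.ball_subset_ball (min_le_right _ _)).trans hsU,
      ⟨hC0, hle.trans hC'.r_le, (by gcongr : C * min r' s ≤ C * r').trans hC'.small,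
        fun p hp => hC'.bound p (hsub hp), fun p hp => hC'.diff p (hsub hp),
        fun p hp => hC'.bound_fderiv p (hsub hp),
        fun p hp q hq => hC'.lipschitz p (hsub hp) q (hsub hq),
        fun p hp q hq => hC'.taylor p (hsub hp) q (hsub hq)⟩, le_trans ?_ hK'⟩
    gcongr
  have hex : ∀ x : E, ∃ γ : ℝ → W, ‖x‖ < r → γ 0 = w₀ ∧ ∀ t ∈ Icc (0 : ℝ) 1,
      HasDerivWithinAt γ (Ω (x₀ + t • x) x (γ t)) (Icc 0 1) t := by
    intro x
    by_cases hx : ‖x‖ < r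
    · have hc : ContinuousOn (fun t : ℝ => Ω (x₀ + t • x) x) (Icc 0 1) := by
        refine ContinuousOn.clm_apply (fun t ht => ?_) continuousOn_const
        exact ((hC.diff _ (ray_mem_ball hx ht)).continuousAt.comp
          (f := fun t : ℝ => x₀ + t • x) (by fun_prop)).continuousWithinAt
      have hb : ∀ t ∈ Icc (0 : ℝ) 1, ‖Ω (x₀ + t • x) x‖ ≤ C * r := by
        intro t ht
        refine ((Ω (x₀ + t • x)).le_opNorm x).trans ?_
        have := hC.nonneg
        gcongr
        exact hC.bound _ (ray_mem_ball hx ht)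
      obtain ⟨γ, h0, h1⟩ := exists_solution_of_norm_le hc hb hK
      exact ⟨γ, fun _ => ⟨h0, h1⟩⟩
    · exact ⟨fun _ => 0, fun h => absurd h hx⟩
  choose γ hγ using hex
  -- The candidate transports w₀ from x₀ to z along the straight ray; on the constant ray at x₀ the
  -- solution does not move.
  refine ⟨fun z => γ (z - x₀) 1, ?_, ?_⟩
  · obtain ⟨h0, h1⟩ := hγ (x₀ - x₀) (by simpa using hr)
    have h2 := norm_le_of_norm_deriv_le (g := fun t => γ (x₀ - x₀) t - w₀) (δ := 0) (ε := 0)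
      (fun t ht => (h1 t ht).sub_const w₀) (by rw [h0]; simp) le_rfl
      (fun t ht => by simp) 1 (by simp)
    simp only [mul_zero, add_zero] at h2
    exact sub_eq_zero.1 (norm_le_zero_iff.1 h2)
  · filter_upwards [Metric.ball_mem_nhds x₀ hr] with z hz
    rw [mem_ball_iff_norm] at hz
    obtain ⟨h0, h1⟩ := hγ (z - x₀) hz
    rw [hasFDerivAt_iff_isLittleO]
    set D := (12 * C + 48 * C ^ 2) * ‖w₀‖
    -- `norm_sub_le` gives a quadratic error, which identifies the Fréchet derivative.
    have hO : (fun z' => γ (z' - x₀) 1 - γ (z - x₀) 1 - (Ω z).flip (γ (z - x₀) 1) (z' - z))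
        =O[𝓝 z] fun z' => ‖z' - z‖ ^ 2 := by
      refine Asymptotics.IsBigO.of_bound D ?_
      filter_upwards [Metric.isOpen_ball.mem_nhds (mem_ball_iff_norm.2 hz)] with z' hz'
      rw [mem_ball_iff_norm] at hz'
      have e : z' - x₀ = z - x₀ + (z' - z) := by abel
      obtain ⟨h0', h1'⟩ := hγ (z' - x₀) hz'
      have := hC.norm_sub_le (fun p hp => hint p (hrU hp)) hz (w := z' - z) (by rwa [← e]) h0 h0' h1
        (fun t ht => by rw [← e]; exact h1' t ht)
      simpa using this
    refine hO.trans_isLittleO ?_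
    have : (fun z' : E => ‖z' - z‖ ^ 2) =o[𝓝 z] fun z' => ‖z' - z‖ ^ 1 :=
      (Asymptotics.isLittleO_pow_pow one_lt_two).comp_tendsto
        (Continuous.tendsto' (by fun_prop) _ _ (by simp))
    simpa using this

end Frobenius

end MKropina

end

/-! ### Parallel covector fields of a flat metric. -/

noncomputable section

namespace MKropina

open Filter Topology Matrix

section Smoothness

set_option maxSynthPendingDepth 3

variable {E W : Type*} [NormedAddCommGroup E] [NormedSpace ℝ E] [NormedAddCommGroup W]
  [NormedSpace ℝ W]

/-- The solutions of a smooth linear system are smooth. -/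
theorem contDiffOn_of_hasFDerivAt {Ω : E → E →L[ℝ] W →L[ℝ] W} {V : Set E} (hV : IsOpen V)
    (hΩ : ContDiffOn ℝ ∞ Ω V) {f : E → W} (hf : ∀ x ∈ V, HasFDerivAt f ((Ω x).flip (f x)) x) :
    ContDiffOn ℝ ∞ f V := by
  rw [contDiffOn_infty]
  intro N
  -- Bootstrap: the derivative of f is a smooth expression in x and f, so it is as regular as f.
  induction N with
  | zero => exact contDiffOn_zero.2 fun x hx => (hf x hx).continuousAt.continuousWithinAt
  | succ N ih =>
    push_cast
    rw [contDiffOn_succ_iff_fderiv_of_isOpen hV]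
    refine ⟨fun x hx => (hf x hx).differentiableAt.differentiableWithinAt, by simp, ?_⟩
    have h1 : ContDiffOn ℝ N (fun x => (Ω x).flip) V :=
      (ContinuousLinearMap.flipₗᵢ ℝ E W W).contDiff.comp_contDiffOn
        (hΩ.of_le (by exact_mod_cast le_top))
    exact (h1.clm_apply ih).congr fun x hx => (hf x hx).fderiv

end Smoothness

section Flat

set_option maxSynthPendingDepth 3

variable {n : ℕ}

/-- The bilinear map `(u, w) ↦ u^k w_l e_j`. -/
def elemMap (j k l : Fin n) : Euc n →L[ℝ] Euc n →L[ℝ] Euc n :=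
  (EuclideanSpace.proj k : Euc n →L[ℝ] ℝ).smulRight
    ((EuclideanSpace.proj l : Euc n →L[ℝ] ℝ).smulRight (stdVec j : Euc n))

theorem elemMap_apply (j k l i : Fin n) (u w : Euc n) :
    (elemMap j k l u w) i = if i = j then u k * w l else 0 := by
  simp [elemMap, stdVec]

/-- The connection form on covectors. -/
def conn (a : Euc n → Matrix (Fin n) (Fin n) ℝ) (x : Euc n) : Euc n →L[ℝ] Euc n →L[ℝ] Euc n :=
  ∑ j, ∑ k, ∑ l, chr a l j k x • elemMap j k l

theorem sum_smul_elemMap_apply (c : Fin n → Fin n → Fin n → ℝ) (u w : Euc n) (i : Fin n) :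
    ((∑ j, ∑ k, ∑ l, c j k l • elemMap j k l) u w) i = ∑ k, ∑ l, c i k l * (u k * w l) := by
  simp only [_root_.sum_apply, _root_.smul_apply, WithLp.ofLp_sum, Finset.sum_apply,
    WithLp.ofLp_smul, Pi.smul_apply, elemMap_apply, smul_eq_mul, mul_ite, mul_zero]
  rw [Finset.sum_eq_single i]
  · simp
  · intro j _ hj
    simp [hj.symm]
  · simp

theorem conn_apply (a : Euc n → Matrix (Fin n) (Fin n) ℝ) (x u w : Euc n) (i : Fin n) :
    (conn a x u w) i = ∑ k, ∑ l, chr a l i k x * (u k * w l) :=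
  sum_smul_elemMap_apply (fun j k l => chr a l j k x) u w i

namespace UnitPair

variable {a : Euc n → Matrix (Fin n) (Fin n) ℝ} {b : Fin n → Euc n → ℝ}
  {U : Set (Euc n)} {x : Euc n}

theorem contDiffOn_conn (h : UnitPair a b U) : ContDiffOn ℝ ∞ (conn a) U :=
  ContDiffOn.sum fun j _ => ContDiffOn.sum fun k _ => ContDiffOn.sum fun l _ =>
    ContDiffOn.smul (fun _ hx => (h.contDiffAt_chr hx l j k).contDiffWithinAt) contDiffOn_const

theorem fderiv_conn_apply (h : UnitPair a b U) (hx : x ∈ U) (u v w : Euc n) (i : Fin n) :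
    (fderiv ℝ (conn a) x u v w) i = ∑ k, ∑ l, (∑ q, u q * pd q (chr a l i k) x) * (v k * w l) := by
  have hd : ∀ j k l, HasFDerivAt (fun x => chr a l j k x • elemMap j k l)
      ((fderiv ℝ (chr a l j k) x).smulRight (elemMap j k l)) x := fun j k l =>
    ((h.contDiffAt_chr hx l j k).differentiableAt (by simp)).hasFDerivAt.smul_const _
  have : HasFDerivAt (conn a) (∑ j, ∑ k, ∑ l,
      (fderiv ℝ (chr a l j k) x).smulRight (elemMap j k l)) x :=
    HasFDerivAt.fun_sum fun j _ => HasFDerivAt.fun_sum fun k _ => HasFDerivAt.fun_sum fun l _ =>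
      hd j k l
  rw [this.fderiv]
  simp only [_root_.sum_apply, ContinuousLinearMap.smulRight_apply]
  have := sum_smul_elemMap_apply (fun j k l => fderiv ℝ (chr a l j k) x u) v w i
  simp only [_root_.sum_apply, fderiv_eq_sum_pd] at this ⊢
  exact this

/-- The difference of the two sides is the curvature tensor contracted with u, v and w, the
Christoffel symbols being symmetric. -/
theorem conn_integrable (h : UnitPair a b U) (hx : x ∈ U) (hR : ∀ l k i j, riem a l k i j x = 0)
    (u v w : Euc n) : fderiv ℝ (conn a) x u v w + conn a x v (conn a x u w)
      = fderiv ℝ (conn a) x v u w + conn a x u (conn a x v w) := by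
  ext i
  simp only [WithLp.ofLp_add, Pi.add_apply]
  have e : ∀ u v : Euc n, (fderiv ℝ (conn a) x u v w) i + (conn a x v (conn a x u w)) i
      = ∑ l, ∑ q, ∑ k, (pd q (chr a l k i) x + ∑ p, chr a l q p x * chr a p k i x)
        * (u q * v k * w l) := by
    intro u v
    rw [h.fderiv_conn_apply hx, conn_apply]
    simp_rw [conn_apply, add_mul, Finset.sum_add_distrib]
    congr 1
    · rw [Finset.sum_comm]
      refine Finset.sum_congr rfl fun l _ => ?_
      rw [Finset.sum_comm]
      refine Finset.sum_congr rfl fun k _ => ?_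
      rw [Finset.sum_mul]
      refine Finset.sum_congr rfl fun q _ => ?_
      rw [h.pd_chr_symm hx q l i k]; ring
    · simp only [Finset.mul_sum, Finset.sum_mul]
      have c1 : ∀ g : Fin n → Fin n → Fin n → Fin n → ℝ, ∑ k, ∑ p, ∑ q, ∑ l, g k p q l
          = ∑ l, ∑ q, ∑ k, ∑ p, g k p q l := by
        intro g
        calc _ = ∑ k, ∑ l, ∑ q, ∑ p, g k p q l := Finset.sum_congr rfl fun k _ => by
              rw [Finset.sum_comm]
              simp_rw [Finset.sum_comm (s := Finset.univ (α := Fin n)) (f := fun p l => g k p _ l)]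
              rw [Finset.sum_comm]
          _ = _ := by
              rw [Finset.sum_comm]
              exact Finset.sum_congr rfl fun l _ => Finset.sum_comm
      rw [c1]
      refine Finset.sum_congr rfl fun l _ => Finset.sum_congr rfl fun q _ =>
        Finset.sum_congr rfl fun k _ => Finset.sum_congr rfl fun p _ => ?_
      rw [h.chr_symm hx p i k, h.chr_symm hx l p q]; ring
  rw [e, e, ← sub_eq_zero, ← Finset.sum_sub_distrib]
  refine Finset.sum_eq_zero fun l _ => ?_
  rw [Finset.sum_comm (f := fun q k => _ * (v q * u k * w l)), ← Finset.sum_sub_distrib]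
  refine Finset.sum_eq_zero fun q _ => ?_
  rw [← Finset.sum_sub_distrib]
  refine Finset.sum_eq_zero fun k _ => ?_
  have := hR l i q k
  rw [riem, Finset.sum_sub_distrib] at this
  linear_combination (u q * v k * w l) * this

/-- On a flat metric there are parallel covector fields with prescribed initial values. -/
theorem exists_parallel (h : UnitPair a b U) (hR : ∀ x ∈ U, ∀ l k i j, riem a l k i j x = 0)
    {x₀ : Euc n} (hx₀ : x₀ ∈ U) (w₀ : Fin n → ℝ) :
    ∃ θ : Fin n → Euc n → ℝ, (∀ j, θ j x₀ = w₀ j) ∧ ∀ᶠ x in 𝓝 x₀, ∀ j, ContDiffAt ℝ ∞ (θ j) x ∧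
      ∀ k, pd k (θ j) x = ∑ l, chr a l j k x * θ l x := by
  obtain ⟨f, hf0, hf⟩ := exists_hasFDerivAt_of_integrable h.isOpen h.contDiffOn_conn
    (fun p hp => h.conn_integrable hp (hR p hp)) hx₀ (WithLp.toLp 2 w₀)
  obtain ⟨V, hV, hVo, hxV⟩ := eventually_nhds_iff.1 (hf.and (h.isOpen.mem_nhds hx₀))
  have hs := contDiffOn_of_hasFDerivAt hVo (h.contDiffOn_conn.mono fun x hx => (hV x hx).2)
    fun x hx => (hV x hx).1
  refine ⟨fun j x => f x j, fun j => by simp only [hf0], ?_⟩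
  filter_upwards [hVo.mem_nhds hxV] with x hx j
  refine ⟨(EuclideanSpace.proj j : Euc n →L[ℝ] ℝ).contDiff.contDiffAt.comp x
    (hs.contDiffAt (hVo.mem_nhds hx)), fun k => ?_⟩
  have := (EuclideanSpace.proj j : Euc n →L[ℝ] ℝ).hasFDerivAt.comp x (hV x hx).1
  have e : pd k (fun x => f x j) x = (conn a x (stdVec k) (f x)) j := by
    rw [pd, HasFDerivAt.fderiv (f := fun x => f x j) this]
    rfl
  rw [e, conn_apply, Finset.sum_eq_single k]
  · simp [stdVec]
  · intro q _ hq
    simp [stdVec, hq]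
  · simp

end UnitPair

end Flat

end MKropina

end

/-! ### Orthonormal parallel coframes and flat coordinates. -/

noncomputable section

namespace MKropina

open Filter Topology Matrix

variable {n : ℕ}

theorem pdMat_mul {A B : Euc n → Matrix (Fin n) (Fin n) ℝ} {x : Euc n}
    (hA : ∀ i j, DifferentiableAt ℝ (fun z => A z i j) x)
    (hB : ∀ i j, DifferentiableAt ℝ (fun z => B z i j) x) (k : Fin n) :
    pdMat k (fun z => A z * B z) x = pdMat k A x * B x + A x * pdMat k B x := by
  ext i j
  simp only [pdMat, of_apply, mul_apply, Matrix.add_apply]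
  rw [pd_sum fun l _ => (hA i l).fun_mul (hB l j), ← Finset.sum_add_distrib]
  exact Finset.sum_congr rfl fun l _ => pd_mul (hA i l) (hB l j)

theorem pdMat_congr {A B : Euc n → Matrix (Fin n) (Fin n) ℝ} {x : Euc n} (h : A =ᶠ[𝓝 x] B)
    (k : Fin n) : pdMat k A x = pdMat k B x := by
  ext i j
  exact pd_congr (h.mono fun z hz => congrFun (congrFun hz i) j)

open scoped MatrixOrder in
/-- A unit covector is the first row of a coframe that is orthonormal for a given metric. -/
theorem exists_orthonormal_coframe {A : Matrix (Fin n) (Fin n) ℝ} (hA : A.PosDef)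
    {v : Fin n → ℝ} (hv : v ⬝ᵥ A⁻¹ *ᵥ v = 1) (i₀ : Fin n) :
    ∃ Θ : Matrix (Fin n) (Fin n) ℝ, Θ i₀ = v ∧ Θ * A⁻¹ * Θᵀ = 1 := by
  -- With A = BᵀB, the row c = vB⁻¹ has Euclidean length one. It is completed to an orthogonal
  -- matrix Q with c in row i₀, and Θ = QB.
  obtain ⟨B, hB⟩ := CStarAlgebra.nonneg_iff_eq_star_mul_self.mp hA.posSemidef.nonneg
  rw [star_eq_conjTranspose, conjTranspose_eq_transpose_of_trivial] at hB
  have hdet : IsUnit B.det := by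
    rw [isUnit_iff_ne_zero]
    intro h0
    have := hA.det_pos
    rw [hB, det_mul, h0, mul_zero] at this
    exact lt_irrefl _ this
  have hinv : A⁻¹ = B⁻¹ * (B⁻¹)ᵀ := by rw [hB, Matrix.mul_inv_rev, transpose_nonsing_inv]
  set c := v ᵥ* B⁻¹ with hc
  have hcc : c ⬝ᵥ c = 1 := by
    rw [← hv, hinv, ← mulVec_mulVec, mulVec_transpose, dotProduct_mulVec]
  have hon : Orthonormal ℝ (({i₀} : Set (Fin n)).domRestrict fun _ : Fin n => WithLp.toLp 2 c) := by
    refine ⟨fun i => ?_, fun i j hij => absurd (Subsingleton.elim i j) hij⟩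
    have : ‖WithLp.toLp 2 c‖ ^ 2 = 1 := by
      rw [EuclideanSpace.norm_sq_eq, ← hcc]
      simp [dotProduct, pow_two]
    exact (pow_eq_one_iff_of_nonneg (norm_nonneg _) two_ne_zero).1 this
  obtain ⟨q, hq⟩ := hon.exists_orthonormalBasis_extension_of_card_eq (ι := Fin n) (by simp)
  set Q : Matrix (Fin n) (Fin n) ℝ := Matrix.of fun i j => q i j with hQ
  have hQQ : Q * Qᵀ = 1 := by
    ext i j
    have := (orthonormal_iff_ite.1 q.orthonormal) j i
    rw [mul_apply, one_apply]
    simp only [PiLp.inner_apply, eq_comm (a := j)] at this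
    rw [← this]
    simp [hQ]
  refine ⟨Q * B, ?_, ?_⟩
  · have h1 : Q i₀ = c := by
      funext j
      simp [hQ, hq i₀ rfl]
    calc (Q * B) i₀ = Q i₀ ᵥ* B := rfl
      _ = v := by rw [h1, hc, vecMul_vecMul, nonsing_inv_mul _ hdet, vecMul_one]
  · rw [transpose_mul, hinv]
    calc Q * B * (B⁻¹ * (B⁻¹)ᵀ) * (Bᵀ * Qᵀ) = Q * (B * B⁻¹) * (B * B⁻¹)ᵀ * Qᵀ := by
          rw [transpose_mul]; simp only [Matrix.mul_assoc]
      _ = 1 := by rw [mul_nonsing_inv _ hdet]; simpa using hQQ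

namespace UnitPair

variable {a : Euc n → Matrix (Fin n) (Fin n) ℝ} {b : Fin n → Euc n → ℝ}
  {U : Set (Euc n)} {x : Euc n}

/-- The metric is parallel. -/
theorem pdMat_a (h : UnitPair a b U) (hx : x ∈ U) (k : Fin n) :
    pdMat k a x = (Matrix.of fun l j => chr a l j k x)ᵀ * a x
      + a x * Matrix.of fun l j => chr a l j k x := by
  ext i j
  simp only [pdMat, Matrix.add_apply, mul_apply, transpose_apply, of_apply]
  have e1 := h.sum_a_chr hx i j k
  have e2 := h.sum_a_chr hx j i k
  have e3 : ∑ l, chr a l i k x * a x l j = ∑ l, a x j l * chr a l i k x :=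
    Finset.sum_congr rfl fun l _ => by rw [h.symm_apply hx l j]; ring
  have s : ∀ p q r, pd p (fun z => a z q r) x = pd p (fun z => a z r q) x := fun p q r =>
    pd_congr (by filter_upwards [h.isOpen.mem_nhds hx] with z hz using h.symm_apply hz q r)
  rw [e3, e1, e2, s k j i, s j i k, s i j k, s j k i, s i k j]
  ring

theorem pdMat_inv (h : UnitPair a b U) (hx : x ∈ U) (k : Fin n) :
    pdMat k (fun z => (a z)⁻¹) x = - ((a x)⁻¹ * (Matrix.of fun l j => chr a l j k x)ᵀ
      + (Matrix.of fun l j => chr a l j k x) * (a x)⁻¹) := by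
  have h1 : pdMat k (fun z => a z * (a z)⁻¹) x = 0 := by
    rw [pdMat_congr (B := fun _ => 1)]
    · ext i j; simp [pdMat]
    · filter_upwards [h.isOpen.mem_nhds hx] with z hz using mul_nonsing_inv _ (h.isUnit_det hz)
  rw [pdMat_mul (fun i j => h.differentiableAt_a hx i j)
    (fun i j => (h.contDiffAt_inv hx i j).differentiableAt (by simp)), h.pdMat_a hx] at h1
  -- Differentiating a a⁻¹ = 1 and multiplying by a⁻¹ from the left.
  have h2 := congrArg (fun M => (a x)⁻¹ * M) h1
  simp only [Matrix.mul_add, Matrix.add_mul, Matrix.mul_assoc,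
    mul_nonsing_inv _ (h.isUnit_det hx), Matrix.mul_one, Matrix.mul_zero] at h2
  rw [← Matrix.mul_assoc _ (a x), nonsing_inv_mul _ (h.isUnit_det hx), Matrix.one_mul,
    ← Matrix.mul_assoc _ (a x), nonsing_inv_mul _ (h.isUnit_det hx), Matrix.one_mul] at h2
  exact eq_neg_of_add_eq_zero_right h2

/-- Parallel covector fields that are orthonormal at a point are orthonormal nearby. -/
theorem parallel_orthonormal (h : UnitPair a b U) {V : Set (Euc n)} (hV : IsOpen V)
    (hVc : IsPreconnected V) (hVU : V ⊆ U) {Θ : Euc n → Matrix (Fin n) (Fin n) ℝ}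
    (hΘ : ∀ x ∈ V, ∀ i j, DifferentiableAt ℝ (fun z => Θ z i j) x)
    (hp : ∀ x ∈ V, ∀ k, pdMat k Θ x = Θ x * Matrix.of fun l j => chr a l j k x)
    {x₀ : Euc n} (hx₀ : x₀ ∈ V) (h0 : Θ x₀ * (a x₀)⁻¹ * (Θ x₀)ᵀ = 1) (hx : x ∈ V) :
    (Θ x)ᵀ * Θ x = a x := by
  have dI : ∀ x ∈ V, ∀ i j, DifferentiableAt ℝ (fun z => (a z)⁻¹ i j) x := fun x hx i j =>
    (h.contDiffAt_inv (hVU hx) i j).differentiableAt (by simp)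
  have dM : ∀ (A B : Euc n → Matrix (Fin n) (Fin n) ℝ), ∀ x,
      (∀ i j, DifferentiableAt ℝ (fun z => A z i j) x) →
      (∀ i j, DifferentiableAt ℝ (fun z => B z i j) x) →
      ∀ i j, DifferentiableAt ℝ (fun z => (A z * B z) i j) x := by
    intro A B x hA hB i j
    simp only [mul_apply]
    exact DifferentiableAt.fun_sum fun l _ => (hA i l).fun_mul (hB l j)
  have dT : ∀ x ∈ V, ∀ i j, DifferentiableAt ℝ (fun z => (Θ z)ᵀ i j) x := fun x hx i j =>
    hΘ x hx j i
  have dS := fun x hx => dM _ _ x (dM _ _ x (hΘ x hx) (dI x hx)) (dT x hx)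
  -- The Gram matrix of parallel covectors is constant: the connection terms of Θ and of the inverse
  -- metric cancel.
  have hS : ∀ x ∈ V, ∀ k, pdMat k (fun z => Θ z * (a z)⁻¹ * (Θ z)ᵀ) x = 0 := by
    intro x hx k
    have eT : pdMat k (fun z => (Θ z)ᵀ) x = (pdMat k Θ x)ᵀ := rfl
    rw [pdMat_mul (dM _ _ x (hΘ x hx) (dI x hx)) (dT x hx), pdMat_mul (hΘ x hx) (dI x hx), eT,
      hp x hx, h.pdMat_inv (hVU hx), transpose_mul]
    simp only [Matrix.add_mul, Matrix.mul_add, Matrix.mul_assoc, Matrix.mul_neg, Matrix.neg_mul]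
    abel
  have hc : Θ x * (a x)⁻¹ * (Θ x)ᵀ = 1 := by
    rw [← h0]
    ext i j
    refine hV.is_const_of_fderiv_eq_zero (𝕜 := ℝ) hVc
      (f := fun z => (Θ z * (a z)⁻¹ * (Θ z)ᵀ) i j)
      (fun z hz => (dS z hz i j).differentiableWithinAt) (fun z hz => ?_) hx hx₀
    ext v
    rw [fderiv_eq_sum_pd]
    have : ∀ k, pd k (fun z => (Θ z * (a z)⁻¹ * (Θ z)ᵀ) i j) z = 0 := fun k =>
      congrFun (congrFun (hS z hz k) i) j
    simp [this]
  -- A one-sided inverse of a square matrix is two-sided, which turns orthonormality of the coframe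
  -- into ΘᵀΘ = a.
  rw [mul_eq_one_comm, ← Matrix.mul_assoc] at hc
  calc (Θ x)ᵀ * Θ x = (Θ x)ᵀ * Θ x * ((a x)⁻¹ * a x) := by
        rw [nonsing_inv_mul _ (h.isUnit_det (hVU hx)), Matrix.mul_one]
    _ = a x := by rw [← Matrix.mul_assoc, hc, Matrix.one_mul]

set_option maxSynthPendingDepth 3 in
/-- **Flat coordinates** adapted to a parallel form. -/
theorem exists_flat_coords (h : UnitPair a b U) (hb : ∀ x ∈ U, covD a b x = 0)
    (hR : ∀ x ∈ U, ∀ l k i j, riem a l k i j x = 0) {x₀ : Euc n} (hx₀ : x₀ ∈ U) (i₀ : Fin n) :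
    ∃ (V : Set (Euc n)) (φ : Euc n → Euc n), IsOpen V ∧ x₀ ∈ V ∧ V ⊆ U ∧ ContDiffOn ℝ ∞ φ V ∧
      ∀ x ∈ V, ∀ y, ‖fderiv ℝ φ x y‖ ^ 2 = alphaSq a x y ∧ (fderiv ℝ φ x y) i₀ = beta b x y := by
  obtain ⟨Θ₀, hΘ₀, hΘ₀'⟩ := exists_orthonormal_coframe (h.posDef x₀ hx₀) (h.unit x₀ hx₀) i₀
  choose θ hθ0 hθ using fun i => h.exists_parallel hR hx₀ (Θ₀ i)
  obtain ⟨r, hr, hball⟩ := Metric.eventually_nhds_iff_ball.1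
    ((eventually_all.2 hθ).and (h.isOpen.mem_nhds hx₀))
  set V := Metric.ball x₀ r with hV
  have hVo : IsOpen V := Metric.isOpen_ball
  have hxV : x₀ ∈ V := Metric.mem_ball_self hr
  have hVU : V ⊆ U := fun x hx => (hball x hx).2
  -- Row i₀ is replaced by b itself, which is parallel and has the same initial value. This avoids a
  -- uniqueness argument for parallel fields.
  set T : Fin n → Fin n → Euc n → ℝ := fun i j x => if i = i₀ then b j x else θ i j x with hT
  have hTs : ∀ x ∈ V, ∀ i j, ContDiffAt ℝ ∞ (T i j) x := by
    intro x hx i j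
    by_cases hi : i = i₀
    · simpa [hT, hi] using h.contDiffAt_b (hVU hx) j
    · simpa [hT, hi] using ((hball x hx).1 i j).1
  have hTp : ∀ x ∈ V, ∀ i j k, pd k (T i j) x = ∑ l, T i l x * chr a l j k x := by
    intro x hx i j k
    by_cases hi : i = i₀
    · have := congrFun (congrFun (hb x (hVU hx)) j) k
      simp only [covD, of_apply, Matrix.zero_apply] at this
      simp only [hT, hi, if_true]
      rw [eq_of_sub_eq_zero this]
      exact Finset.sum_congr rfl fun l _ => mul_comm _ _
    · simp only [hT, hi, if_false]
      rw [((hball x hx).1 i j).2 k]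
      exact Finset.sum_congr rfl fun l _ => mul_comm _ _
  have hTd := fun x hx i j => (hTs x hx i j).differentiableAt (by simp)
  have hT0 : (Matrix.of fun i j => T i j x₀) = Θ₀ := by
    ext i j
    by_cases hi : i = i₀
    · simp only [hT, hi, of_apply, if_true, hΘ₀]; rfl
    · simp only [hT, hi, of_apply, if_false, hθ0]
  have hTT : ∀ x ∈ V, (Matrix.of fun i j => T i j x)ᵀ * (Matrix.of fun i j => T i j x) = a x :=
    fun x hx => h.parallel_orthonormal hVo (convex_ball x₀ r).isPreconnected hVU
      (Θ := fun x => Matrix.of fun i j => T i j x) hTd (fun x hx k => by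
        ext i j
        exact hTp x hx i j k) hxV (by rw [hT0]; exact hΘ₀') hx
  set cf : Fin n → Euc n → Euc n →L[ℝ] ℝ := fun i x => ∑ j, T i j x • EuclideanSpace.proj j with hcf
  have hcs : ∀ i, ContDiffOn ℝ ∞ (cf i) V := fun i =>
    ContDiffOn.sum fun j _ => ContDiffOn.smul
      (fun x hx => (hTs x hx i j).contDiffWithinAt) contDiffOn_const
  have hca : ∀ i x y, cf i x y = ∑ j, T i j x * y j := by
    intro i x y
    simp [hcf]
  have hcd : ∀ i, ∀ x ∈ V, ∀ u v, fderiv ℝ (cf i) x u v = ∑ j, (∑ k, u k * pd k (T i j) x) * v j := by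
    intro i x hx u v
    have : HasFDerivAt (cf i) (∑ j, (fderiv ℝ (T i j) x).smulRight
        (EuclideanSpace.proj j : Euc n →L[ℝ] ℝ)) x :=
      HasFDerivAt.fun_sum fun j _ => (hTd x hx i j).hasFDerivAt.smul_const
        (EuclideanSpace.proj j : Euc n →L[ℝ] ℝ)
    rw [this.fderiv]
    simp only [_root_.sum_apply, ContinuousLinearMap.smulRight_apply, fderiv_eq_sum_pd]
    rfl
  -- Parallel covector fields are closed, by the symmetry of the Christoffel symbols; the Poincaré
  -- lemma on the ball gives potentials.
  have hφ : ∀ i, ∃ f, ∀ x ∈ V, HasFDerivAt f (cf i x) x := by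
    intro i
    refine (convex_ball x₀ r).exists_forall_hasFDerivAt_of_fderiv_symmetric Metric.isOpen_ball
      (fun x hx => ((hcs i).differentiableOn (by simp)) x hx) fun x hx u v => ?_
    rw [hcd i x hx, hcd i x hx]
    simp_rw [Finset.sum_mul]
    rw [Finset.sum_comm]
    refine Finset.sum_congr rfl fun j _ => Finset.sum_congr rfl fun k _ => ?_
    rw [hTp x hx, hTp x hx]
    simp_rw [h.chr_symm (hVU hx) _ k j]
    ring
  choose φ hφ using hφ
  have hφs : ∀ i, ContDiffOn ℝ ∞ (φ i) V := by
    intro i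
    rw [contDiffOn_infty_iff_fderiv_of_isOpen hVo]
    exact ⟨fun x hx => (hφ i x hx).differentiableAt.differentiableWithinAt,
      (hcs i).congr fun x hx => (hφ i x hx).fderiv⟩
  refine ⟨V, fun x => WithLp.toLp 2 fun i => φ i x, hVo, hxV, hVU, ?_, fun x hx y => ?_⟩
  · exact contDiffOn_euclidean.2 hφs
  · have hd : HasFDerivAt (fun x => (WithLp.toLp 2 fun i => φ i x : Euc n))
        ((EuclideanSpace.equiv (Fin n) ℝ).symm.toContinuousLinearMap ∘L
          ContinuousLinearMap.pi fun i => cf i x) x :=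
      (EuclideanSpace.equiv (Fin n) ℝ).symm.toContinuousLinearMap.hasFDerivAt.comp x
        (hasFDerivAt_pi.2 fun i => hφ i x hx)
    have hda : ∀ i, (fderiv ℝ (fun x => (WithLp.toLp 2 fun i => φ i x : Euc n)) x y) i
        = ((Matrix.of fun i j => T i j x) *ᵥ y.ofLp) i := by
      intro i
      rw [hd.fderiv]
      exact hca i x y
    constructor
    · rw [EuclideanSpace.norm_sq_eq]
      simp_rw [Real.norm_eq_abs, sq_abs, hda]
      rw [alphaSq, quad, ← hTT x hx, ← mulVec_mulVec, dotProduct_mulVec, vecMul_transpose]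
      simp only [dotProduct, pow_two]
    · rw [hda]
      simp only [mulVec, of_apply, hT, if_true, beta]
      rfl

end UnitPair

end MKropina

end

/-! ### Metrics and one-forms on the manifold in local coordinates. -/

noncomputable section

namespace MKropina

open Filter Topology Matrix

variable {n : ℕ} {M : Type*} [TopologicalSpace M] [ChartedSpace (EuclideanSpace ℝ (Fin n)) M]
  [IsManifold (𝓡 n) ∞ M]

section Chart

variable {e : OpenPartialHomeomorph M (EuclideanSpace ℝ (Fin n))} {x : Euc n}

set_option linter.unusedSectionVars false

instance isManifold_one : IsManifold (𝓡 n) 1 M := IsManifold.of_le (n := ∞) (by simp)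

theorem IsCoord.mdifferentiable (he : IsCoord n M e) : e.MDifferentiable (𝓡 n) (𝓡 n) :=
  ⟨(contMDiffOn_of_mem_maximalAtlas he).mdifferentiableOn (by simp),
    (contMDiffOn_symm_of_mem_maximalAtlas he).mdifferentiableOn (by simp)⟩

theorem IsCoord.coordVec_surjective (he : IsCoord n M e) (hx : x ∈ e.target) :
    Function.Surjective (coordVec e x) :=
  he.mdifferentiable.symm.mfderiv_surjective hx

theorem IsCoord.coordVec_injective (he : IsCoord n M e) (hx : x ∈ e.target) :
    Function.Injective (coordVec e x) :=
  he.mdifferentiable.symm.mfderiv_injective hx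

theorem coordVec_smul (c : ℝ) (y : Euc n) : coordVec e x (c • y) = c • coordVec e x y :=
  map_smul (mfderiv (𝓡 n) (𝓡 n) e.symm x) c y

theorem coordVec_eq_sum (y : Euc n) : coordVec e x y = ∑ i, y i • coordVec e x (stdVec i) := by
  have hv : y = ∑ k, y k • (stdVec k : Euc n) := by
    ext i
    simp [stdVec, Pi.single_apply]
  conv_lhs => rw [hv]
  exact (map_sum (mfderiv (𝓡 n) (𝓡 n) e.symm x) _ _).trans
    (Finset.sum_congr rfl fun i _ => coordVec_smul (e := e) (x := x) _ _)

theorem inner_coordVec (α : RiemMetric n M) (y z : Euc n) :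
    α.inner (e.symm x) (coordVec e x y) (coordVec e x z) = y.ofLp ⬝ᵥ coeffA α e x *ᵥ z.ofLp := by
  rw [coordVec_eq_sum y, coordVec_eq_sum z]
  simp only [map_sum, map_smul, _root_.sum_apply, _root_.smul_apply, dotProduct, mulVec, coeffA,
    of_apply, smul_eq_mul, Finset.mul_sum]
  rw [Finset.sum_comm]
  exact Finset.sum_congr rfl fun i _ => Finset.sum_congr rfl fun j _ => by ring

theorem form_coordVec (β : OneForm n M) (y : Euc n) :
    β.form (e.symm x) (coordVec e x y) = beta (coeffB β e) x y := by
  rw [coordVec_eq_sum y]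
  simp only [map_sum, map_smul, beta, cov, dotProduct, coeffB, smul_eq_mul]
  exact Finset.sum_congr rfl fun i _ => mul_comm _ _

theorem length_coordVec (α : RiemMetric n M) (y : Euc n) :
    length α (e.symm x) (coordVec e x y) = √(alphaSq (coeffA α e) x y) := by
  rw [length, inner_coordVec]; rfl

theorem IsCoord.posDef (he : IsCoord n M e) (hx : x ∈ e.target) (α : RiemMetric n M) :
    (coeffA α e x).PosDef := by
  refine PosDef.of_dotProduct_mulVec_pos ?_ fun v hv => ?_
  · ext i j
    simp only [conjTranspose_apply, coeffA, of_apply, star_trivial]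
    exact α.symm _ _ _
  · have := inner_coordVec (e := e) (x := x) α (WithLp.toLp 2 v) (WithLp.toLp 2 v)
    simp only [star_trivial]
    rw [← this]
    refine α.pos _ _ fun h0 => hv ?_
    have h1 : coordVec e x (WithLp.toLp 2 v) = coordVec e x 0 := by
      rw [h0]; exact (map_zero (mfderiv (𝓡 n) (𝓡 n) e.symm x)).symm
    have := he.coordVec_injective hx h1
    simpa using congrArg WithLp.ofLp this

/-- The field is the tangent map of the inverse chart applied to a constant field. Coefficients of
metrics and forms are smooth because they are pairings of smooth sections with such fields. -/
theorem IsCoord.contMDiffOn_coordVec (he : IsCoord n M e) (y : Euc n) :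
    ContMDiffOn (𝓡 n) ((𝓡 n).prod 𝓘(ℝ, EuclideanSpace ℝ (Fin n))) ∞
      (fun x => Bundle.TotalSpace.mk' (EuclideanSpace ℝ (Fin n))
        (E := fun p : M => TangentSpace (𝓡 n) p) (e.symm x) (coordVec e x y)) e.target := by
  have h1 := (contMDiffOn_symm_of_mem_maximalAtlas he).contMDiffOn_tangentMapWithin (m := ∞)
    (by simp) e.open_target.uniqueMDiffOn
  have h2 : ContMDiff (𝓡 n) (𝓡 n).tangent ∞
      (fun x => (⟨x, y⟩ : TangentBundle (𝓡 n) (EuclideanSpace ℝ (Fin n)))) :=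
    contMDiff_vectorSpace_iff_contDiff.2 contDiff_const
  have h3 := h1.comp h2.contMDiffOn (s := e.target) fun x hx => hx
  refine h3.congr fun x hx => ?_
  simp only [Function.comp, tangentMapWithin, mfderivWithin_of_isOpen e.open_target hx]
  rfl

theorem IsCoord.contDiffOn_coeffB (he : IsCoord n M e) (β : OneForm n M) (i : Fin n) :
    ContDiffOn ℝ ∞ (coeffB β e i) e.target := by
  rw [← contMDiffOn_iff_contDiffOn]
  have h1 := β.smooth.comp_contMDiffOn (contMDiffOn_symm_of_mem_maximalAtlas he)
  have h2 : ContMDiffOn (𝓡 n) ((𝓡 n).prod 𝓘(ℝ, ℝ)) ∞ (fun x => Bundle.TotalSpace.mk' ℝ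
      (E := Bundle.Trivial M ℝ) (e.symm x) (coeffB β e i x)) e.target := by
    apply ContMDiffOn.clm_bundle_apply (F₁ := EuclideanSpace ℝ (Fin n)) (F₂ := ℝ)
    · exact h1
    · exact he.contMDiffOn_coordVec _
  intro x hx
  exact (Bundle.contMDiffWithinAt_totalSpace.1 (h2 x hx)).2

theorem IsCoord.contDiffOn_coeffA (he : IsCoord n M e) (α : RiemMetric n M) (i j : Fin n) :
    ContDiffOn ℝ ∞ (fun x => coeffA α e x i j) e.target := by
  rw [← contMDiffOn_iff_contDiffOn]
  have h1 := α.contMDiff.comp_contMDiffOn (contMDiffOn_symm_of_mem_maximalAtlas he)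
  have h2 : ContMDiffOn (𝓡 n) ((𝓡 n).prod 𝓘(ℝ, ℝ)) ∞ (fun x => Bundle.TotalSpace.mk' ℝ
      (E := Bundle.Trivial M ℝ) (e.symm x) (coeffA α e x i j)) e.target := by
    apply ContMDiffOn.clm_bundle_apply₂ (F₁ := EuclideanSpace ℝ (Fin n))
      (F₂ := EuclideanSpace ℝ (Fin n))
    · exact h1
    · exact he.contMDiffOn_coordVec _
    · exact he.contMDiffOn_coordVec _
  intro x hx
  exact (Bundle.contMDiffWithinAt_totalSpace.1 (h2 x hx)).2

end Chart

end MKropina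

end

/-! ### The length of the form and conformal rescaling. -/

noncomputable section

namespace MKropina

open Filter Topology Matrix

variable {n : ℕ} {M : Type*} [TopologicalSpace M] [ChartedSpace (EuclideanSpace ℝ (Fin n)) M]
  [IsManifold (𝓡 n) ∞ M]

section NormSq

variable {e : OpenPartialHomeomorph M (EuclideanSpace ℝ (Fin n))} {x : Euc n}

theorem exists_coord (p : M) : ∃ e, IsCoord n M e ∧ p ∈ e.source ∧ ∃ x ∈ e.target, e.symm x = p :=
  ⟨chartAt _ p, IsManifold.chart_mem_maximalAtlas p, mem_chart_source _ p, chartAt _ p p,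
    mem_chart_target _ p, (chartAt _ p).left_inv (mem_chart_source _ p)⟩

theorem IsCoord.inner_bup (he : IsCoord n M e) (hx : x ∈ e.target) (α : RiemMetric n M)
    (β : OneForm n M) (v : TangentSpace (𝓡 n) (e.symm x)) :
    α.inner (e.symm x) (coordVec e x (WithLp.toLp 2 (bup (coeffA α e) (coeffB β e) x))) v
      = β.form (e.symm x) v := by
  obtain ⟨y, rfl⟩ := he.coordVec_surjective hx v
  have hp := he.posDef hx α
  have hs : (coeffA α e x)ᵀ = coeffA α e x := by
    have := hp.isHermitian
    rwa [Matrix.IsHermitian, conjTranspose_eq_transpose_of_trivial] at this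
  rw [inner_coordVec, form_coordVec, dotProduct_mulVec, ← mulVec_transpose, hs, bup, mulVec_mulVec,
    mul_nonsing_inv _ hp.det_pos.ne'.isUnit, one_mulVec]
  rfl

theorem exists_dual (α : RiemMetric n M) (β : OneForm n M) (p : M) :
    ∃ X, ∀ v, α.inner p X v = β.form p v := by
  obtain ⟨e, he, -, x, hx, rfl⟩ := exists_coord (n := n) p
  exact ⟨_, he.inner_bup hx α β⟩

/-- The squared length `a^{ij} b_i b_j` of `β` with respect to `α`. -/
def normSq (α : RiemMetric n M) (β : OneForm n M) (p : M) : ℝ :=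
  β.form p (Classical.choose (exists_dual α β p))

/-- Frees `normSq` from the choice in its definition: by symmetry of the inner product any dual
vector gives the same value. -/
theorem normSq_eq_of_dual {α : RiemMetric n M} {β : OneForm n M} {p : M}
    {X : TangentSpace (𝓡 n) p} (hX : ∀ v, α.inner p X v = β.form p v) :
    normSq α β p = β.form p X := by
  have h := Classical.choose_spec (exists_dual α β p)
  rw [normSq, ← hX, ← h X, α.symm]

theorem IsCoord.normSq_eq (he : IsCoord n M e) (hx : x ∈ e.target) (α : RiemMetric n M)
    (β : OneForm n M) : normSq α β (e.symm x)
      = cov (coeffB β e) x ⬝ᵥ bup (coeffA α e) (coeffB β e) x := by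
  rw [normSq_eq_of_dual (he.inner_bup hx α β), form_coordVec]
  rfl

theorem normSq_pos {α : RiemMetric n M} {β : OneForm n M} {p : M} (h : β.form p ≠ 0) :
    0 < normSq α β p := by
  obtain ⟨X, hX⟩ := exists_dual α β p
  rw [normSq_eq_of_dual hX, ← hX]
  refine α.pos p X fun h0 => h ?_
  ext v
  rw [← hX, h0, map_zero]

theorem contMDiff_normSq (α : RiemMetric n M) (β : OneForm n M) :
    ContMDiff (𝓡 n) 𝓘(ℝ, ℝ) ∞ (normSq α β) := by
  intro p
  obtain ⟨e, he, hp, -⟩ := exists_coord (n := n) p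
  have h1 : ContDiffAt ℝ ∞ (fun x => cov (coeffB β e) x ⬝ᵥ bup (coeffA α e) (coeffB β e) x)
      (e p) := by
    have hn := e.open_target.mem_nhds (e.map_source hp)
    have hb : ∀ i, ContDiffAt ℝ ∞ (coeffB β e i) (e p) := fun i =>
      (he.contDiffOn_coeffB β i).contDiffAt hn
    have ha : ∀ i j, ContDiffAt ℝ ∞ (fun x => (coeffA α e x)⁻¹ i j) (e p) :=
      contDiffAt_matrix_inv (fun i j => (he.contDiffOn_coeffA α i j).contDiffAt hn)
        (he.posDef (e.map_source hp) α).det_pos.ne'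
    exact ContDiffAt.sum (s := Finset.univ) fun i _ => (hb i).mul
      (ContDiffAt.sum (s := Finset.univ) fun j _ => (ha i j).mul (hb j))
  have h2 := h1.contMDiffAt.comp p
    ((contMDiffOn_of_mem_maximalAtlas he).contMDiffAt (e.open_source.mem_nhds hp))
  refine h2.congr_of_eventuallyEq ?_
  filter_upwards [e.open_source.mem_nhds hp] with q hq
  have := he.normSq_eq (e.map_source hq) α β
  rw [e.left_inv hq] at this
  exact this

theorem hasUnitLength_iff (α : RiemMetric n M) (β : OneForm n M) :
    HasUnitLength α β ↔ ∀ p, normSq α β p = 1 := by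
  have key : ∀ e : OpenPartialHomeomorph M (EuclideanSpace ℝ (Fin n)), ∀ x,
      ∑ i, ∑ j, (coeffA α e x)⁻¹ i j * coeffB β e i x * coeffB β e j x
        = cov (coeffB β e) x ⬝ᵥ bup (coeffA α e) (coeffB β e) x := by
    intro e x
    simp only [dotProduct, bup, mulVec, cov, Finset.mul_sum]
    exact Finset.sum_congr rfl fun i _ => Finset.sum_congr rfl fun j _ => by ring
  constructor
  · intro h p
    obtain ⟨e, he, -, x, hx, rfl⟩ := exists_coord (n := n) p
    rw [he.normSq_eq hx, ← key, h e he x hx]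
  · intro h e he x hx
    rw [key, ← he.normSq_eq hx, h]

theorem HasUnitLength.unitPair {α : RiemMetric n M} {β : OneForm n M} (h : HasUnitLength α β)
    (he : IsCoord n M e) : UnitPair (coeffA α e) (coeffB β e) e.target where
  isOpen := e.open_target
  smooth_a := he.contDiffOn_coeffA α
  smooth_b := he.contDiffOn_coeffB β
  posDef x hx := he.posDef hx α
  unit x hx := by rw [← he.normSq_eq hx, (hasUnitLength_iff α β).1 h]

end NormSq

section Scaling

set_option maxSynthPendingDepth 3
set_option synthInstance.maxHeartbeats 100000

/-- The metric with inner product `f ⟨·, ·⟩`. -/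
def scaleMetric (f : M → ℝ) (hf : ContMDiff (𝓡 n) 𝓘(ℝ, ℝ) ∞ f) (h0 : ∀ p, 0 < f p)
    (α : RiemMetric n M) : RiemMetric n M where
  inner p := f p • α.inner p
  symm p v w := by
    simp only [_root_.smul_apply, α.symm p v w]
  pos p v hv := by
    simpa only [_root_.smul_apply, smul_eq_mul] using mul_pos (h0 p) (α.pos p v hv)
  isVonNBounded p := by
    -- The unit ball of the rescaled metric is contained in the image of the original one under
    -- multiplication by 1/√f.
    have hc := Real.sqrt_pos.2 (h0 p)
    have h1 := Bornology.IsVonNBounded.image (σ := RingHom.id ℝ) (α.isVonNBounded p)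
      ((√(f p))⁻¹ • ContinuousLinearMap.id ℝ (TangentSpace (𝓡 n) p))
    refine Bornology.IsVonNBounded.subset ?_ h1
    intro v hv
    refine (Set.mem_image _ _ _).2 ⟨√(f p) • v, ?_, ?_⟩
    · simp only [Set.mem_ofPred_eq, _root_.smul_apply, smul_eq_mul, map_smul] at hv ⊢
      rwa [← mul_assoc, Real.mul_self_sqrt (h0 p).le]
    · simp [smul_smul, hc.ne']
  contMDiff := ContMDiff.smul_section hf α.contMDiff

/-- The one-form `f β`. -/
def scaleForm (f : M → ℝ) (hf : ContMDiff (𝓡 n) 𝓘(ℝ, ℝ) ∞ f) (β : OneForm n M) : OneForm n M where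
  form p := f p • β.form p
  smooth := hf.smul_section β.smooth

end Scaling

end MKropina

end

/-! ### Normalisation, and the equivalence with the flat parallel form. -/

noncomputable section

namespace MKropina

open Filter Topology Matrix

variable {n : ℕ} {M : Type*} [TopologicalSpace M] [ChartedSpace (EuclideanSpace ℝ (Fin n)) M]
  [IsManifold (𝓡 n) ∞ M] {m : ℝ} {α α' : RiemMetric n M} {β β' : OneForm n M}

set_option linter.unusedSectionVars false

theorem length_scaleMetric {f : M → ℝ} (hf : ContMDiff (𝓡 n) 𝓘(ℝ, ℝ) ∞ f) (h0 : ∀ p, 0 < f p)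
    (p : M) (v : TangentSpace (𝓡 n) p) :
    length (scaleMetric f hf h0 α) p v = √(f p) * length α p v :=
  Real.sqrt_mul (h0 p).le _

theorem contMDiff_rpow {f : M → ℝ} (hf : ContMDiff (𝓡 n) 𝓘(ℝ, ℝ) ∞ f) (h0 : ∀ p, 0 < f p)
    (r : ℝ) : ContMDiff (𝓡 n) 𝓘(ℝ, ℝ) ∞ (fun p => f p ^ r) := fun p =>
  (Real.contDiffAt_rpow_const_of_ne (h0 p).ne').contMDiffAt.comp p (hf p)

/-- Every `m`-Kropina metric can be written with a one-form of length one. -/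
theorem exists_hasUnitLength (m : ℝ) (α : RiemMetric n M) (β : OneForm n M)
    (hβ : ∀ p, β.form p ≠ 0) :
    ∃ (α' : RiemMetric n M) (β' : OneForm n M),
      (kropina m α β).Agrees (kropina m α' β') ∧ HasUnitLength α' β' := by
  have hN : ∀ p, 0 < normSq α β p := fun p => normSq_pos (hβ p)
  have hNs := contMDiff_normSq α β
  -- With N the squared length of `β`, the inner product is multiplied by N^m and the form by
  -- N^((m-1)/2). The powers cancel in F, and the new squared length is N^(m-1) · N^(-m) · N = 1.
  refine ⟨scaleMetric _ (contMDiff_rpow hNs hN m) (fun p => Real.rpow_pos_of_pos (hN p) _) α,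
    scaleForm _ (contMDiff_rpow hNs hN ((m - 1) / 2)) β, fun p => ⟨?_, fun v hv => ?_⟩,
    (hasUnitLength_iff _ _).2 fun p => ?_⟩
  · ext v
    exact (mul_pos_iff_of_pos_left (Real.rpow_pos_of_pos (hN p) _)).symm
  · have hb : 0 < β.form p v := hv
    have hl : 0 ≤ length α p v := Real.sqrt_nonneg _
    have hc := hN p
    simp only [kropina, length_scaleMetric]
    rw [show (scaleForm _ (contMDiff_rpow hNs hN ((m - 1) / 2)) β).form p v
      = normSq α β p ^ ((m - 1) / 2) * β.form p v from rfl, Real.sqrt_eq_rpow,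
      ← Real.rpow_mul hc.le, Real.mul_rpow (by positivity) hl,
      Real.mul_rpow (by positivity) hb.le, ← Real.rpow_mul hc.le, ← Real.rpow_mul hc.le]
    have : normSq α β p ^ (m * (1 / 2) * (1 - m)) * normSq α β p ^ ((m - 1) / 2 * m) = 1 := by
      rw [← Real.rpow_add hc]
      convert Real.rpow_zero _ using 2
      ring
    linear_combination (-length α p v ^ (1 - m) * β.form p v ^ m) * this
  · obtain ⟨X, hX⟩ := exists_dual α β p
    have hc := hN p
    set N := normSq α β p with hNdef
    have hX' : ∀ v, (scaleMetric _ (contMDiff_rpow hNs hN m)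
        (fun p => Real.rpow_pos_of_pos (hN p) _) α).inner p
        ((N ^ ((m - 1) / 2) / N ^ m) • X) v
        = (scaleForm _ (contMDiff_rpow hNs hN ((m - 1) / 2)) β).form p v := by
      intro v
      change N ^ m * α.inner p ((N ^ ((m - 1) / 2) / N ^ m) • X) v = N ^ ((m - 1) / 2) * β.form p v
      rw [map_smul, _root_.smul_apply, hX, smul_eq_mul]
      have := (Real.rpow_pos_of_pos hc m).ne'
      field_simp
    rw [normSq_eq_of_dual hX']
    change N ^ ((m - 1) / 2) * β.form p ((N ^ ((m - 1) / 2) / N ^ m) • X) = 1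
    rw [map_smul, ← normSq_eq_of_dual hX, ← hNdef, smul_eq_mul]
    have h2 : N ^ ((m - 1) / 2) * N ^ ((m - 1) / 2) * N = N ^ m := by
      nth_rw 3 [← Real.rpow_one N]
      rw [← Real.rpow_add hc, ← Real.rpow_add hc]
      congr 1
      ring
    have := (Real.rpow_pos_of_pos hc m).ne'
    field_simp
    linear_combination h2

section Local

variable {e : OpenPartialHomeomorph M (EuclideanSpace ℝ (Fin n))} {x y : Euc n}
  {F : SingularMetric n M}

theorem SingularMetric.Agrees.mem_dom_iff (h : F.Agrees (kropina m α β)) :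
    coordVec e x y ∈ F.dom (e.symm x) ↔ 0 < beta (coeffB β e) x y := by
  rw [(h _).1, ← form_coordVec]; rfl

theorem SingularMetric.Agrees.coordFun_eq (h : F.Agrees (kropina m α β))
    (hy : 0 < beta (coeffB β e) x y) : F.coordFun e x y =
      length α (e.symm x) (coordVec e x y) ^ (1 - m) * β.form (e.symm x) (coordVec e x y) ^ m :=
  (h _).2 _ (h.mem_dom_iff.2 hy)

theorem SingularMetric.Agrees.isKropinaEnergy (h : F.Agrees (kropina m α β))
    (he : IsCoord n M e) :
    IsKropinaEnergy m (coeffA α e) (coeffB β e) e.target (F.coordFun e) := by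
  intro x hx y hy
  have hA : 0 ≤ alphaSq (coeffA α e) x y := by
    have := (he.posDef hx α).posSemidef.dotProduct_mulVec_nonneg y.ofLp
    rwa [star_trivial] at this
  rw [energy, h.coordFun_eq hy, length_coordVec, form_coordVec, mul_pow, Real.sqrt_eq_rpow,
    ← Real.rpow_mul hA, ← Real.rpow_natCast, ← Real.rpow_natCast, ← Real.rpow_mul hA,
    ← Real.rpow_mul hy.le]
  congr 2 <;> push_cast <;> ring

end Local

/-- Once the length is one, the given pair is itself flat and parallel; all conditions are local and
are verified in each coordinate system. -/
theorem isFlatParallelForm_of_isOfScalarFlagCurvature (hn : 3 ≤ n) (hm0 : m ≠ 0) (hm1 : m ≠ 1)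
    (hm : m ≠ -1) {F : SingularMetric n M} (hF : F.Agrees (kropina m α β))
    (hu : HasUnitLength α β) (hS : F.IsOfScalarFlagCurvature) : IsFlatParallelForm m F α β := by
  obtain ⟨K, hK⟩ := hS
  have h1 : ∀ e, IsCoord n M e → ∀ x ∈ e.target,
      IsScalarAt m (coeffA α e) (coeffB β e) (F.coordFun e) x := fun e he x hx =>
    (hu.unitPair he).isScalarAt (hF.isKropinaEnergy he) hm1 hx
      (K := fun y => K (e.symm x) (coordVec e x y))
      fun y hy hD i k => hK e he x hx y (hF.mem_dom_iff.2 hy) hD i k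
  have h2 : ∀ e, IsCoord n M e → ∀ x ∈ e.target, covD (coeffA α e) (coeffB β e) x = 0 :=
    fun e he x hx => (hu.unitPair he).covD_eq_zero (hF.isKropinaEnergy he) hn hm0 hm1 hm
      (h1 e he) hx
  refine ⟨hF, fun e he x hx => ?_, fun e he x hx i j => ?_, hu⟩
  · exact (hu.unitPair he).riem_eq_zero (hF.isKropinaEnergy he) hn hm1 (h2 e he) hx (h1 e he x hx)
  · exact congrFun (congrFun (h2 e he x hx) i) j

theorem IsFlatParallelForm.covD_eq_zero {F : SingularMetric n M}
    (h : IsFlatParallelForm m F α β) {e : OpenPartialHomeomorph M (EuclideanSpace ℝ (Fin n))}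
    (he : IsCoord n M e) : ∀ x ∈ e.target, covD (coeffA α e) (coeffB β e) x = 0 :=
  fun x hx => Matrix.ext fun i j => h.2.2.1 e he x hx i j

theorem IsFlatParallelForm.isOfScalarFlagCurvature (hm1 : m ≠ 1) {F : SingularMetric n M}
    (h : IsFlatParallelForm m F α β) : F.IsOfScalarFlagCurvature := by
  refine ⟨fun _ _ => 0, fun e he x hx y hy hD i k => ?_⟩
  rw [zero_mul]
  exact (h.2.2.2.unitPair he).riemCurv_eq_zero (h.1.isKropinaEnergy he) hm1 (h.covD_eq_zero he) hx
    (h.2.1 e he x hx) (h.1.mem_dom_iff.1 hy) hD i k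

end MKropina

end

/-! ### Adapted coordinates on the manifold and uniqueness of the representation. -/

noncomputable section

namespace MKropina

open Filter Topology Matrix

/-- The inverse function theorem, with the domain cut down to V so that the derivative is
invertible, and the inverse smooth, at every point. -/
theorem exists_openPartialHomeomorph {n : ℕ} {φ : Euc n → Euc n} {V : Set (Euc n)} {x₀ : Euc n}
    (hV : IsOpen V) (hx₀ : x₀ ∈ V) (hφ : ContDiffOn ℝ ∞ φ V)
    (hinj : ∀ x ∈ V, Function.Injective (fderiv ℝ φ x)) :
    ∃ ψ : OpenPartialHomeomorph (Euc n) (Euc n), x₀ ∈ ψ.source ∧ ψ.source ⊆ V ∧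
      ContDiffOn ℝ ∞ ψ ψ.source ∧ ContDiffOn ℝ ∞ ψ.symm ψ.target ∧
      ∀ z ∈ ψ.target, ∀ y, fderiv ℝ φ (ψ.symm z) (fderiv ℝ ψ.symm z y) = y := by
  have hat : ∀ x ∈ V, ContDiffAt ℝ ∞ φ x := fun x hx => hφ.contDiffAt (hV.mem_nhds hx)
  have hequiv : ∀ x ∈ V, ∃ f' : Euc n ≃L[ℝ] Euc n, HasFDerivAt φ (f' : Euc n →L[ℝ] Euc n) x := by
    intro x hx
    refine ⟨(LinearEquiv.ofInjectiveEndo (fderiv ℝ φ x : Euc n →ₗ[ℝ] Euc n)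
      (hinj x hx)).toContinuousLinearEquiv, ?_⟩
    have h1 := ((hat x hx).differentiableAt (by simp)).hasFDerivAt
    exact h1.congr_fderiv (ContinuousLinearMap.ext fun y => rfl)
  obtain ⟨f', hf'⟩ := hequiv x₀ hx₀
  set Ψ := (hat x₀ hx₀).toOpenPartialHomeomorph φ hf' (by simp) with hΨ
  have hcoe : (Ψ : Euc n → Euc n) = φ := ContDiffAt.toOpenPartialHomeomorph_coe _ hf' (by simp)
  have hmem : x₀ ∈ Ψ.source := ContDiffAt.mem_toOpenPartialHomeomorph_source _ hf' (by simp)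
  set ψ := Ψ.restrOpen V hV with hψ
  have hcoe' : (ψ : Euc n → Euc n) = φ := hcoe
  have hsub : ψ.source ⊆ V := by
    rw [hψ, OpenPartialHomeomorph.restrOpen_source]
    exact Set.inter_subset_right
  have hs : ∀ z ∈ ψ.target, ContDiffAt ℝ ∞ ψ.symm z := by
    intro z hz
    have hzV := hsub (ψ.map_target hz)
    obtain ⟨g', hg'⟩ := hequiv _ hzV
    exact ψ.contDiffAt_symm hz (by rwa [hcoe']) (by rw [hcoe']; exact hat _ hzV)
  refine ⟨ψ, ?_, hsub, ?_, fun z hz => (hs z hz).contDiffWithinAt, fun z hz y => ?_⟩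
  · rw [hψ, OpenPartialHomeomorph.restrOpen_source]
    exact ⟨hmem, hx₀⟩
  · rw [hcoe']
    exact hφ.mono hsub
  · have h1 := ((hat _ (hsub (ψ.map_target hz))).differentiableAt (by simp)).hasFDerivAt.comp z
      ((hs z hz).differentiableAt (by simp)).hasFDerivAt
    have h2 : HasFDerivAt (φ ∘ ψ.symm) (ContinuousLinearMap.id ℝ (Euc n)) z := by
      refine (hasFDerivAt_id z).congr_of_eventuallyEq ?_
      filter_upwards [ψ.open_target.mem_nhds hz] with w hw
      rw [Function.comp, ← hcoe']
      exact ψ.right_inv hw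
    exact DFunLike.congr_fun (h1.unique h2) y

variable {n : ℕ} {M : Type*} [TopologicalSpace M] [ChartedSpace (EuclideanSpace ℝ (Fin n)) M]
  [IsManifold (𝓡 n) ∞ M] {m : ℝ} {α α' : RiemMetric n M} {β β' : OneForm n M}

set_option linter.unusedSectionVars false

section ChangeOfCoordinates

variable {e : OpenPartialHomeomorph M (EuclideanSpace ℝ (Fin n))}
  {ψ : OpenPartialHomeomorph (EuclideanSpace ℝ (Fin n)) (EuclideanSpace ℝ (Fin n))}

theorem IsCoord.trans (he : IsCoord n M e) (h1 : ContDiffOn ℝ ∞ ψ ψ.source)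
    (h2 : ContDiffOn ℝ ∞ ψ.symm ψ.target) : IsCoord n M (e ≫ₕ ψ) := by
  refine OpenPartialHomeomorph.mem_maximalAtlas_of_contMDiffOn _ ?_ ?_
  · rw [OpenPartialHomeomorph.trans_source]
    exact h1.contMDiffOn.comp ((contMDiffOn_of_mem_maximalAtlas he).mono Set.inter_subset_left)
      fun x hx => hx.2
  · rw [OpenPartialHomeomorph.trans_target]
    exact (contMDiffOn_symm_of_mem_maximalAtlas he).comp
      (h2.contMDiffOn.mono Set.inter_subset_left) fun x hx => hx.2

theorem IsCoord.coordVec_trans (he : IsCoord n M e) (h2 : ContDiffOn ℝ ∞ ψ.symm ψ.target)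
    {z : Euc n} (hz : z ∈ (e ≫ₕ ψ).target) (y : Euc n) :
    coordVec (e ≫ₕ ψ) z y = coordVec e (ψ.symm z) (fderiv ℝ ψ.symm z y) := by
  rw [OpenPartialHomeomorph.trans_target] at hz
  have hd : DifferentiableAt ℝ ψ.symm z :=
    (h2.contDiffAt (ψ.open_target.mem_nhds hz.1)).differentiableAt (by simp)
  have := mfderiv_comp_apply (I := 𝓡 n) (I' := 𝓡 n) (I'' := 𝓡 n) z (f := ψ.symm) (g := e.symm)
    (he.mdifferentiable.symm.mdifferentiableAt hz.2) hd.mdifferentiableAt y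
  rw [mfderiv_eq_fderiv] at this
  exact this

end ChangeOfCoordinates

theorem IsFlatParallelForm.exists_flat_coord {F : SingularMetric n M}
    (h : IsFlatParallelForm m F α β) (i₀ : Fin n) (p : M) :
    ∃ e, IsCoord n M e ∧ p ∈ e.source ∧ ∀ x ∈ e.target, ∀ y : Euc n,
      length α (e.symm x) (coordVec e x y) = ‖y‖ ∧ β.form (e.symm x) (coordVec e x y) = y i₀ := by
  obtain ⟨e, he, hp, -⟩ := exists_coord (n := n) p
  obtain ⟨V, φ, hV, hpV, hVt, hφ, hiso⟩ := (h.2.2.2.unitPair he).exists_flat_coords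
    (h.covD_eq_zero he) (h.2.1 e he) (e.map_source hp) i₀
  -- φ pulls the Euclidean norm back to the positive definite form α², so its derivative has no
  -- kernel.
  have hinj : ∀ x ∈ V, Function.Injective (fderiv ℝ φ x) := by
    intro x hx
    refine (injective_iff_map_eq_zero _).2 fun y hy => ?_
    by_contra hy0
    have h1 := (hiso x hx y).1
    have h2 := (he.posDef (hVt hx) α).dotProduct_mulVec_pos (x := y.ofLp) (by simpa using hy0)
    rw [star_trivial] at h2
    rw [hy, norm_zero, alphaSq, quad] at h1
    linarith
  obtain ⟨ψ, hpψ, hψV, hψ1, hψ2, hinv⟩ := exists_openPartialHomeomorph hV hpV hφ hinj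
  refine ⟨e ≫ₕ ψ, he.trans hψ1 hψ2, ?_, fun z hz y => ?_⟩
  · rw [OpenPartialHomeomorph.trans_source]
    exact ⟨hp, hpψ⟩
  · have hz' := hz
    rw [OpenPartialHomeomorph.trans_target] at hz'
    have hi := hiso _ (hψV (ψ.map_target hz'.1)) (fderiv ℝ ψ.symm z y)
    rw [hinv z hz'.1] at hi
    rw [he.coordVec_trans hψ2 hz]
    constructor
    · refine (length_coordVec (e := e) (x := ψ.symm z) α _).trans ?_
      rw [← hi.1, Real.sqrt_sq (norm_nonneg _)]
    · exact (form_coordVec (e := e) (x := ψ.symm z) β _).trans hi.2.symm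

theorem IsFlatParallelForm.isLocallyMinkowskian {F : SingularMetric n M}
    (h : IsFlatParallelForm m F α β) (i₀ : Fin n) : F.IsLocallyMinkowskian := by
  intro p
  obtain ⟨e, he, hp, hfl⟩ := h.exists_flat_coord i₀ p
  refine ⟨e, he, hp, {y | 0 < y i₀}, fun y => ‖y‖ ^ (1 - m) * y i₀ ^ m, fun x hx y => ?_⟩
  have hb : beta (coeffB β e) x y = y i₀ := by rw [← form_coordVec, (hfl x hx y).2]
  refine ⟨by rw [h.1.mem_dom_iff, hb]; rfl, fun hy => ?_⟩
  rw [h.1.coordFun_eq (by rwa [hb]), (hfl x hx y).1, (hfl x hx y).2]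

section Comparison

theorem inner_nonneg (α : RiemMetric n M) (p : M) (v : TangentSpace (𝓡 n) p) :
    0 ≤ α.inner p v v := by
  rcases eq_or_ne v 0 with rfl | hv
  · simp
  · exact (α.pos p v hv).le

theorem length_sq (α : RiemMetric n M) (p : M) (v : TangentSpace (𝓡 n) p) :
    length α p v ^ 2 = α.inner p v v := Real.sq_sqrt (inner_nonneg α p v)

/-- Two linear forms which are positive at the same vectors are proportional. -/
theorem eq_smul_of_pos_iff {E : Type*} [AddCommGroup E] [Module ℝ E] {f g : E →ₗ[ℝ] ℝ} {v₀ : E}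
    (h : ∀ v, 0 < f v ↔ 0 < g v) (h0 : 0 < f v₀) (v : E) : f v = f v₀ / g v₀ * g v := by
  have hg0 := (h v₀).1 h0
  set w := v - (g v / g v₀) • v₀ with hw
  have hgw : g w = 0 := by
    rw [hw, map_sub, map_smul, smul_eq_mul]
    field_simp
    ring
  have hfw : f w = 0 := by
    by_contra hne
    -- If f(w) ≠ 0, moving v₀ along w reaches f = 0 without changing g, against the equality of the
    -- half-spaces.
    have h1 : 0 < g (v₀ - (f v₀ / f w) • w) := by
      rw [map_sub, map_smul, hgw, smul_zero, sub_zero]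
      exact hg0
    rw [← h, map_sub, map_smul, smul_eq_mul, div_mul_cancel₀ _ hne, sub_self] at h1
    exact lt_irrefl _ h1
  have hv : v = w + (g v / g v₀) • v₀ := by rw [hw]; abel
  conv_lhs => rw [hv, map_add, hfw, map_smul, smul_eq_mul]
  ring

/-- Two inner products whose quadratic forms agree on an open half-space are equal on the
diagonal. -/
theorem inner_self_eq_of_halfspace {p : M} {g : TangentSpace (𝓡 n) p →L[ℝ] ℝ}
    {v₀ : TangentSpace (𝓡 n) p} (h0 : 0 < g v₀) {r : ℝ}
    (h : ∀ v, 0 < g v → α.inner p v v = r * α'.inner p v v) (v : TangentSpace (𝓡 n) p) :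
    α.inner p v v = r * α'.inner p v v := by
  rcases lt_trichotomy (g v) 0 with hv | hv | hv
  · have := h (-v) (by rw [map_neg]; linarith)
    simpa using this
  -- On the boundary hyperplane the parallelogram law expresses the square of v through v₀ ± v and
  -- v₀, which lie in the half-space.
  · have h1 := h (v₀ + v) (by rw [map_add, hv]; linarith)
    have h2 := h (v₀ - v) (by rw [map_sub, hv]; linarith)
    have h3 := h v₀ h0
    simp only [map_add, map_sub, _root_.add_apply, _root_.sub_apply] at h1 h2
    linear_combination (h1 + h2) / 2 - h3
  · exact h v hv

/-- A representation of an `m`-Kropina metric is unique up to a conformal change. -/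
theorem exists_conformal_factor (hm1 : m ≠ 1) (hβ : ∀ p, β.form p ≠ 0)
    (h : (kropina m α β).Agrees (kropina m α' β')) (p : M) :
    ∃ c : ℝ, 0 < c ∧ ∀ v : TangentSpace (𝓡 n) p,
      α.inner p v v = c ^ (-2 * m) * α'.inner p v v ∧ β.form p v = c ^ (1 - m) * β'.form p v := by
  have hm1' : 1 - m ≠ 0 := sub_ne_zero.2 hm1.symm
  have hdom : ∀ v, 0 < β.form p v ↔ 0 < β'.form p v := fun v => Set.ext_iff.1 (h p).1 v
  obtain ⟨v₀, hv₀⟩ : ∃ v₀, 0 < β.form p v₀ := by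
    obtain ⟨w, hw⟩ := DFunLike.ne_iff.1 (hβ p)
    have hw' : β.form p w ≠ 0 := hw
    rcases lt_or_gt_of_ne hw' with hlt | hgt
    · exact ⟨-w, by rw [map_neg]; linarith⟩
    · exact ⟨w, hgt⟩
  have hv₀' := (hdom v₀).1 hv₀
  set k := β.form p v₀ / β'.form p v₀ with hk
  have hk0 : 0 < k := div_pos hv₀ hv₀'
  have hb : ∀ v, β.form p v = k * β'.form p v :=
    eq_smul_of_pos_iff (f := (β.form p).toLinearMap) (g := (β'.form p).toLinearMap) hdom hv₀
  -- The factor is read off from the forms, by c^(1-m) = k. Cancelling the power of β' in the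
  -- equality of the two metrics then determines the ratio of the lengths on the half-space.
  set c := k ^ (1 - m)⁻¹ with hc
  have hc0 : 0 < c := Real.rpow_pos_of_pos hk0 _
  have hck : c ^ (1 - m) = k := by rw [hc, ← Real.rpow_mul hk0.le, inv_mul_cancel₀ hm1', Real.rpow_one]
  refine ⟨c, hc0, fun v => ⟨?_, by rw [hck, hb]⟩⟩
  refine inner_self_eq_of_halfspace hv₀ (fun v hv => ?_) v
  have hv' := (hdom v).1 hv
  have hF : length α p v ^ (1 - m) * β.form p v ^ m = length α' p v ^ (1 - m) * β'.form p v ^ m :=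
    (h p).2 v hv
  have hl : 0 ≤ length α p v := Real.sqrt_nonneg _
  have hl' : 0 ≤ length α' p v := Real.sqrt_nonneg _
  have hcm : 0 < c ^ m := Real.rpow_pos_of_pos hc0 _
  have h1 : (length α p v * c ^ m) ^ (1 - m) = length α' p v ^ (1 - m) := by
    rw [hb, Real.mul_rpow hk0.le hv'.le, ← mul_assoc] at hF
    have hF' := mul_right_cancel₀ (Real.rpow_pos_of_pos hv' m).ne' hF
    rw [Real.mul_rpow hl hcm.le, ← hF', ← hck, ← Real.rpow_mul hc0.le, ← Real.rpow_mul hc0.le,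
      mul_comm m]
  have h2 : length α p v * c ^ m = length α' p v :=
    Real.rpow_left_injOn hm1' (mul_nonneg hl hcm.le) hl' h1
  rw [← length_sq, ← length_sq, ← h2, neg_mul, Real.rpow_neg hc0.le, mul_comm 2 m,
    Real.rpow_mul hc0.le, Real.rpow_two]
  field_simp

/-- Shows that the pointwise factor c is the length of β whenever β' has length one. This makes it
unique and, in `exists_smooth_conformal_factor`, smooth. -/
theorem normSq_eq_of_conformal {p : M} {c : ℝ} (hc : 0 < c)
    (h : ∀ v : TangentSpace (𝓡 n) p,
      α.inner p v v = c ^ (-2 * m) * α'.inner p v v ∧ β.form p v = c ^ (1 - m) * β'.form p v) :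
    normSq α β p = c ^ 2 * normSq α' β' p := by
  obtain ⟨X, hX⟩ := exists_dual α' β' p
  -- Polarisation, needed because the hypothesis speaks of squares only. The dual vector then scales
  -- by c^(1+m).
  have hpol : ∀ v w, α.inner p v w = c ^ (-2 * m) * α'.inner p v w := by
    intro v w
    have h1 := (h (v + w)).1
    simp only [map_add, _root_.add_apply] at h1
    have h2 := α.symm p v w
    have h3 := α'.symm p v w
    linear_combination (h1 - (h v).1 - (h w).1 + h2 - c ^ (-2 * m) * h3) / 2
  have e1 : c ^ (-2 * m) * c ^ (1 + m) = c ^ (1 - m) := by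
    rw [← Real.rpow_add hc]; congr 1; ring
  have hX' : ∀ v, α.inner p (c ^ (1 + m) • X) v = β.form p v := by
    intro v
    rw [map_smul, _root_.smul_apply, smul_eq_mul, hpol, hX, (h v).2]
    linear_combination β'.form p v * e1
  rw [normSq_eq_of_dual hX', normSq_eq_of_dual hX, map_smul, smul_eq_mul, (h X).2, ← mul_assoc,
    ← Real.rpow_add hc, ← Real.rpow_two]
  congr 2
  ring

theorem exists_smooth_conformal_factor (hm1 : m ≠ 1) (hβ : ∀ p, β.form p ≠ 0)
    (h : (kropina m α β).Agrees (kropina m α' β')) (hu : HasUnitLength α' β') :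
    ∃ c : M → ℝ, ContMDiff (𝓡 n) 𝓘(ℝ, ℝ) ∞ c ∧ (∀ p, 0 < c p) ∧
      ∀ (p : M) (v : TangentSpace (𝓡 n) p),
        length α p v = c p ^ (-m) * length α' p v ∧ β.form p v = c p ^ (1 - m) * β'.form p v := by
  have hN : ∀ p, 0 < normSq α β p := fun p => normSq_pos (hβ p)
  refine ⟨fun p => normSq α β p ^ (1 / 2 : ℝ), contMDiff_rpow (contMDiff_normSq α β) hN _,
    fun p => Real.rpow_pos_of_pos (hN p) _, fun p v => ?_⟩
  obtain ⟨c, hc, hcv⟩ := exists_conformal_factor hm1 hβ h p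
  have h1 : normSq α β p ^ (1 / 2 : ℝ) = c := by
    rw [normSq_eq_of_conformal hc hcv, (hasUnitLength_iff α' β').1 hu, mul_one,
      ← Real.sqrt_eq_rpow, Real.sqrt_sq hc.le]
  simp only [h1]
  refine ⟨?_, (hcv v).2⟩
  rw [length, (hcv v).1, Real.sqrt_mul (Real.rpow_pos_of_pos hc _).le, Real.sqrt_eq_rpow,
    ← Real.rpow_mul hc.le, length]
  congr 2
  ring

end Comparison

end MKropina

end

theorem theorem1p1 {n : ℕ} (hn : 3 ≤ n) {M : Type*} [TopologicalSpace M]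
    [ChartedSpace (EuclideanSpace ℝ (Fin n)) M] [IsManifold (𝓡 n) ∞ M]
    (m : ℝ) (hm0 : m ≠ 0) (hm1 : m ≠ 1) (hm : m ≠ -1)
    (α : MKropina.RiemMetric n M) (β : MKropina.OneForm n M) (hβ : ∀ p, β.form p ≠ 0) :
    ((MKropina.kropina m α β).IsOfScalarFlagCurvature ↔
      ∃ (α' : MKropina.RiemMetric n M) (β' : MKropina.OneForm n M),
        MKropina.IsFlatParallelForm m (MKropina.kropina m α β) α' β') ∧
    (∀ (α' : MKropina.RiemMetric n M) (β' : MKropina.OneForm n M),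
      MKropina.IsFlatParallelForm m (MKropina.kropina m α β) α' β' →
        (MKropina.kropina m α β).IsLocallyMinkowskian ∧
        (∀ p : M, ∃ e, MKropina.IsCoord n M e ∧ p ∈ e.source ∧
          ∀ x ∈ e.target, ∀ y : EuclideanSpace ℝ (Fin n),
            MKropina.length α' (e.symm x) (MKropina.coordVec e x y) = ‖y‖ ∧
            β'.form (e.symm x) (MKropina.coordVec e x y) = y ⟨0, by omega⟩) ∧
        ∃ c : M → ℝ, ContMDiff (𝓡 n) 𝓘(ℝ, ℝ) ∞ c ∧ (∀ p, 0 < c p) ∧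
          ∀ (p : M) (v : TangentSpace (𝓡 n) p),
            MKropina.length α p v = c p ^ (-m) * MKropina.length α' p v ∧
            β.form p v = c p ^ (1 - m) * β'.form p v) := by
  refine ⟨⟨fun hS => ?_, fun ⟨α', β', h⟩ => h.isOfScalarFlagCurvature hm1⟩, fun α' β' h => ?_⟩
  · obtain ⟨α', β', hF, hu⟩ := MKropina.exists_hasUnitLength m α β hβ
    exact ⟨α', β',
      MKropina.isFlatParallelForm_of_isOfScalarFlagCurvature hn hm0 hm1 hm hF hu hS⟩
  · exact ⟨h.isLocallyMinkowskian ⟨0, by omega⟩, h.exists_flat_coord ⟨0, by omega⟩,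
      MKropina.exists_smooth_conformal_factor hm1 hβ h.1 h.2.2.2⟩
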